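/- Let $d\ge 0$ be an integer and let $X_i\subset[0,1]^d$, $i\in\mathcal I$, be a finite collection of sets, each of which is a finite union of rectangles with edges parallel to the axes (that is, of products $I_1\times\dots\times I_d$ of bounded intervals, which may be open, closed, half-open, degenerate or empty). For $\xi\in\mathbb Z^d$ put $e_\xi(x)=e^{2\pi i\langle \xi,x\rangle}$, and for $\Xi\subset\mathbb Z^d$ put $e(\Xi)=\{e_\xi\}_{\xi\in\Xi}$. A system of vectors in a Hilbert space $H$ is called a Riesz basis of $H$ if it is the image of an orthonormal basis of $H$ under a bounded invertible operator on $H$. Then $(X_i)_{i\in\mathcal I}$ has a coherent collection of Riesz bases: there exist sets $\Xi_i\subset\mathbb Z^d$, $i\in\mathcal I$, such that (i) for every $i\in\mathcal I$, $e(\Xi_i)$ is a Riesz basis of $L^2(X_i)$ (with respect to Lebesgue measure on $X_i$), and (ii) for all $i,j\in\mathcal I$, if $X_i\subset X_j$ then $\Xi_i\subset\Xi_j$. -/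

import Mathlib

open MeasureTheory

noncomputable section

/-- A family `f` of vectors in a Hilbert space `H` is a Riesz basis if it is the image of an
orthonormal basis of `H` under a bounded invertible operator on `H`. -/
def IsRieszBasis {ι H : Type*} [NormedAddCommGroup H] [InnerProductSpace ℂ H]
    (f : ι → H) : Prop :=
  ∃ (b : HilbertBasis ι ℂ H) (T : H ≃L[ℂ] H), ∀ i, f i = T (b i)

/-- The exponential `e_ξ(x) = exp (2 π i ⟨ξ, x⟩)` on `ℝ^d` with integer frequency `ξ ∈ ℤ^d`. -/
def expFun {d : ℕ} (ξ : Fin d → ℤ) (x : Fin d → ℝ) : ℂ :=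
  Complex.exp (2 * Real.pi * Complex.I * ((∑ k, (ξ k : ℝ) * x k : ℝ) : ℂ))

/-- `e(Ξ)` is a Riesz basis of `L²(X)`, where `X ⊆ ℝ^d` carries Lebesgue measure: the
exponentials with frequencies in `Ξ` are square integrable on `X`, and their classes
form a Riesz basis of `L²(X)`. -/
def IsExpRieszBasis {d : ℕ} (Ξ : Set (Fin d → ℤ)) (X : Set (Fin d → ℝ)) : Prop :=
  ∃ h : ∀ ξ : Ξ, MemLp (expFun ξ.1) 2 (volume.restrict X),
    IsRieszBasis (H := Lp ℂ 2 (volume.restrict X)) (fun ξ : Ξ => (h ξ).toLp (expFun ξ.1))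

/-- An axis-parallel rectangle in `ℝ^d`: a product of bounded intervals
(open, closed or half-open, possibly degenerate). -/
def IsRectangle {d : ℕ} (R : Set (Fin d → ℝ)) : Prop :=
  ∃ I : Fin d → Set ℝ,
    (∀ k, (I k).OrdConnected ∧ Bornology.IsBounded (I k)) ∧ R = Set.univ.pi I

/-- A finite union of axis-parallel rectangles. -/
def IsFiniteUnionOfRectangles {d : ℕ} (X : Set (Fin d → ℝ)) : Prop :=
  ∃ S : Set (Set (Fin d → ℝ)), S.Finite ∧ (∀ R ∈ S, IsRectangle R) ∧ X = ⋃₀ S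

/-- `Ξ` is a coherent collection of Riesz bases for the family of sets `X`. -/
def IsCoherentCollection {ι : Type*} {d : ℕ} (X : ι → Set (Fin d → ℝ))
    (Ξ : ι → Set (Fin d → ℤ)) : Prop :=
  (∀ i, IsExpRieszBasis (Ξ i) (X i)) ∧ ∀ i j, X i ⊆ X j → Ξ i ⊆ Ξ j

end

/-! For `X` inside the unit cube, `e(Ξ)` is a Riesz basis of `L²(X)` as soon as two lower bounds
hold: the energy over the cube of a trigonometric polynomial is controlled by its energy on `X` if
its frequencies lie in `Ξ`, and by its energy on the complement of `X` if they avoid `Ξ`. The first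
bound makes the synthesis map injective with closed range; the second, applied to a function that
lives on `X` and is orthogonal to `e(Ξ)`, gives completeness (`isRieszBasis_of_split`). The
endpoints of all rectangles generate one finite grid, so it suffices to attach to every union of
grid atoms, monotonically, a frequency set with both bounds (`exists_coherent_grid`).

This goes by induction on the dimension. In the first variable a polynomial is a trigonometric sum
with values in polynomials of fewer variables, and a union of atoms is a step function `σ` on the
circle whose values are sets of lower dimensional atoms. What is needed is `Good`: a monotone choice
of frequencies for all step functions with prescribed jumps. Two operations transport such a choice
from a smaller circle to a larger one.

Folding (`Good.fold`) passes from length `ℓ / N` to `ℓ`: the residue class `i` modulo `N` receives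
the frequencies chosen for the set over which more than `i` of the `N` translates belong to `σ`. It
works because any `k` rows and the first, or last, `k` columns of the Fourier matrix form an
invertible Vandermonde type matrix.

The short circle (`Good.of_short_circle`) treats jumps confined to an interval of length `ℓ`, much
shorter than the period `L`, outside which `σ` is a constant `B`. Two disjoint copies of `ℤ`, both
close to the frequencies of the short circle, carry the choices for `σ ∪ B` and `σ ∩ B`; all other
frequencies carry the choice for `B`. Paley–Wiener stability makes the displacement of frequencies
harmless when the interval is close enough to the origin.

The arithmetic is in `goodNear`, an induction on the dimension of the rational span of the jumps and
the period. Jumps commensurable with the period disappear after one folding. Otherwise, remove from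
each jump a rational multiple of the period. Kronecker's theorem gives `N` such that, modulo `ℓ /
N`, the jumps lie close to a tiny dilate of these remainders. Folding by `N` and the short circle
then lead to a problem whose data lie in a smaller rational space. Since the dilate is only
approximate, the induction carries a statement stable under small `ℚ`-linear perturbations and under
scaling (`GoodNear`), with a constant known before the size of the dilate is fixed. -/

namespace CoherentRiesz

open MeasureTheory

noncomputable section

set_option linter.unusedSectionVars false

/-! ### Fourier analysis on a circle of length `ℓ`, with vector valued coefficients. -/

/-- The character `s ↦ exp (2 π i s)` of the real line. -/
def ex (s : ℝ) : ℂ := Complex.exp (2 * Real.pi * Complex.I * (s : ℂ))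

lemma ex_add (s t : ℝ) : ex (s + t) = ex s * ex t := by
  simp only [ex, ← Complex.exp_add]; congr 1; push_cast; ring

@[simp] lemma ex_zero : ex 0 = 1 := by simp [ex]

@[simp] lemma norm_ex (s : ℝ) : ‖ex s‖ = 1 := by
  have : (2 * Real.pi * Complex.I * (s : ℂ)) = ((2 * Real.pi * s : ℝ) : ℂ) * Complex.I := by
    push_cast; ring
  rw [ex, this, Complex.norm_exp_ofReal_mul_I]

lemma ex_ne_zero (s : ℝ) : ex s ≠ 0 := Complex.exp_ne_zero _

lemma ex_neg (s : ℝ) : ex (-s) = (starRingEnd ℂ) (ex s) := by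
  rw [ex, ex, ← Complex.exp_conj]; congr 1; simp [map_ofNat]

@[simp] lemma ex_int (n : ℤ) : ex n = 1 := by
  rw [ex, Complex.exp_eq_one_iff]; exact ⟨n, by push_cast; ring⟩

lemma ex_add_int (s : ℝ) (n : ℤ) : ex (s + n) = ex s := by rw [ex_add, ex_int, mul_one]

lemma ex_eq_one_iff (s : ℝ) : ex s = 1 ↔ ∃ n : ℤ, s = n := by
  constructor
  · intro h
    rw [ex, Complex.exp_eq_one_iff] at h
    obtain ⟨n, hn⟩ := h
    refine ⟨n, ?_⟩
    have h2 : (2 * Real.pi * Complex.I : ℂ) ≠ 0 := by simp [Real.pi_ne_zero]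
    have : (s : ℂ) = (n : ℂ) := mul_left_cancel₀ h2 (by rw [hn]; ring)
    exact_mod_cast this
  · rintro ⟨n, rfl⟩; simp

@[fun_prop] lemma continuous_ex : Continuous ex := by unfold ex; fun_prop

lemma hasDerivAt_ex (s : ℝ) : HasDerivAt ex (2 * Real.pi * Complex.I * ex s) s := by
  have h : HasDerivAt (fun z : ℂ => Complex.exp (2 * Real.pi * Complex.I * z))
      (Complex.exp (2 * Real.pi * Complex.I * (s : ℂ)) * (2 * Real.pi * Complex.I)) (s : ℂ) := by
    simpa using ((hasDerivAt_id (s : ℂ)).const_mul (2 * Real.pi * Complex.I : ℂ)).cexp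
  convert! h.comp_ofReal using 1
  rw [ex, mul_comm]

lemma integral_ex {ℓ : ℝ} (hℓ : 0 < ℓ) (n : ℤ) (a : ℝ) :
    ∫ t in a..a + ℓ, ex (n * t / ℓ) = if n = 0 then (ℓ : ℂ) else 0 := by
  split_ifs with h
  · subst h; simp
  · have hc : (2 * Real.pi * Complex.I * (n / ℓ : ℝ) : ℂ) ≠ 0 := by
      simp [Real.pi_ne_zero, h, hℓ.ne']
    have hd : ∀ t : ℝ, HasDerivAt (fun t : ℝ => ex (n * t / ℓ) / (2 * Real.pi * Complex.I * (n / ℓ : ℝ)))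
        (ex (n * t / ℓ)) t := by
      intro t
      have h1 : HasDerivAt (fun t : ℝ => n * t / ℓ) (n / ℓ) t := by
        simpa using ((hasDerivAt_id t).const_mul (n : ℝ)).div_const ℓ
      have h2 := ((hasDerivAt_ex (n * t / ℓ)).scomp t h1).div_const
        (2 * Real.pi * Complex.I * (n / ℓ : ℝ))
      convert! h2 using 1
      have h3 : ((n / ℓ : ℝ) : ℂ) ≠ 0 := by
        rw [Ne, Complex.ofReal_eq_zero]; exact div_ne_zero (by exact_mod_cast h) hℓ.ne'
      rw [Complex.real_smul, eq_div_iff hc]; ring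
    rw [intervalIntegral.integral_eq_sub_of_hasDerivAt (fun t _ => hd t)
      (Continuous.intervalIntegrable (by fun_prop) _ _)]
    have : (n : ℝ) * (a + ℓ) / ℓ = n * a / ℓ + n := by field_simp
    rw [this, ex_add_int, sub_self]

section TrigSum
variable {K : Type*} [NormedAddCommGroup K] [InnerProductSpace ℂ K]

/-- The vector valued trigonometric sum with period `ℓ`, frequencies in `S` and coefficients `v`. -/
def trigSum (ℓ : ℝ) (S : Finset ℤ) (v : ℤ → K) (t : ℝ) : K := ∑ l ∈ S, ex (l * t / ℓ) • v l

@[fun_prop] lemma continuous_trigSum (ℓ : ℝ) (S : Finset ℤ) (v : ℤ → K) :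
    Continuous (trigSum ℓ S v) := by unfold trigSum; fun_prop

lemma trigSum_periodic {ℓ : ℝ} (hℓ : ℓ ≠ 0) (S : Finset ℤ) (v : ℤ → K) :
    Function.Periodic (trigSum ℓ S v) ℓ := by
  intro t
  unfold trigSum
  refine Finset.sum_congr rfl fun l _ => ?_
  have : (l : ℝ) * (t + ℓ) / ℓ = l * t / ℓ + l := by field_simp
  rw [this, ex_add_int]

lemma norm_trigSum_le (ℓ : ℝ) (S : Finset ℤ) (v : ℤ → K) (t : ℝ) :
    ‖trigSum ℓ S v t‖ ≤ ∑ l ∈ S, ‖v l‖ :=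
  (norm_sum_le _ _).trans (Finset.sum_le_sum fun l _ => by rw [norm_smul, norm_ex, one_mul])

lemma integral_norm_sq_trigSum {ℓ : ℝ} (hℓ : 0 < ℓ) (a : ℝ) (S : Finset ℤ) (v : ℤ → K) :
    ∫ t in a..a + ℓ, ‖trigSum ℓ S v t‖ ^ 2 = ℓ * ∑ l ∈ S, ‖v l‖ ^ 2 := by
  have key : ∀ t, ((‖trigSum ℓ S v t‖ ^ 2 : ℝ) : ℂ) =
      ∑ k ∈ S, ∑ l ∈ S, inner ℂ (v k) (v l) * ex ((l - k : ℤ) * t / ℓ) := by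
    intro t
    have h0 : ((‖trigSum ℓ S v t‖ ^ 2 : ℝ) : ℂ) = inner ℂ (trigSum ℓ S v t) (trigSum ℓ S v t) := by
      rw [inner_self_eq_norm_sq_to_K]; norm_cast
    rw [h0, trigSum, sum_inner]
    refine Finset.sum_congr rfl fun k _ => ?_
    rw [inner_sum]
    refine Finset.sum_congr rfl fun l _ => ?_
    rw [inner_smul_left, inner_smul_right, ← ex_neg]
    have : ((l - k : ℤ) : ℝ) * t / ℓ = -(k * t / ℓ) + l * t / ℓ := by push_cast; ring
    rw [this, ex_add]; ring
  have h : ((∫ t in a..a + ℓ, ‖trigSum ℓ S v t‖ ^ 2 : ℝ) : ℂ) = ((ℓ * ∑ l ∈ S, ‖v l‖ ^ 2 : ℝ) : ℂ) := by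
    rw [← intervalIntegral.integral_ofReal]
    simp only [key]
    rw [intervalIntegral.integral_finsetSum
      (fun k _ => Continuous.intervalIntegrable (by fun_prop) _ _)]
    rw [Complex.ofReal_mul, Complex.ofReal_sum, Finset.mul_sum]
    refine Finset.sum_congr rfl fun k hk => ?_
    rw [intervalIntegral.integral_finsetSum
      (fun l _ => Continuous.intervalIntegrable (by fun_prop) _ _)]
    simp only [intervalIntegral.integral_const_mul]
    rw [Finset.sum_eq_single_of_mem k hk]
    · rw [integral_ex hℓ, sub_self, if_pos rfl, inner_self_eq_norm_sq_to_K, mul_comm]; simp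
    · intro l _ hlk
      rw [integral_ex hℓ, if_neg (sub_ne_zero.2 hlk), mul_zero]
  exact_mod_cast h

end TrigSum

lemma hasSum_norm_sq_integral_ex {ℓ : ℝ} (hℓ : 0 < ℓ) (a : ℝ) {w : ℝ → ℂ}
    (hw : MemLp w 2 (volume.restrict (Set.Ioc a (a + ℓ)))) :
    HasSum (fun k : ℤ => ‖∫ t in a..a + ℓ, ex (-(k * t / ℓ)) * w t‖ ^ 2)
      (ℓ * ∫ t in a..a + ℓ, ‖w t‖ ^ 2) := by
  have h := (hasSum_sq_fourierCoeffOn (by linarith : a < a + ℓ) hw).mul_left (ℓ ^ 2)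
  convert! h using 1
  · funext k
    rw [fourierCoeffOn_eq_integral, norm_smul, mul_pow, ← mul_assoc]
    have h1 : ℓ ^ 2 * ‖1 / (a + ℓ - a)‖ ^ 2 = 1 := by
      rw [add_sub_cancel_left, norm_div, norm_one, Real.norm_of_nonneg hℓ.le]; field_simp
    rw [h1, one_mul]
    congr 3
    funext t
    rw [fourier_coe_apply, smul_eq_mul, add_sub_cancel_left, ex]
    congr 2; push_cast; ring
  · rw [add_sub_cancel_left, smul_eq_mul]; field_simp

lemma memLp_two_of_bounded {w : ℝ → ℂ} (hw : Measurable w) {M : ℝ} (hM : ∀ t, ‖w t‖ ≤ M) (a b : ℝ)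
    (p : ENNReal := 2) :
    MemLp w p (volume.restrict (Set.Ioc a b)) :=
  MemLp.of_bound hw.aestronglyMeasurable M (Filter.Eventually.of_forall hM)

lemma sum_norm_sq_integral_ex_le {ℓ : ℝ} (hℓ : 0 < ℓ) (a : ℝ) {w : ℝ → ℂ}
    (hw : Measurable w) {M : ℝ} (hM : ∀ t, ‖w t‖ ≤ M) (S : Finset ℤ) :
    ∑ k ∈ S, ‖∫ t in a..a + ℓ, ex (-(k * t / ℓ)) * w t‖ ^ 2 ≤ ℓ * ∫ t in a..a + ℓ, ‖w t‖ ^ 2 :=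
  sum_le_hasSum S (fun _ _ => by positivity)
    (hasSum_norm_sq_integral_ex hℓ a (memLp_two_of_bounded hw hM _ _))

lemma intervalIntegrable_of_bounded {E : Type*} [NormedAddCommGroup E] {w : ℝ → E}
    (hw : StronglyMeasurable w) {M : ℝ} (hM : ∀ t, ‖w t‖ ≤ M) (a b : ℝ) :
    IntervalIntegrable w volume a b := by
  have : IntervalIntegrable (fun _ : ℝ => M) volume a b := by simp
  exact this.mono_fun hw.aestronglyMeasurable
    (Filter.Eventually.of_forall fun t => (hM t).trans (le_abs_self M))

/-! ### Stability under small displacements of the frequencies. -/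

lemma hasDerivAt_integral_ex {φ : ℝ → ℂ} (hφ : Measurable φ) {M : ℝ} (hM : ∀ t, ‖φ t‖ ≤ M)
    {R : ℝ} {a b : ℝ} (hR : ∀ t ∈ Set.uIoc a b, |t| ≤ R) (s₀ : ℝ) :
    HasDerivAt (fun s => ∫ t in a..b, φ t * ex (-(s * t)))
      (∫ t in a..b, φ t * (-(2 * Real.pi * Complex.I * t) * ex (-(s₀ * t)))) s₀ := by
  have hM0 : 0 ≤ M := (norm_nonneg _).trans (hM 0)
  refine (intervalIntegral.hasDerivAt_integral_of_dominated_loc_of_deriv_le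
    (F := fun s t => φ t * ex (-(s * t)))
    (F' := fun s t => φ t * (-(2 * Real.pi * Complex.I * t) * ex (-(s * t))))
    (bound := fun _ => M * (2 * Real.pi * R)) Filter.univ_mem ?_ ?_ ?_ ?_ ?_ ?_).2
  · refine Filter.Eventually.of_forall fun s => Measurable.aestronglyMeasurable ?_
    fun_prop
  · refine intervalIntegrable_of_bounded (M := M) (Measurable.stronglyMeasurable (by fun_prop)) ?_ _ _
    intro t; simpa using hM t
  · exact Measurable.aestronglyMeasurable (by fun_prop)
  · refine Filter.Eventually.of_forall fun t ht s _ => ?_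
    have := hR t ht
    simp only [norm_mul, norm_neg, norm_ex, mul_one, Complex.norm_I, Complex.norm_real,
      Complex.norm_ofNat, Real.norm_eq_abs, abs_of_pos Real.pi_pos]
    gcongr
    exact hM t
  · simp
  · refine Filter.Eventually.of_forall fun t ht s _ => ?_
    have h1 : HasDerivAt (fun s : ℝ => -(s * t)) (-t) s := by
      simpa using ((hasDerivAt_id s).mul_const t).fun_neg
    convert! ((hasDerivAt_ex (-(s * t))).scomp s h1).const_mul (φ t) using 2
    rw [Complex.real_smul]; push_cast; ring

/-- Expanding the nonnegative integral of `(f - m) ^ 2`, where `m` is the mean of `f`, gives this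
case of Cauchy–Schwarz. -/
lemma sq_integral_le {f : ℝ → ℝ} (hf : Continuous f) {a b : ℝ} (hab : a ≤ b) :
    (∫ t in a..b, f t) ^ 2 ≤ (b - a) * ∫ t in a..b, f t ^ 2 := by
  rcases hab.eq_or_lt with rfl | hlt
  · simp
  have hpos : 0 < b - a := by linarith
  set m := (∫ t in a..b, f t) / (b - a) with hm
  have h0 : 0 ≤ ∫ t in a..b, (f t - m) ^ 2 :=
    intervalIntegral.integral_nonneg hab fun t _ => sq_nonneg _
  have h1 : ∫ t in a..b, (f t - m) ^ 2 =
      (∫ t in a..b, f t ^ 2) - 2 * m * (∫ t in a..b, f t) + m ^ 2 * (b - a) := by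
    have : ∀ t, (f t - m) ^ 2 = f t ^ 2 - 2 * m * f t + m ^ 2 := fun t => by ring
    simp only [this]
    rw [intervalIntegral.integral_add (Continuous.intervalIntegrable (by fun_prop) _ _)
      (Continuous.intervalIntegrable (by fun_prop) _ _),
      intervalIntegral.integral_sub (Continuous.intervalIntegrable (by fun_prop) _ _)
      (Continuous.intervalIntegrable (by fun_prop) _ _), intervalIntegral.integral_const_mul]
    simp; ring
  have h2 : (∫ t in a..b, f t) = m * (b - a) := by rw [hm]; field_simp
  rw [h1, h2] at h0
  rw [h2]
  nlinarith [mul_nonneg hpos.le h0]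

/-- Sobolev type bound: a function on `[-κ, κ]` varies by at most the `L²` norm of its derivative. -/
lemma norm_sub_sq_le {G g : ℝ → ℂ} (hG : ∀ s, HasDerivAt G (g s) s) (hg : Continuous g) {κ s : ℝ}
    (hs : |s| ≤ κ) : ‖G s - G 0‖ ^ 2 ≤ 8 * κ * ∫ r in (-κ)..κ, ‖g r‖ ^ 2 := by
  have hκ : 0 ≤ κ := (abs_nonneg s).trans hs
  -- Both values are compared with the one at `-κ`. Each comparison costs `2 * κ`, and squaring the
  -- triangle inequality doubles the sum, whence `8 * κ`.
  have key : ∀ x, |x| ≤ κ → ‖G x - G (-κ)‖ ^ 2 ≤ 2 * κ * ∫ r in (-κ)..κ, ‖g r‖ ^ 2 := by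
    intro x hx
    rw [abs_le] at hx
    rw [← intervalIntegral.integral_eq_sub_of_hasDerivAt (fun t _ => hG t)
      (hg.intervalIntegrable _ _)]
    have h1 : ‖∫ r in (-κ)..x, g r‖ ≤ ∫ r in (-κ)..x, ‖g r‖ :=
      intervalIntegral.norm_integral_le_integral_norm hx.1
    have h2 := sq_integral_le hg.norm hx.1
    have h3 : ∫ r in (-κ)..x, ‖g r‖ ^ 2 ≤ ∫ r in (-κ)..κ, ‖g r‖ ^ 2 :=
      intervalIntegral.integral_mono_interval le_rfl hx.1 hx.2
        (Filter.Eventually.of_forall fun t => by positivity)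
        (Continuous.intervalIntegrable (by fun_prop) _ _)
    have h4 : 0 ≤ ∫ r in (-κ)..x, ‖g r‖ ^ 2 :=
      intervalIntegral.integral_nonneg hx.1 fun t _ => by positivity
    calc ‖∫ r in (-κ)..x, g r‖ ^ 2 ≤ (∫ r in (-κ)..x, ‖g r‖) ^ 2 := by gcongr
      _ ≤ (x - -κ) * ∫ r in (-κ)..x, ‖g r‖ ^ 2 := h2
      _ ≤ (2 * κ) * ∫ r in (-κ)..κ, ‖g r‖ ^ 2 := by gcongr; linarith
  have h1 := key s hs
  have h2 := key 0 (by simpa using hκ)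
  have h3 : ‖G s - G 0‖ ≤ ‖G s - G (-κ)‖ + ‖G 0 - G (-κ)‖ := by
    have : G s - G 0 = (G s - G (-κ)) - (G 0 - G (-κ)) := by ring
    rw [this]; exact norm_sub_le _ _
  nlinarith [sq_nonneg (‖G s - G (-κ)‖ - ‖G 0 - G (-κ)‖), norm_nonneg (G s - G 0)]

/-- Perturbing the frequencies by at most `κ` changes the Fourier coefficients of a function
supported where `|t| ≤ R` only slightly in `ℓ²`. -/
lemma sum_norm_sq_integral_perturb_le {ℓ : ℝ} (hℓ : 0 < ℓ) (a : ℝ) {w : ℝ → ℂ}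
    (hw : Measurable w) {M : ℝ} (hM : ∀ t, ‖w t‖ ≤ M) {R κ : ℝ}
    (hR : ∀ t ∈ Set.uIoc a (a + ℓ), |t| ≤ R) (η : ℤ → ℝ) (hη : ∀ k, |η k| ≤ κ) (S : Finset ℤ) :
    ∑ k ∈ S, ‖∫ t in a..a + ℓ, (ex (-((k / ℓ + η k) * t)) - ex (-(k * t / ℓ))) * w t‖ ^ 2 ≤
      (64 * Real.pi ^ 2 * κ ^ 2 * R ^ 2) * (ℓ * ∫ t in a..a + ℓ, ‖w t‖ ^ 2) := by
  have hκ : 0 ≤ κ := (abs_nonneg _).trans (hη 0)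
  have hM0 : 0 ≤ M := (norm_nonneg _).trans (hM 0)
  set φ : ℤ → ℝ → ℂ := fun k t => ex (-(k * t / ℓ)) * w t with hφ
  have hφm : ∀ k, Measurable (φ k) := fun k => by fun_prop
  have hφM : ∀ k t, ‖φ k t‖ ≤ M := fun k t => by simpa [hφ] using hM t
  set G : ℤ → ℝ → ℂ := fun k s => ∫ t in a..a + ℓ, φ k t * ex (-(s * t)) with hG
  -- the function `t w(t)`, cut off outside the interval
  set w1 : ℝ → ℂ := fun t => (Set.uIoc a (a + ℓ)).indicator
    (fun t => -(2 * Real.pi * Complex.I * t) * w t) t with hw1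
  have hw1m : Measurable w1 := Measurable.indicator (by fun_prop) measurableSet_uIoc
  have hw1b : ∀ t, ‖w1 t‖ ≤ 2 * Real.pi * R * ‖w t‖ := by
    intro t
    by_cases ht : t ∈ Set.uIoc a (a + ℓ)
    · have := hR t ht
      simp only [hw1, Set.indicator_of_mem ht, norm_mul, norm_neg, Complex.norm_I,
        Complex.norm_real, Complex.norm_ofNat, Real.norm_eq_abs, abs_of_pos Real.pi_pos, mul_one]
      gcongr
    · have hR0 : 0 ≤ R := (abs_nonneg _).trans (hR (a + ℓ) (by
        rw [Set.uIoc_of_le (by linarith)]; simp [hℓ]))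
      simp only [hw1, Set.indicator_of_notMem ht, norm_zero]
      have := Real.pi_pos
      positivity
  have hR0 : 0 ≤ R := (abs_nonneg _).trans (hR (a + ℓ) (by
        rw [Set.uIoc_of_le (by linarith)]; simp [hℓ]))
  have hw1M : ∀ t, ‖w1 t‖ ≤ 2 * Real.pi * R * M := fun t => (hw1b t).trans (by
    have := hM t; have := Real.pi_pos; gcongr)
  set g : ℤ → ℝ → ℂ := fun k s => ∫ t in a..a + ℓ, (ex (-(k * t / ℓ)) * w1 t) * ex (-(s * t)) with hg
  have hGd : ∀ k s, HasDerivAt (G k) (g k s) s := by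
    intro k s
    have h := hasDerivAt_integral_ex (hφm k) (hφM k) hR s
    convert! h using 1
    refine intervalIntegral.integral_congr_ae (Filter.Eventually.of_forall fun t ht => ?_)
    simp only [hw1, Set.indicator_of_mem ht, hφ]; ring
  have hgc : ∀ k, Continuous (g k) := by
    intro k
    have : Differentiable ℝ (g k) := fun s =>
      (hasDerivAt_integral_ex (φ := fun t => ex (-(k * t / ℓ)) * w1 t) (M := 2 * Real.pi * R * M)
        (by fun_prop) (fun t => by simpa using hw1M t) hR s).differentiableAt
    exact this.continuous
  -- For fixed `s` the numbers `g k s` are Fourier coefficients of the single function `w1 t * ex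
  -- (-(s * t))`, so Bessel applies uniformly in `s`.
  have hbessel : ∀ s, ∑ k ∈ S, ‖g k s‖ ^ 2 ≤
      (4 * Real.pi ^ 2 * R ^ 2) * (ℓ * ∫ t in a..a + ℓ, ‖w t‖ ^ 2) := by
    intro s
    have h := sum_norm_sq_integral_ex_le hℓ a (w := fun t => w1 t * ex (-(s * t)))
      (M := 2 * Real.pi * R * M) (by fun_prop) (fun t => by simpa using hw1M t) S
    have e1 : ∀ k : ℤ, (∫ t in a..a + ℓ, ex (-(k * t / ℓ)) * (w1 t * ex (-(s * t)))) = g k s := by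
      intro k; simp only [hg, mul_assoc]
    simp only [e1, norm_mul, norm_ex, mul_one] at h
    refine h.trans ?_
    have h2 : ∫ t in a..a + ℓ, ‖w1 t‖ ^ 2 ≤ ∫ t in a..a + ℓ, (4 * Real.pi ^ 2 * R ^ 2) * ‖w t‖ ^ 2 := by
      refine intervalIntegral.integral_mono_on (by linarith) ?_ ?_ fun t _ => ?_
      · refine intervalIntegrable_of_bounded (M := (2 * Real.pi * R * M) ^ 2)
          (Measurable.stronglyMeasurable (by fun_prop)) (fun t => ?_) _ _
        rw [norm_pow, norm_norm]; have := hw1M t; gcongr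
      · refine intervalIntegrable_of_bounded (M := (4 * Real.pi ^ 2 * R ^ 2) * M ^ 2)
          (Measurable.stronglyMeasurable (by fun_prop)) (fun t => ?_) _ _
        rw [Real.norm_of_nonneg (by positivity)]; have := hM t; gcongr
      · have := hw1b t
        calc ‖w1 t‖ ^ 2 ≤ (2 * Real.pi * R * ‖w t‖) ^ 2 := by gcongr
          _ = _ := by ring
    rw [intervalIntegral.integral_const_mul] at h2
    nlinarith
  have hterm : ∀ k, (∫ t in a..a + ℓ, (ex (-((k / ℓ + η k) * t)) - ex (-(k * t / ℓ))) * w t) =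
      G k (η k) - G k 0 := by
    intro k
    simp only [hG]
    rw [← intervalIntegral.integral_sub]
    · refine intervalIntegral.integral_congr fun t _ => ?_
      have : -((k / ℓ + η k) * t) = -(k * t / ℓ) + -(η k * t) := by ring
      simp only [this, ex_add, hφ]; simp; ring
    all_goals
      refine intervalIntegrable_of_bounded (M := M) (Measurable.stronglyMeasurable ?_) ?_ _ _
      · have := hφm k; fun_prop
      · intro t; simpa using hφM k t
  simp only [hterm]
  -- The displacements `η k` vary with `k`, but each difference is bounded by an integral over the
  -- common window `[-κ, κ]`; hence the sum can be taken inside the integral.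
  calc ∑ k ∈ S, ‖G k (η k) - G k 0‖ ^ 2
      ≤ ∑ k ∈ S, 8 * κ * ∫ r in (-κ)..κ, ‖g k r‖ ^ 2 :=
        Finset.sum_le_sum fun k _ => norm_sub_sq_le (hGd k) (hgc k) (hη k)
    _ = 8 * κ * ∫ r in (-κ)..κ, ∑ k ∈ S, ‖g k r‖ ^ 2 := by
        rw [← Finset.mul_sum, intervalIntegral.integral_finsetSum]
        intro k _
        have := hgc k
        exact Continuous.intervalIntegrable (by fun_prop) _ _
    _ ≤ 8 * κ * ∫ r in (-κ)..κ, (4 * Real.pi ^ 2 * R ^ 2) * (ℓ * ∫ t in a..a + ℓ, ‖w t‖ ^ 2) := by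
        have : ∫ r in (-κ)..κ, ∑ k ∈ S, ‖g k r‖ ^ 2 ≤
            ∫ r in (-κ)..κ, (4 * Real.pi ^ 2 * R ^ 2) * (ℓ * ∫ t in a..a + ℓ, ‖w t‖ ^ 2) := by
          refine intervalIntegral.integral_mono_on (by linarith) ?_ (by simp) fun r _ => hbessel r
          exact Continuous.intervalIntegrable (by fun_prop) _ _
        gcongr
    _ = _ := by rw [intervalIntegral.integral_const, smul_eq_mul]; ring

lemma integral_ex_mul_trigSum {ℓ : ℝ} (hℓ : 0 < ℓ) (a : ℝ) (S : Finset ℤ) (v : ℤ → ℂ) (k : ℤ) :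
    ∫ t in a..a + ℓ, ex (-(k * t / ℓ)) * trigSum ℓ S v t = if k ∈ S then ℓ * v k else 0 := by
  have h : ∀ t, ex (-(k * t / ℓ)) * trigSum ℓ S v t =
      ∑ l ∈ S, v l * ex ((l - k : ℤ) * t / ℓ) := by
    intro t
    rw [trigSum, Finset.mul_sum]
    refine Finset.sum_congr rfl fun l _ => ?_
    have : ((l - k : ℤ) : ℝ) * t / ℓ = -(k * t / ℓ) + l * t / ℓ := by push_cast; ring
    rw [this, ex_add, smul_eq_mul]; ring
  simp only [h]
  rw [intervalIntegral.integral_finsetSum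
      (fun l _ => Continuous.intervalIntegrable (by fun_prop) _ _)]
  simp only [intervalIntegral.integral_const_mul, integral_ex hℓ, sub_eq_zero]
  simp [mul_comm]

/-- Compare Fourier coefficients on the short circle. The factor `L / ℓ` makes the `k`-th
coefficient of the rescaled sum equal to the `ρ k`-th coefficient of the long sum `g` over its own
period. Splitting `g` into its part `w` on `T` and the rest `r`, the difference of coefficients
becomes `A k + B k`: `A k` comes from moving the frequency `k / ℓ` to `ρ k / L` on `w`, and `B k` is
a coefficient of `r` on the long circle. -/
lemma approx_restrict_scalar {ℓ L : ℝ} (hℓ : 0 < ℓ) (hL : ℓ ≤ L) {a R κ : ℝ}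
    (hR : ∀ t ∈ Set.uIoc a (a + ℓ), |t| ≤ R) {ρ : ℤ → ℤ} (hρ : Function.Injective ρ)
    (hρκ : ∀ k, |ρ k / L - k / ℓ| ≤ κ) (S : Finset ℤ) (v : ℤ → ℂ) {T : Set ℝ}
    (hT : MeasurableSet T) (hTa : T ⊆ Set.Ioc a (a + ℓ)) :
    ∫ t in a..a + ℓ, ‖((L / ℓ : ℝ) : ℂ) * trigSum ℓ (S.preimage ρ hρ.injOn) (v ∘ ρ) t -
        T.indicator (trigSum L S v) t‖ ^ 2 ≤
      2 * (64 * Real.pi ^ 2 * κ ^ 2 * R ^ 2) *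
        (∫ t in a..a + ℓ, ‖T.indicator (trigSum L S v) t‖ ^ 2) +
      2 * (L / ℓ) * ∫ t in a..a + L, ‖Tᶜ.indicator (trigSum L S v) t‖ ^ 2 := by
  have hL0 : 0 < L := hℓ.trans_le hL
  set g := trigSum L S v with hg
  set w := T.indicator g with hw
  set r := Tᶜ.indicator g with hr
  set M := ∑ l ∈ S, ‖v l‖ with hM
  have hgm : Measurable g := (continuous_trigSum L S v).measurable
  have hgM : ∀ t, ‖g t‖ ≤ M := norm_trigSum_le L S v
  have hwm : Measurable w := hgm.indicator hT
  have hrm : Measurable r := hgm.indicator hT.compl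
  have hwM : ∀ t, ‖w t‖ ≤ M := fun t => (norm_indicator_le_norm_self _ _).trans (hgM t)
  have hrM : ∀ t, ‖r t‖ ≤ M := fun t => (norm_indicator_le_norm_self _ _).trans (hgM t)
  have hwr : ∀ t, g t = w t + r t := fun t => by
    rw [hw, hr, ← Pi.add_apply, Set.indicator_self_add_compl]
  set h := trigSum ℓ (S.preimage ρ hρ.injOn) (v ∘ ρ) with hh
  set M' := ∑ l ∈ S.preimage ρ hρ.injOn, ‖(v ∘ ρ) l‖
  have hhM : ∀ t, ‖h t‖ ≤ M' := norm_trigSum_le ℓ _ _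
  have hhm : Continuous h := continuous_trigSum _ _ _
  set ψ : ℝ → ℂ := fun t => ((L / ℓ : ℝ) : ℂ) * h t - w t with hψ
  have hψm : Measurable ψ := by have := hhm.measurable; fun_prop
  have hψM : ∀ t, ‖ψ t‖ ≤ L / ℓ * M' + M := by
    intro t
    refine (norm_sub_le _ _).trans ?_
    rw [norm_mul, Complex.norm_real, Real.norm_of_nonneg (by positivity)]
    have := hhM t; have := hwM t
    gcongr
  have hsum := hasSum_norm_sq_integral_ex hℓ a (memLp_two_of_bounded hψm hψM a (a + ℓ))
  set A : ℤ → ℂ := fun k => ∫ t in a..a + ℓ, (ex (-((k / ℓ + (ρ k / L - k / ℓ)) * t)) -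
    ex (-(k * t / ℓ))) * w t with hA
  set B : ℤ → ℂ := fun k => ∫ t in a..a + L, ex (-(ρ k * t / L)) * r t with hB
  have hii : ∀ (c : ℝ → ℂ) (φ : ℝ → ℂ) (N : ℝ) (b b' : ℝ), Continuous c → (∀ t, ‖c t‖ ≤ 1) →
      Measurable φ → (∀ t, ‖φ t‖ ≤ N) →
      IntervalIntegrable (fun t => c t * φ t) volume b b' := by
    intro c φ N b b' hc hc1 hφ hN
    refine intervalIntegrable_of_bounded (M := N) ?_ (fun t => ?_) _ _
    · have := hc.measurable
      exact Measurable.stronglyMeasurable (by fun_prop)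
    · rw [norm_mul]
      exact (mul_le_of_le_one_left (norm_nonneg _) (hc1 t)).trans (hN t)
  have hcoef : ∀ k : ℤ, ∫ t in a..a + ℓ, ex (-(k * t / ℓ)) * ψ t = A k + B k := by
    intro k
    have e1 : ∫ t in a..a + ℓ, ex (-(k * t / ℓ)) * ψ t =
        ((L / ℓ : ℝ) : ℂ) * (∫ t in a..a + ℓ, ex (-(k * t / ℓ)) * h t) -
          ∫ t in a..a + ℓ, ex (-(k * t / ℓ)) * w t := by
      rw [← intervalIntegral.integral_const_mul, ← intervalIntegral.integral_sub]
      · refine intervalIntegral.integral_congr fun t _ => ?_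
        simp only [hψ]; ring
      · exact Continuous.intervalIntegrable (by fun_prop) _ _
      · exact hii _ _ M _ _ (by fun_prop) (by simp) hwm hwM
    have e2 : ∫ t in a..a + L, ex (-(ρ k * t / L)) * g t =
        (∫ t in a..a + ℓ, ex (-(ρ k * t / L)) * w t) + B k := by
      have e3 : ∫ t in a..a + L, ex (-(ρ k * t / L)) * g t =
          (∫ t in a..a + L, ex (-(ρ k * t / L)) * w t) + B k := by
        rw [hB, ← intervalIntegral.integral_add]
        · refine intervalIntegral.integral_congr fun t _ => ?_
          simp only [hwr]; ring
        · exact hii _ _ M _ _ (by fun_prop) (by simp) hwm hwM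
        · exact hii _ _ M _ _ (by fun_prop) (by simp) hrm hrM
      have e4 : ∫ t in a + ℓ..a + L, ex (-(ρ k * t / L)) * w t = 0 := by
        refine intervalIntegral.integral_zero_ae (Filter.Eventually.of_forall fun t ht => ?_)
        rw [Set.uIoc_of_le (by linarith)] at ht
        have : t ∉ T := fun h => absurd (hTa h).2 (not_le.2 ht.1)
        rw [hw, Set.indicator_of_notMem this, mul_zero]
      have hi : ∀ b b', IntervalIntegrable (fun t => ex (-(ρ k * t / L)) * w t) volume b b' :=
        fun b b' => hii _ _ M b b' (by fun_prop) (by simp) hwm hwM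
      rw [e3, ← intervalIntegral.integral_add_adjacent_intervals (hi a (a + ℓ)) (hi _ (a + L)),
        e4, add_zero]
    have e5 : A k = (∫ t in a..a + ℓ, ex (-(ρ k * t / L)) * w t) -
        ∫ t in a..a + ℓ, ex (-(k * t / ℓ)) * w t := by
      rw [← intervalIntegral.integral_sub]
      · refine intervalIntegral.integral_congr fun t _ => ?_
        have : -((k / ℓ + (ρ k / L - k / ℓ)) * t) = -(ρ k * t / L) := by ring
        simp only [this]; ring
      · exact hii _ _ M _ _ (by fun_prop) (by simp) hwm hwM
      · exact hii _ _ M _ _ (by fun_prop) (by simp) hwm hwM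
    rw [integral_ex_mul_trigSum hL0] at e2
    rw [e1, e5, hh, integral_ex_mul_trigSum hℓ]
    simp only [Finset.mem_preimage, Function.comp]
    have : ((L / ℓ : ℝ) : ℂ) * (if ρ k ∈ S then (ℓ : ℂ) * v (ρ k) else 0) =
        if ρ k ∈ S then (L : ℂ) * v (ρ k) else 0 := by
      have : (ℓ : ℂ) ≠ 0 := by exact_mod_cast hℓ.ne'
      split_ifs
      · push_cast; field_simp
      · simp
    rw [this, e2]; ring
  simp only [hcoef] at hsum
  have hle : ℓ * ∫ t in a..a + ℓ, ‖ψ t‖ ^ 2 ≤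
      2 * ((64 * Real.pi ^ 2 * κ ^ 2 * R ^ 2) * (ℓ * ∫ t in a..a + ℓ, ‖w t‖ ^ 2)) +
      2 * (L * ∫ t in a..a + L, ‖r t‖ ^ 2) := by
    refine hasSum_le_of_sum_le hsum fun S' => ?_
    have h1 := sum_norm_sq_integral_perturb_le hℓ a hwm hwM hR
      (fun k => ρ k / L - k / ℓ) hρκ S'
    -- By injectivity of `ρ` the sum over `k` is part of a Bessel sum on the long circle.
    have h2 := sum_norm_sq_integral_ex_le hL0 a hrm hrM (S'.image ρ)
    rw [Finset.sum_image (fun _ _ _ _ h => hρ h)] at h2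
    calc ∑ k ∈ S', ‖A k + B k‖ ^ 2 ≤ ∑ k ∈ S', (2 * ‖A k‖ ^ 2 + 2 * ‖B k‖ ^ 2) := by
          refine Finset.sum_le_sum fun k _ => ?_
          have := norm_add_le (A k) (B k)
          nlinarith [sq_nonneg (‖A k‖ - ‖B k‖), norm_nonneg (A k + B k)]
      _ = 2 * ∑ k ∈ S', ‖A k‖ ^ 2 + 2 * ∑ k ∈ S', ‖B k‖ ^ 2 := by
          rw [Finset.sum_add_distrib, Finset.mul_sum, Finset.mul_sum]
      _ ≤ _ := by gcongr
  have : ∫ t in a..a + ℓ, ‖ψ t‖ ^ 2 = (ℓ * ∫ t in a..a + ℓ, ‖ψ t‖ ^ 2) / ℓ := by field_simp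
  rw [this, div_le_iff₀ hℓ]
  refine hle.trans (le_of_eq ?_)
  field_simp

/-- This is dual to `sum_norm_sq_integral_perturb_le`. Pairing the sum with itself produces the
perturbed coefficients of the sum; Cauchy–Schwarz and the coefficient estimate then leave one factor
of its energy to cancel. -/
lemma perturb_scalar {ℓ L : ℝ} (hℓ : 0 < ℓ) {a R κ : ℝ}
    (hR : ∀ t ∈ Set.uIoc a (a + ℓ), |t| ≤ R) {ρ : ℤ → ℤ}
    (hρκ : ∀ k, |ρ k / L - k / ℓ| ≤ κ) (S : Finset ℤ) (v : ℤ → ℂ) :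
    ∫ t in a..a + ℓ, ‖∑ k ∈ S, (ex (ρ k * t / L) - ex (k * t / ℓ)) * v k‖ ^ 2 ≤
      (64 * Real.pi ^ 2 * κ ^ 2 * R ^ 2) * (ℓ * ∑ k ∈ S, ‖v k‖ ^ 2) := by
  set ψ : ℝ → ℂ := fun t => ∑ k ∈ S, (ex (ρ k * t / L) - ex (k * t / ℓ)) * v k with hψ
  have hψc : Continuous ψ := by fun_prop
  have hψM : ∀ t, ‖ψ t‖ ≤ ∑ k ∈ S, 2 * ‖v k‖ := by
    intro t
    refine (norm_sum_le _ _).trans (Finset.sum_le_sum fun k _ => ?_)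
    rw [norm_mul]
    gcongr
    refine (norm_sub_le _ _).trans ?_
    simp; norm_num
  set A : ℤ → ℂ := fun k => ∫ t in a..a + ℓ, (ex (-((k / ℓ + (ρ k / L - k / ℓ)) * t)) -
    ex (-(k * t / ℓ))) * ψ t with hA
  have h1 := sum_norm_sq_integral_perturb_le hℓ a hψc.measurable hψM hR
      (fun k => ρ k / L - k / ℓ) hρκ S
  set I := ∫ t in a..a + ℓ, ‖ψ t‖ ^ 2 with hI
  have hI0 : 0 ≤ I := intervalIntegral.integral_nonneg (by linarith) fun t _ => by positivity
  have h2 : (I : ℂ) = ∑ k ∈ S, (starRingEnd ℂ) (v k) * A k := by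
    rw [hI, ← intervalIntegral.integral_ofReal]
    have : ∀ t, ((‖ψ t‖ ^ 2 : ℝ) : ℂ) = ∑ k ∈ S, (starRingEnd ℂ) (v k) *
        ((ex (-((k / ℓ + (ρ k / L - k / ℓ)) * t)) - ex (-(k * t / ℓ))) * ψ t) := by
      intro t
      have : ((‖ψ t‖ ^ 2 : ℝ) : ℂ) = (starRingEnd ℂ) (ψ t) * ψ t := by
        rw [Complex.conj_mul']; norm_cast
      rw [this]
      nth_rewrite 1 [hψ]
      simp only [map_sum, Finset.sum_mul, map_mul, map_sub, ← ex_neg]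
      refine Finset.sum_congr rfl fun k _ => ?_
      have : -((k / ℓ + (ρ k / L - k / ℓ)) * t) = -(ρ k * t / L) := by ring
      rw [this]; ring
    simp only [this]
    rw [intervalIntegral.integral_finsetSum
      (fun l _ => Continuous.intervalIntegrable (by fun_prop) _ _)]
    simp only [intervalIntegral.integral_const_mul, hA]
  have h3 : I ≤ ∑ k ∈ S, ‖v k‖ * ‖A k‖ := by
    have : I = ‖(I : ℂ)‖ := by rw [Complex.norm_real, Real.norm_of_nonneg hI0]
    rw [this, h2]
    exact (norm_sum_le _ _).trans (Finset.sum_le_sum fun k _ => by simp)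
  have h4 : I ^ 2 ≤ (∑ k ∈ S, ‖v k‖ ^ 2) * ∑ k ∈ S, ‖A k‖ ^ 2 :=
    (pow_le_pow_left₀ hI0 h3 2).trans (Finset.sum_mul_sq_le_sq_mul_sq _ _ _)
  have hv0 : 0 ≤ ∑ k ∈ S, ‖v k‖ ^ 2 := Finset.sum_nonneg fun _ _ => by positivity
  rcases hI0.eq_or_lt with h0 | h0
  · rw [← h0]; positivity
  · have h5 : I * I ≤ I * ((64 * Real.pi ^ 2 * κ ^ 2 * R ^ 2) * (ℓ * ∑ k ∈ S, ‖v k‖ ^ 2)) := by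
      calc I * I = I ^ 2 := by ring
        _ ≤ _ := h4
        _ ≤ (∑ k ∈ S, ‖v k‖ ^ 2) * ((64 * Real.pi ^ 2 * κ ^ 2 * R ^ 2) * (ℓ * I)) := by gcongr
        _ = _ := by ring
    exact le_of_mul_le_mul_left h5 h0

section Vector
variable {K : Type*} [NormedAddCommGroup K] [InnerProductSpace ℂ K]

/-- All values of a trigonometric sum lie in the span of its finitely many coefficients, so vector
valued estimates follow by summing scalar ones over coordinates. -/
lemma exists_orthonormal_coordinates (S : Finset ℤ) (v : ℤ → K) :
    ∃ (n : ℕ) (e : Fin n → K), ∀ x ∈ Submodule.span ℂ (v '' S),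
      ‖x‖ ^ 2 = ∑ i, ‖inner ℂ (e i) x‖ ^ 2 := by
  have : FiniteDimensional ℂ (Submodule.span ℂ (v '' S)) :=
    FiniteDimensional.span_of_finite ℂ (S.finite_toSet.image v)
  let b := stdOrthonormalBasis ℂ (Submodule.span ℂ (v '' S))
  refine ⟨_, fun i => (b i : K), fun x hx => ?_⟩
  have := b.sum_sq_norm_inner_right ⟨x, hx⟩
  simpa using this.symm

lemma inner_trigSum (e : K) (ℓ : ℝ) (S : Finset ℤ) (v : ℤ → K) (t : ℝ) :
    inner ℂ e (trigSum ℓ S v t) = trigSum ℓ S (fun k => inner ℂ e (v k)) t := by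
  simp only [trigSum, inner_sum, inner_smul_right, smul_eq_mul]

lemma trigSum_mem_span (ℓ : ℝ) (S : Finset ℤ) (v : ℤ → K) (t : ℝ) :
    trigSum ℓ S v t ∈ Submodule.span ℂ (v '' S) :=
  Submodule.sum_mem _ fun k hk => Submodule.smul_mem _ _ (Submodule.subset_span ⟨k, hk, rfl⟩)

/-- A trigonometric sum with frequencies near those of the circle of length `ℓ`, cut off to a set
inside an interval of length `ℓ`, is close to the trigonometric sum on that circle that has the
corresponding coefficients. -/
lemma approx_restrict {ℓ L : ℝ} (hℓ : 0 < ℓ) (hL : ℓ ≤ L) {a R κ : ℝ}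
    (hR : ∀ t ∈ Set.uIoc a (a + ℓ), |t| ≤ R) {ρ : ℤ → ℤ} (hρ : Function.Injective ρ)
    (hρκ : ∀ k, |ρ k / L - k / ℓ| ≤ κ) (S : Finset ℤ) (v : ℤ → K) {T : Set ℝ}
    (hT : MeasurableSet T) (hTa : T ⊆ Set.Ioc a (a + ℓ)) :
    ∫ t in a..a + ℓ, ‖((L / ℓ : ℝ) : ℂ) • trigSum ℓ (S.preimage ρ hρ.injOn) (v ∘ ρ) t -
        T.indicator (trigSum L S v) t‖ ^ 2 ≤
      2 * (64 * Real.pi ^ 2 * κ ^ 2 * R ^ 2) *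
        (∫ t in a..a + ℓ, ‖T.indicator (trigSum L S v) t‖ ^ 2) +
      2 * (L / ℓ) * ∫ t in a..a + L, ‖Tᶜ.indicator (trigSum L S v) t‖ ^ 2 := by
  obtain ⟨n, e, he⟩ := exists_orthonormal_coordinates S v
  have hind : ∀ (T : Set ℝ) t, T.indicator (trigSum L S v) t ∈ Submodule.span ℂ (v '' S) := by
    intro T t
    by_cases ht : t ∈ T
    · rw [Set.indicator_of_mem ht]; exact trigSum_mem_span _ _ _ _
    · rw [Set.indicator_of_notMem ht]; exact Submodule.zero_mem _
  have hinner : ∀ (T : Set ℝ) i t, inner ℂ (e i) (T.indicator (trigSum L S v) t) =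
      T.indicator (trigSum L S (fun k => inner ℂ (e i) (v k))) t := by
    intro T i t
    by_cases ht : t ∈ T
    · rw [Set.indicator_of_mem ht, Set.indicator_of_mem ht, inner_trigSum]
    · rw [Set.indicator_of_notMem ht, Set.indicator_of_notMem ht, inner_zero_right]
  have hh : ∀ t, trigSum ℓ (S.preimage ρ hρ.injOn) (v ∘ ρ) t ∈ Submodule.span ℂ (v '' S) := by
    intro t
    refine Submodule.sum_mem _ fun k hk => Submodule.smul_mem _ _ (Submodule.subset_span ?_)
    exact ⟨ρ k, by simpa using hk, rfl⟩
  have h1 : ∀ t, ‖((L / ℓ : ℝ) : ℂ) • trigSum ℓ (S.preimage ρ hρ.injOn) (v ∘ ρ) t -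
        T.indicator (trigSum L S v) t‖ ^ 2 = ∑ i, ‖((L / ℓ : ℝ) : ℂ) *
        trigSum ℓ (S.preimage ρ hρ.injOn) ((fun k => inner ℂ (e i) (v k)) ∘ ρ) t -
        T.indicator (trigSum L S (fun k => inner ℂ (e i) (v k))) t‖ ^ 2 := by
    intro t
    rw [he _ (Submodule.sub_mem _ (Submodule.smul_mem _ _ (hh t)) (hind T t))]
    refine Finset.sum_congr rfl fun i _ => ?_
    rw [inner_sub_right, inner_smul_right, hinner, inner_trigSum]; rfl
  have h2 : ∀ (T : Set ℝ) t, ‖T.indicator (trigSum L S v) t‖ ^ 2 =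
      ∑ i, ‖T.indicator (trigSum L S (fun k => inner ℂ (e i) (v k))) t‖ ^ 2 := by
    intro T t
    rw [he _ (hind T t)]
    refine Finset.sum_congr rfl fun i _ => ?_
    rw [hinner]
  have hint : ∀ (T : Set ℝ), MeasurableSet T → ∀ (v : ℤ → ℂ) b b',
      IntervalIntegrable (fun t => ‖T.indicator (trigSum L S v) t‖ ^ 2) volume b b' := by
    intro T hT v b b'
    refine intervalIntegrable_of_bounded (M := (∑ l ∈ S, ‖v l‖) ^ 2)
      (Measurable.stronglyMeasurable ?_) (fun t => ?_) _ _
    · have := (continuous_trigSum L S v).measurable.indicator hT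
      fun_prop
    · rw [norm_pow, norm_norm]
      have := (norm_indicator_le_norm_self (s := T) (trigSum L S v) t).trans (norm_trigSum_le L S v t)
      gcongr
  have hint1 : ∀ (v : ℤ → ℂ) b b', IntervalIntegrable (fun t => ‖((L / ℓ : ℝ) : ℂ) *
        trigSum ℓ (S.preimage ρ hρ.injOn) (v ∘ ρ) t -
        T.indicator (trigSum L S v) t‖ ^ 2) volume b b' := by
    intro v b b'
    refine intervalIntegrable_of_bounded (M := (‖((L / ℓ : ℝ) : ℂ)‖ *
      (∑ l ∈ S.preimage ρ hρ.injOn, ‖(v ∘ ρ) l‖) + (∑ l ∈ S, ‖v l‖)) ^ 2)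
      (Measurable.stronglyMeasurable ?_) (fun t => ?_) _ _
    · have := (continuous_trigSum L S v).measurable.indicator hT
      have := (continuous_trigSum ℓ (S.preimage ρ hρ.injOn) (v ∘ ρ)).measurable
      fun_prop
    · rw [norm_pow, norm_norm]
      have h3 := (norm_indicator_le_norm_self (s := T) (trigSum L S v) t).trans
        (norm_trigSum_le L S v t)
      have h4 := norm_trigSum_le ℓ (S.preimage ρ hρ.injOn) (v ∘ ρ) t
      gcongr
      refine (norm_sub_le _ _).trans ?_
      rw [norm_mul]
      gcongr
  simp only [h1, h2]
  rw [intervalIntegral.integral_finsetSum fun i _ => hint1 _ _ _,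
    intervalIntegral.integral_finsetSum fun i _ => hint _ hT _ _ _,
    intervalIntegral.integral_finsetSum fun i _ => hint _ hT.compl _ _ _, Finset.mul_sum,
    Finset.mul_sum, ← Finset.sum_add_distrib]
  exact Finset.sum_le_sum fun i _ => approx_restrict_scalar hℓ hL hR hρ hρκ S _ hT hTa

/-- Paley–Wiener type stability: moving the frequencies slightly changes a trigonometric sum
little near the origin. -/
lemma norm_sub_trigSum_le {ℓ L : ℝ} (hℓ : 0 < ℓ) {a R κ : ℝ}
    (hR : ∀ t ∈ Set.uIoc a (a + ℓ), |t| ≤ R) {ρ : ℤ → ℤ} (hρ : Function.Injective ρ)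
    (hρκ : ∀ k, |ρ k / L - k / ℓ| ≤ κ) (S : Finset ℤ) (v : ℤ → K) :
    ∫ t in a..a + ℓ, ‖trigSum L (S.image ρ) v t - trigSum ℓ S (v ∘ ρ) t‖ ^ 2 ≤
      (64 * Real.pi ^ 2 * κ ^ 2 * R ^ 2) * (ℓ * ∑ k ∈ S, ‖v (ρ k)‖ ^ 2) := by
  obtain ⟨n, e, he⟩ := exists_orthonormal_coordinates S (v ∘ ρ)
  have h0 : ∀ t, trigSum L (S.image ρ) v t - trigSum ℓ S (v ∘ ρ) t =
      ∑ k ∈ S, (ex (ρ k * t / L) - ex (k * t / ℓ)) • v (ρ k) := by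
    intro t
    rw [trigSum, trigSum, Finset.sum_image (fun _ _ _ _ h => hρ h), ← Finset.sum_sub_distrib]
    refine Finset.sum_congr rfl fun k _ => ?_
    rw [sub_smul, Function.comp]
  have h1 : ∀ t, ‖trigSum L (S.image ρ) v t - trigSum ℓ S (v ∘ ρ) t‖ ^ 2 =
      ∑ i, ‖∑ k ∈ S, (ex (ρ k * t / L) - ex (k * t / ℓ)) * inner ℂ (e i) (v (ρ k))‖ ^ 2 := by
    intro t
    have hm : ∑ k ∈ S, (ex (ρ k * t / L) - ex (k * t / ℓ)) • v (ρ k) ∈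
        Submodule.span ℂ (v ∘ ρ '' S) :=
      Submodule.sum_mem _ fun k hk => Submodule.smul_mem _ _ (Submodule.subset_span ⟨k, hk, rfl⟩)
    rw [h0, he _ hm]
    simp only [inner_sum, inner_smul_right]
  have h2 : ∀ k ∈ S, ‖v (ρ k)‖ ^ 2 = ∑ i, ‖inner ℂ (e i) (v (ρ k))‖ ^ 2 := fun k hk =>
    he _ (Submodule.subset_span ⟨k, hk, rfl⟩)
  simp only [h1]
  rw [Finset.sum_congr rfl h2, intervalIntegral.integral_finsetSum
    fun i _ => Continuous.intervalIntegrable (by fun_prop) _ _, Finset.sum_comm, Finset.mul_sum,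
    Finset.mul_sum]
  exact Finset.sum_le_sum fun i _ => perturb_scalar hℓ hR hρκ S _

end Vector

/-! ### Lower Riesz bounds for sliced sets, and the cylinder estimate. -/

section RieszSequence
variable {P Ω K : Type*} [Fintype P] [NormedAddCommGroup K] [InnerProductSpace ℂ K]
  (F : P → (Ω →₀ ℂ) →ₗ[ℂ] K)

/-- The total energy of a coefficient vector. -/
def nsq (v : Ω →₀ ℂ) : ℝ := ∑ p, ‖F p v‖ ^ 2

lemma nsq_nonneg (v : Ω →₀ ℂ) : 0 ≤ nsq F v := Finset.sum_nonneg fun _ _ => by positivity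

open Classical in
/-- Lower Riesz bound for the frequencies in `U` on the union of the atoms in `B`. -/
def IsBaseRS (B : Set P) (U : Set Ω) (C : ℝ) : Prop :=
  ∀ v : Ω →₀ ℂ, (∀ ξ, v ξ ≠ 0 → ξ ∈ U) → nsq F v ≤ C * ∑ p with p ∈ B, ‖F p v‖ ^ 2

/-- The `p`-component of the wave with period `ℓ` and coefficients `c`. -/
def wave (ℓ : ℝ) (S : Finset ℤ) (c : ℤ → Ω →₀ ℂ) (p : P) : ℝ → K :=
  trigSum ℓ S (fun l => F p (c l))

/-- Lower Riesz bound for the frequencies in `Γ` on the set described by the slices `σ t`,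
over a circle of length `ℓ`. -/
def IsRS (ℓ : ℝ) (σ : ℝ → Set P) (Γ : Set (Ω × ℤ)) (C : ℝ) : Prop :=
  ∀ (S : Finset ℤ) (c : ℤ → Ω →₀ ℂ), (∀ l ∈ S, ∀ ξ, c l ξ ≠ 0 → (ξ, l) ∈ Γ) →
    ℓ * ∑ l ∈ S, nsq F (c l) ≤
      C * ∑ p, ∫ t in (0 : ℝ)..ℓ, ‖{t | p ∈ σ t}.indicator (wave F ℓ S c p) t‖ ^ 2

variable {F}

lemma norm_indicator_wave_sq_periodic {ℓ : ℝ} (hℓ : ℓ ≠ 0) {σ : ℝ → Set P}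
    (hσ : Function.Periodic σ ℓ) (S : Finset ℤ) (c : ℤ → Ω →₀ ℂ) (p : P) :
    Function.Periodic (fun t => ‖{t | p ∈ σ t}.indicator (wave F ℓ S c p) t‖ ^ 2) ℓ := by
  intro t
  have h1 : wave F ℓ S c p (t + ℓ) = wave F ℓ S c p t := trigSum_periodic hℓ _ _ _
  have h2 : (t + ℓ ∈ {t | p ∈ σ t}) ↔ t ∈ {t | p ∈ σ t} := by
    rw [Set.mem_ofPred_eq, hσ t, Set.mem_ofPred_eq]
  by_cases h : t ∈ {t | p ∈ σ t}
  · simp only [Set.indicator_of_mem h, Set.indicator_of_mem (h2.2 h), h1]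
  · simp only [Set.indicator_of_notMem h, Set.indicator_of_notMem (mt h2.1 h)]

lemma IsRS.bound {ℓ : ℝ} (hℓ : ℓ ≠ 0) {σ : ℝ → Set P} (hσ : Function.Periodic σ ℓ)
    {Γ : Set (Ω × ℤ)} {C : ℝ} (h : IsRS F ℓ σ Γ C) (a : ℝ) (S : Finset ℤ) (c : ℤ → Ω →₀ ℂ)
    (hc : ∀ l ∈ S, ∀ ξ, c l ξ ≠ 0 → (ξ, l) ∈ Γ) :
    ℓ * ∑ l ∈ S, nsq F (c l) ≤
      C * ∑ p, ∫ t in a..a + ℓ, ‖{t | p ∈ σ t}.indicator (wave F ℓ S c p) t‖ ^ 2 := by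
  refine (h S c hc).trans (le_of_eq ?_)
  congr 1
  refine Finset.sum_congr rfl fun p _ => ?_
  have := (norm_indicator_wave_sq_periodic (F := F) hℓ hσ S c p).intervalIntegral_add_eq 0 a
  rwa [zero_add] at this

lemma intervalIntegrable_indicator_trigSum {A : Set ℝ} (hA : MeasurableSet A) (ℓ : ℝ)
    (S : Finset ℤ) (v : ℤ → K) (a b : ℝ) :
    IntervalIntegrable (fun t => ‖A.indicator (trigSum ℓ S v) t‖ ^ 2) volume a b := by
  refine intervalIntegrable_of_bounded (M := (∑ l ∈ S, ‖v l‖) ^ 2)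
    (StronglyMeasurable.pow ?_ 2) (fun t => ?_) _ _
  · exact ((continuous_trigSum ℓ S v).stronglyMeasurable.indicator hA).norm
  · simp only [Pi.pow_apply]
    rw [norm_pow, norm_norm]
    have := (norm_indicator_le_norm_self (s := A) (trigSum ℓ S v) t).trans (norm_trigSum_le ℓ S v t)
    gcongr

lemma sq_norm_indicator_le (A : Set ℝ) (u : ℝ → K) (t : ℝ) :
    ‖A.indicator u t‖ ^ 2 ≤ ‖u t‖ ^ 2 := by
  have := norm_indicator_le_norm_self (s := A) u t
  gcongr

lemma integral_sq_indicator_nonneg {a b : ℝ} (hab : a ≤ b) (A : Set ℝ) (u : ℝ → K) :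
    0 ≤ ∫ t in a..b, ‖A.indicator u t‖ ^ 2 :=
  intervalIntegral.integral_nonneg hab fun t _ => by positivity

lemma IsRS.mono {ℓ : ℝ} (hℓ : 0 ≤ ℓ) {σ : ℝ → Set P} {Γ : Set (Ω × ℤ)} {C C' : ℝ}
    (hC : C ≤ C') (h : IsRS F ℓ σ Γ C) : IsRS F ℓ σ Γ C' := by
  intro S c hc
  refine (h S c hc).trans (mul_le_mul_of_nonneg_right hC ?_)
  exact Finset.sum_nonneg fun p _ => integral_sq_indicator_nonneg hℓ _ _

lemma sum_integral_sq_wave {ℓ : ℝ} (hℓ : 0 < ℓ) (a : ℝ) (S : Finset ℤ) (c : ℤ → Ω →₀ ℂ) :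
    ∑ p, ∫ t in a..a + ℓ, ‖wave F ℓ S c p t‖ ^ 2 = ℓ * ∑ l ∈ S, nsq F (c l) := by
  simp only [wave, integral_norm_sq_trigSum hℓ, nsq]
  rw [← Finset.mul_sum, Finset.sum_comm]

open Classical in
/-- If the frequencies close to those of a short circle are under control on the part of `B` over
that short circle, then the energy on the whole cylinder over `B` is controlled by the energy on the
part of the cylinder that belongs to the given set. -/
lemma sum_cylinder_le {ℓ L : ℝ} (hℓ : 0 < ℓ) (hL : ℓ ≤ L) {s : ℝ} (hs : L / ℓ ≤ s) {a R κ : ℝ}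
    (hR : ∀ t ∈ Set.uIoc a (a + ℓ), |t| ≤ R) {ρ : ℤ → ℤ} (hρ : Function.Injective ρ)
    (hρκ : ∀ k, |ρ k / L - k / ℓ| ≤ κ) {C : ℝ} (hC : 0 ≤ C)
    (hδ : 8 * (1 + C) * (64 * Real.pi ^ 2 * κ ^ 2 * R ^ 2) ≤ 1)
    {σ τ : ℝ → Set P} (hτp : Function.Periodic τ ℓ)
    (hσm : ∀ p, MeasurableSet {t | p ∈ σ t}) (hτm : ∀ p, MeasurableSet {t | p ∈ τ t})
    {B : Set P} (hστ : ∀ t ∈ Set.Ico a (a + ℓ), τ t = σ t ∩ B)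
    (hσB : ∀ t ∈ Set.Ico (a + ℓ) (a + L), σ t = B)
    {Γ' : Set (Ω × ℤ)} (hΓ' : IsRS F ℓ τ Γ' C) {Γ : Set (Ω × ℤ)}
    (hΓ : ∀ ξ k, (ξ, ρ k) ∈ Γ → (ξ, k) ∈ Γ') (S : Finset ℤ) (c : ℤ → Ω →₀ ℂ)
    (hc : ∀ l ∈ S, ∀ ξ, c l ξ ≠ 0 → (ξ, l) ∈ Γ) :
    ∑ p with p ∈ B, ∫ t in a..a + L, ‖wave F L S c p t‖ ^ 2 ≤ (8 * (1 + C) * s + 1) *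
      ∑ p, ∫ t in a..a + L, ‖{t | p ∈ σ t}.indicator (wave F L S c p) t‖ ^ 2 := by
  have hL0 : 0 < L := hℓ.trans_le hL
  have hs1 : 0 < L / ℓ := by positivity
  set δ := 64 * Real.pi ^ 2 * κ ^ 2 * R ^ 2 with hδdef
  have hδ0 : 0 ≤ δ := by positivity
  -- For `p ∈ B`, the part of the cylinder missed by `σ` is `T p`, up to the endpoint `a`. The aim
  -- is to bound the energy `H p` there by the energy `r p` off `T p`.
  set T : P → Set ℝ := fun p => {t | p ∉ σ t} ∩ Set.Ioo a (a + ℓ) with hT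
  have hTm : ∀ p, MeasurableSet (T p) := fun p => (hσm p).compl.inter measurableSet_Ioo
  have hTa : ∀ p, T p ⊆ Set.Ioc a (a + ℓ) := fun p t ht => ⟨ht.2.1, ht.2.2.le⟩
  set u := wave F L S c with hu
  set S' := S.preimage ρ hρ.injOn with hS'
  set h := wave F ℓ S' (c ∘ ρ) with hh
  set H : P → ℝ := fun p => ∫ t in a..a + ℓ, ‖(T p).indicator (u p) t‖ ^ 2 with hH
  set r : P → ℝ := fun p => ∫ t in a..a + L, ‖(T p)ᶜ.indicator (u p) t‖ ^ 2 with hr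
  set E : P → ℝ := fun p => ∫ t in a..a + L, ‖{t | p ∈ σ t}.indicator (u p) t‖ ^ 2 with hE
  set Z : P → ℝ := fun p => 2 * δ * H p + 2 * (L / ℓ) * r p with hZ
  have hZ' : ∀ p, ∫ t in a..a + ℓ, ‖((L / ℓ : ℝ) : ℂ) • h p t - (T p).indicator (u p) t‖ ^ 2 ≤ Z p :=
    fun p => approx_restrict hℓ hL hR hρ hρκ S (fun l => F p (c l)) (hTm p) (hTa p)
  have hZi : ∀ p b b', IntervalIntegrable
      (fun t => ‖((L / ℓ : ℝ) : ℂ) • h p t - (T p).indicator (u p) t‖ ^ 2) volume b b' := by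
    intro p b b'
    refine intervalIntegrable_of_bounded
      (M := (‖((L / ℓ : ℝ) : ℂ)‖ * (∑ l ∈ S', ‖F p (c (ρ l))‖) + ∑ l ∈ S, ‖F p (c l)‖) ^ 2)
      (StronglyMeasurable.pow ?_ 2) (fun t => ?_) _ _
    · exact (((continuous_trigSum ℓ S' _).stronglyMeasurable.const_smul _).sub
        ((continuous_trigSum L S _).stronglyMeasurable.indicator (hTm p))).norm
    · simp only [Pi.pow_apply]
      rw [norm_pow, norm_norm]
      have h3 : ‖(T p).indicator (u p) t‖ ≤ ∑ l ∈ S, ‖F p (c l)‖ :=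
        (norm_indicator_le_norm_self (s := T p) (u p) t).trans (norm_trigSum_le L S _ t)
      have h4 : ‖h p t‖ ≤ ∑ l ∈ S', ‖F p (c (ρ l))‖ := norm_trigSum_le ℓ S' _ t
      gcongr
      refine (norm_sub_le _ _).trans ?_
      rw [norm_smul]
      gcongr
  have hrE : ∀ p ∈ B, r p ≤ E p := by
    intro p hp
    refine intervalIntegral.integral_mono_on_of_le_Ioo (by linarith)
      (intervalIntegrable_indicator_trigSum (hTm p).compl _ _ _ _ _)
      (intervalIntegrable_indicator_trigSum (hσm p) _ _ _ _ _) fun t ht => ?_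
    by_cases htT : t ∈ T p
    · rw [Set.indicator_of_notMem (by simpa using htT)]; simp
    · have : p ∈ σ t := by
        by_cases hlt : t < a + ℓ
        · by_contra hn
          exact htT ⟨hn, ht.1, hlt⟩
        · rw [hσB t ⟨not_lt.1 hlt, ht.2⟩]; exact hp
      rw [Set.indicator_of_mem (by simpa using htT), Set.indicator_of_mem (by simpa using this)]
  have hE0 : ∀ p, 0 ≤ E p := fun p => integral_sq_indicator_nonneg (by linarith) _ _
  have hr0 : ∀ p, 0 ≤ r p := fun p => integral_sq_indicator_nonneg (by linarith) _ _
  have hH0 : ∀ p, 0 ≤ H p := fun p => integral_sq_indicator_nonneg (by linarith) _ _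
  have hN := hΓ'.bound hℓ.ne' hτp a S' (c ∘ ρ)
    (fun k hk ξ hξ => hΓ ξ k (hc (ρ k) (by simpa [hS'] using hk) ξ hξ))
  set N := ∑ k ∈ S', nsq F ((c ∘ ρ) k) with hNdef
  -- bound for the short circle coefficients
  have hN2 : (L / ℓ) ^ 2 * (ℓ * N) ≤ C * ∑ p with p ∈ B, Z p := by
    have h1 : (L / ℓ) ^ 2 * ∑ p, ∫ t in a..a + ℓ, ‖{t | p ∈ τ t}.indicator (h p) t‖ ^ 2 ≤
        ∑ p with p ∈ B, Z p := by
      rw [Finset.sum_filter, Finset.mul_sum]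
      refine Finset.sum_le_sum fun p _ => ?_
      split_ifs with hp
      · rw [← intervalIntegral.integral_const_mul]
        refine le_trans (intervalIntegral.integral_mono_on_of_le_Ioo (by linarith)
          ((intervalIntegrable_indicator_trigSum (hτm p) _ _ _ _ _).const_mul _)
          (hZi p _ _) fun t ht => ?_) (hZ' p)
        by_cases hpt : p ∈ τ t
        -- Where `p ∈ τ t` the approximated function `(T p).indicator (u p)` vanishes, so the
        -- rescaled short wave is itself the approximation error.
        · have : t ∉ T p := fun h => h.1 (by
            have := hστ t ⟨ht.1.le, ht.2⟩
            rw [this] at hpt; exact hpt.1)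
          rw [Set.indicator_of_mem (by simpa using hpt), Set.indicator_of_notMem this, sub_zero,
            norm_smul, mul_pow, Complex.norm_real, Real.norm_eq_abs, sq_abs]
        · rw [Set.indicator_of_notMem (by simpa using hpt)]
          simp only [norm_zero, ne_eq, OfNat.ofNat_ne_zero, not_false_eq_true, zero_pow, mul_zero]
          positivity
      · have : ∫ t in a..a + ℓ, ‖{t | p ∈ τ t}.indicator (h p) t‖ ^ 2 = ∫ t in a..a + ℓ, (0 : ℝ) := by
          refine intervalIntegral.integral_congr_Ioo_of_le (by linarith) fun t ht => ?_
          have : p ∉ τ t := fun h => hp (by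
            rw [hστ t ⟨ht.1.le, ht.2⟩] at h; exact h.2)
          simp [this]
        rw [this]; simp
    calc (L / ℓ) ^ 2 * (ℓ * N) ≤ (L / ℓ) ^ 2 *
          (C * ∑ p, ∫ t in a..a + ℓ, ‖{t | p ∈ τ t}.indicator (h p) t‖ ^ 2) := by gcongr
      _ = C * ((L / ℓ) ^ 2 * ∑ p, ∫ t in a..a + ℓ, ‖{t | p ∈ τ t}.indicator (h p) t‖ ^ 2) := by ring
      _ ≤ _ := by gcongr
  have hHp : ∀ p, H p ≤ 2 * Z p + 2 * (L / ℓ) ^ 2 * ∫ t in a..a + ℓ, ‖h p t‖ ^ 2 := by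
    intro p
    have h1 : H p ≤ ∫ t in a..a + ℓ, (2 * ‖((L / ℓ : ℝ) : ℂ) • h p t - (T p).indicator (u p) t‖ ^ 2 +
        2 * (L / ℓ) ^ 2 * ‖h p t‖ ^ 2) := by
      have hc1 : Continuous (h p) := continuous_trigSum _ _ _
      refine intervalIntegral.integral_mono_on_of_le_Ioo (by linarith)
        (intervalIntegrable_indicator_trigSum (hTm p) _ _ _ _ _)
        (((hZi p _ _).const_mul _).add (Continuous.intervalIntegrable (by fun_prop) _ _))
        fun t _ => ?_
      have h2 : ‖(T p).indicator (u p) t‖ ≤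
          ‖((L / ℓ : ℝ) : ℂ) • h p t - (T p).indicator (u p) t‖ + L / ℓ * ‖h p t‖ := by
        have h3 := norm_sub_norm_le ((T p).indicator (u p) t) (((L / ℓ : ℝ) : ℂ) • h p t)
        rw [norm_sub_rev, norm_smul, Complex.norm_real, Real.norm_of_nonneg hs1.le] at h3
        linarith
      have h4 := norm_nonneg ((T p).indicator (u p) t)
      nlinarith [sq_nonneg (‖((L / ℓ : ℝ) : ℂ) • h p t - (T p).indicator (u p) t‖ - L / ℓ * ‖h p t‖)]
    refine h1.trans ?_
    have hc1 : Continuous (h p) := continuous_trigSum _ _ _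
    rw [intervalIntegral.integral_add ((hZi p _ _).const_mul _)
      (Continuous.intervalIntegrable (by fun_prop) _ _), intervalIntegral.integral_const_mul,
      intervalIntegral.integral_const_mul]
    have := hZ' p
    gcongr
  have hHs : ∑ p with p ∈ B, H p ≤ 2 * (1 + C) * ∑ p with p ∈ B, Z p := by
    have h1 : ∑ p with p ∈ B, ∫ t in a..a + ℓ, ‖h p t‖ ^ 2 ≤ ℓ * N := by
      rw [hNdef, ← sum_integral_sq_wave hℓ a]
      exact Finset.sum_le_univ_sum_of_nonneg fun p =>
        intervalIntegral.integral_nonneg (by linarith) fun t _ => by positivity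
    calc ∑ p with p ∈ B, H p ≤ ∑ p with p ∈ B, (2 * Z p + 2 * (L / ℓ) ^ 2 *
          ∫ t in a..a + ℓ, ‖h p t‖ ^ 2) := Finset.sum_le_sum fun p _ => hHp p
      _ = 2 * ∑ p with p ∈ B, Z p + 2 * ((L / ℓ) ^ 2 * ∑ p with p ∈ B,
          ∫ t in a..a + ℓ, ‖h p t‖ ^ 2) := by
          simp only [Finset.sum_add_distrib, Finset.mul_sum, mul_assoc]
      _ ≤ 2 * ∑ p with p ∈ B, Z p + 2 * ((L / ℓ) ^ 2 * (ℓ * N)) := by gcongr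
      _ ≤ 2 * ∑ p with p ∈ B, Z p + 2 * (C * ∑ p with p ∈ B, Z p) := by gcongr
      _ = _ := by ring
  set Hs := ∑ p with p ∈ B, H p with hHsdef
  set rs := ∑ p with p ∈ B, r p with hrsdef
  have hZs : ∑ p with p ∈ B, Z p = 2 * δ * Hs + 2 * (L / ℓ) * rs := by
    rw [hZ, Finset.sum_add_distrib, ← Finset.mul_sum, ← Finset.mul_sum]
  have hrs0 : 0 ≤ rs := Finset.sum_nonneg fun p _ => hr0 p
  have hHs0 : 0 ≤ Hs := Finset.sum_nonneg fun p _ => hH0 p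
  have hrsE : rs ≤ ∑ p, E p :=
    (Finset.sum_le_sum fun p hp => hrE p (Finset.mem_filter.1 hp).2).trans
      (Finset.sum_le_univ_sum_of_nonneg hE0)
  -- The error contains `Hs` with coefficient `4 * (1 + C) * δ`, at most `1 / 2` by the smallness
  -- hypothesis, so it can be absorbed on the left.
  have hHfinal : Hs ≤ 8 * (1 + C) * s * rs := by
    rw [hZs] at hHs
    have h1 : 4 * (1 + C) * δ * Hs ≤ 1 / 2 * Hs := by
      refine mul_le_mul_of_nonneg_right ?_ hHs0; linarith
    have h2 : 4 * (1 + C) * (L / ℓ) * rs ≤ 4 * (1 + C) * s * rs := by gcongr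
    nlinarith
  have hsplit : ∀ p, ∫ t in a..a + L, ‖u p t‖ ^ 2 = H p + r p := by
    intro p
    have h1 : ∀ t, ‖u p t‖ ^ 2 = ‖(T p).indicator (u p) t‖ ^ 2 + ‖(T p)ᶜ.indicator (u p) t‖ ^ 2 := by
      intro t
      by_cases ht : t ∈ T p
      · rw [Set.indicator_of_mem ht, Set.indicator_of_notMem (by simpa using ht)]; simp
      · rw [Set.indicator_of_notMem ht, Set.indicator_of_mem (by simpa using ht)]; simp
    have hi : ∀ b b', IntervalIntegrable (fun t => ‖(T p).indicator (u p) t‖ ^ 2) volume b b' :=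
      fun b b' => intervalIntegrable_indicator_trigSum (hTm p) L S (fun l => F p (c l)) b b'
    have hi2 : IntervalIntegrable (fun t => ‖(T p)ᶜ.indicator (u p) t‖ ^ 2) volume a (a + L) :=
      intervalIntegrable_indicator_trigSum (hTm p).compl L S (fun l => F p (c l)) _ _
    simp only [h1]
    rw [intervalIntegral.integral_add (hi _ _) hi2,
      ← intervalIntegral.integral_add_adjacent_intervals (hi a (a + ℓ)) (hi _ (a + L))]
    have : ∫ t in a + ℓ..a + L, ‖(T p).indicator (u p) t‖ ^ 2 = ∫ t in a + ℓ..a + L, (0 : ℝ) := by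
      refine intervalIntegral.integral_congr_Ioo_of_le (by linarith) fun t ht => ?_
      have : t ∉ T p := fun h => absurd h.2.2 (not_lt.2 ht.1.le)
      simp only [Set.indicator_of_notMem this]; simp
    rw [this, intervalIntegral.integral_zero, add_zero]
  simp only [hsplit]
  rw [Finset.sum_add_distrib]
  have hs0 : 0 ≤ s := hs1.le.trans hs
  have : 8 * (1 + C) * s * rs ≤ 8 * (1 + C) * s * ∑ p, E p := by gcongr
  linarith

end RieszSequence

/-! ### Passing from a short circle to a long one. -/

section Round
variable {P Ω K : Type*} [Fintype P] [NormedAddCommGroup K] [InnerProductSpace ℂ K]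
  {F : P → (Ω →₀ ℂ) →ₗ[ℂ] K}

/-- The constant in `IsRS.of_short_circle`. -/
def shortCircleConst (C C₀ s : ℝ) : ℝ :=
  2 * s * C * ((1 + 3 * C₀) * (8 * (1 + C) * s + 1) + 3) + C₀ * (8 * (1 + C) * s + 1)

open Classical in
/-- Let `σ` be equal to the constant slice `B` outside a short interval of length `ℓ`. Lower Riesz
bounds over the circle of length `ℓ` for `σ ∩ B` and `σ ∪ B` give a lower Riesz bound for `σ`. -/
lemma IsRS.of_short_circle {ℓ L : ℝ} (hℓ : 0 < ℓ) (hL : ℓ ≤ L) {s : ℝ} (hs : L / ℓ ≤ s) {a R κ : ℝ}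
    (hR : ∀ t ∈ Set.uIoc a (a + ℓ), |t| ≤ R) {ρ ρ' : ℤ → ℤ} (hρ : Function.Injective ρ)
    (hρ' : Function.Injective ρ')
    (hρκ : ∀ k, |ρ k / L - k / ℓ| ≤ κ) (hρκ' : ∀ k, |ρ' k / L - k / ℓ| ≤ κ) {C C₀ : ℝ}
    (hC : 0 ≤ C) (hC₀ : 0 ≤ C₀) (hδ : 8 * (1 + C) * (64 * Real.pi ^ 2 * κ ^ 2 * R ^ 2) ≤ 1)
    {σ τ τ' : ℝ → Set P} (hσp : Function.Periodic σ L) (hτp : Function.Periodic τ ℓ)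
    (hτp' : Function.Periodic τ' ℓ)
    (hσm : ∀ p, MeasurableSet {t | p ∈ σ t}) (hτm : ∀ p, MeasurableSet {t | p ∈ τ t})
    (hτm' : ∀ p, MeasurableSet {t | p ∈ τ' t})
    {B : Set P} (hστ : ∀ t ∈ Set.Ico a (a + ℓ), τ t = σ t ∪ B)
    (hστ' : ∀ t ∈ Set.Ico a (a + ℓ), τ' t = σ t ∩ B)
    (hσB : ∀ t ∈ Set.Ico (a + ℓ) (a + L), σ t = B)
    {Δ Δ' : Set (Ω × ℤ)} (hΔ : IsRS F ℓ τ Δ C) (hΔ' : IsRS F ℓ τ' Δ' C)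
    {U : Set Ω} (hU : IsBaseRS F B U C₀) {Γ : Set (Ω × ℤ)}
    (hΓ : ∀ ξ k, (ξ, ρ k) ∈ Γ → (ξ, k) ∈ Δ) (hΓ' : ∀ ξ k, (ξ, ρ' k) ∈ Γ → (ξ, k) ∈ Δ')
    (hΓU : ∀ ξ l, l ∉ Set.range ρ → (ξ, l) ∈ Γ → ξ ∈ U) :
    IsRS F L σ Γ (shortCircleConst C C₀ s) := by
  have hL0 : 0 < L := hℓ.trans_le hL
  have hs1 : 0 < L / ℓ := by positivity
  have hs0 : 0 ≤ s := hs1.le.trans hs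
  intro S c hc
  have hshift : ∑ p, ∫ t in (0 : ℝ)..L, ‖{t | p ∈ σ t}.indicator (wave F L S c p) t‖ ^ 2 =
      ∑ p, ∫ t in a..a + L, ‖{t | p ∈ σ t}.indicator (wave F L S c p) t‖ ^ 2 := by
    refine Finset.sum_congr rfl fun p _ => ?_
    have := (norm_indicator_wave_sq_periodic (F := F) hL0.ne' hσp S c p).intervalIntegral_add_eq 0 a
    rwa [zero_add] at this
  rw [hshift]
  -- The copy `ρ'` and the slices `σ ∩ B` serve only here, to control the whole cylinder over `B`.
  -- The rest of the proof uses `ρ` and `σ ∪ B`.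
  have hβ := sum_cylinder_le hℓ hL hs hR hρ' hρκ' hC hδ hτp' hσm hτm' hστ' hσB hΔ' hΓ' S c hc
  set δ := 64 * Real.pi ^ 2 * κ ^ 2 * R ^ 2 with hδdef
  have hδ0 : 0 ≤ δ := by positivity
  set u := wave F L S c with hu
  set β := ∑ p with p ∈ B, ∫ t in a..a + L, ‖u p t‖ ^ 2 with hβdef
  set E := ∑ p, ∫ t in a..a + L, ‖{t | p ∈ σ t}.indicator (u p) t‖ ^ 2 with hE
  have hβL : β = L * ∑ l ∈ S, ∑ p with p ∈ B, ‖F p (c l)‖ ^ 2 := by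
    simp only [hβdef, hu, wave, integral_norm_sq_trigSum hL0]
    rw [← Finset.mul_sum, Finset.sum_comm]
  have hβ0 : 0 ≤ β := by
    rw [hβL]
    exact mul_nonneg hL0.le (Finset.sum_nonneg fun _ _ => Finset.sum_nonneg fun _ _ => by positivity)
  set S₀ := S.preimage ρ hρ.injOn with hS₀
  set S₁ := S.filter (fun l => l ∉ Set.range ρ) with hS₁
  have himg : S₀.image ρ = S.filter (fun l => l ∈ Set.range ρ) := by
    rw [hS₀, Finset.image_preimage]
  have hSsum : ∀ f : ℤ → ℝ, ∑ l ∈ S, f l = ∑ k ∈ S₀, f (ρ k) + ∑ l ∈ S₁, f l := by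
    intro f
    rw [← Finset.sum_image (f := f) (g := ρ) (fun _ _ _ _ h => hρ h), himg, hS₁,
      Finset.sum_filter_add_sum_filter_not]
  have hsplit : ∀ p t, u p t = trigSum L (S₀.image ρ) (fun l => F p (c l)) t + wave F L S₁ c p t := by
    intro p t
    rw [himg, hu, hS₁, wave, wave, trigSum, trigSum, trigSum, Finset.sum_filter_add_sum_filter_not]
  -- the frequencies outside the range of `ρ`
  have h1 : L * ∑ l ∈ S₁, nsq F (c l) ≤ C₀ * β := by
    have : ∑ l ∈ S₁, nsq F (c l) ≤ C₀ * ∑ l ∈ S, ∑ p with p ∈ B, ‖F p (c l)‖ ^ 2 := by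
      rw [Finset.mul_sum]
      calc ∑ l ∈ S₁, nsq F (c l) ≤ ∑ l ∈ S₁, C₀ * ∑ p with p ∈ B, ‖F p (c l)‖ ^ 2 := by
            refine Finset.sum_le_sum fun l hl => hU _ fun ξ hξ => ?_
            rw [hS₁, Finset.mem_filter] at hl
            exact hΓU ξ l hl.2 (hc l hl.1 ξ hξ)
        _ ≤ _ := Finset.sum_le_sum_of_subset_of_nonneg (Finset.filter_subset _ _)
            fun l _ _ => mul_nonneg hC₀ (Finset.sum_nonneg fun _ _ => by positivity)
    rw [hβL]
    calc L * ∑ l ∈ S₁, nsq F (c l) ≤ L * (C₀ * ∑ l ∈ S, ∑ p with p ∈ B, ‖F p (c l)‖ ^ 2) := by gcongr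
      _ = _ := by ring
  set h := wave F ℓ S₀ (c ∘ ρ) with hh
  set N := ∑ k ∈ S₀, nsq F ((c ∘ ρ) k) with hN
  have hN0 : 0 ≤ N := Finset.sum_nonneg fun _ _ => nsq_nonneg _ _
  have hb := hΔ.bound hℓ.ne' hτp a S₀ (c ∘ ρ)
    (fun k hk ξ hξ => hΓ ξ k (hc (ρ k) (by simpa [hS₀] using hk) ξ hξ))
  have hint : ∀ (p : P) b b', IntervalIntegrable (fun t => ‖{t | p ∈ σ t}.indicator (u p) t‖ ^ 2)
      volume b b' := fun p b b' => intervalIntegrable_indicator_trigSum (hσm p) _ _ _ _ _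
  set v : P → ℝ → K := fun p t => trigSum L (S₀.image ρ) (fun l => F p (c l)) t - h p t with hv
  have hvc : ∀ p, Continuous (v p) := fun p =>
    (continuous_trigSum _ _ _).sub (continuous_trigSum _ _ _)
  have hwc : ∀ p, Continuous (wave F L S₁ c p) := fun p => continuous_trigSum _ _ _
  have hhc : ∀ p, Continuous (h p) := fun p => continuous_trigSum _ _ _
  set D : P → ℝ := fun p => ∫ t in a..a + ℓ, (3 * ‖v p t‖ ^ 2 +
    3 * ‖{t | p ∈ σ t}.indicator (u p) t‖ ^ 2 + 3 * ‖wave F L S₁ c p t‖ ^ 2) with hD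
  have hDp : ∀ p, D p ≤ 3 * (δ * (ℓ * ∑ k ∈ S₀, ‖F p (c (ρ k))‖ ^ 2)) +
      3 * (∫ t in a..a + L, ‖{t | p ∈ σ t}.indicator (u p) t‖ ^ 2) +
      3 * ∫ t in a..a + L, ‖wave F L S₁ c p t‖ ^ 2 := by
    intro p
    have hvi : IntervalIntegrable (fun t => 3 * ‖v p t‖ ^ 2) volume a (a + ℓ) := by
      have := hvc p
      exact Continuous.intervalIntegrable (by fun_prop) _ _
    have hwi : ∀ b b', IntervalIntegrable (fun t => ‖wave F L S₁ c p t‖ ^ 2) volume b b' := by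
      have := hwc p
      exact fun b b' => Continuous.intervalIntegrable (by fun_prop) _ _
    simp only [hD]
    rw [intervalIntegral.integral_add (hvi.add ((hint p _ _).const_mul 3)) ((hwi _ _).const_mul 3),
      intervalIntegral.integral_add hvi ((hint p _ _).const_mul 3),
      intervalIntegral.integral_const_mul, intervalIntegral.integral_const_mul,
      intervalIntegral.integral_const_mul]
    have hm1 := intervalIntegral.integral_mono_interval le_rfl (by linarith : a ≤ a + ℓ)
      (by linarith : a + ℓ ≤ a + L) (Filter.Eventually.of_forall
        fun t => by positivity : 0 ≤ᵐ[volume.restrict (Set.Ioc a (a + L))]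
          fun t => ‖{t | p ∈ σ t}.indicator (u p) t‖ ^ 2) (hint p _ _)
    have hm2 := intervalIntegral.integral_mono_interval le_rfl (by linarith : a ≤ a + ℓ)
      (by linarith : a + ℓ ≤ a + L) (Filter.Eventually.of_forall
        fun t => by positivity : 0 ≤ᵐ[volume.restrict (Set.Ioc a (a + L))]
          fun t => ‖wave F L S₁ c p t‖ ^ 2) (hwi _ _)
    have hm3 : ∫ t in a..a + ℓ, ‖v p t‖ ^ 2 ≤ δ * (ℓ * ∑ k ∈ S₀, ‖F p (c (ρ k))‖ ^ 2) :=
      norm_sub_trigSum_le hℓ hR hρ hρκ S₀ (fun l => F p (c l))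
    gcongr
  have hD0 : ∀ p, 0 ≤ D p := fun p =>
    intervalIntegral.integral_nonneg (by linarith) fun t _ => by positivity
  have hDs : ∑ p, D p ≤ 3 * (δ * (ℓ * N)) + 3 * E + 3 * (C₀ * β) := by
    calc ∑ p, D p ≤ ∑ p, (3 * (δ * (ℓ * ∑ k ∈ S₀, ‖F p (c (ρ k))‖ ^ 2)) +
      3 * (∫ t in a..a + L, ‖{t | p ∈ σ t}.indicator (u p) t‖ ^ 2) +
      3 * ∫ t in a..a + L, ‖wave F L S₁ c p t‖ ^ 2) := Finset.sum_le_sum fun p _ => hDp p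
      _ = 3 * (δ * (ℓ * N)) + 3 * E + 3 * (L * ∑ l ∈ S₁, nsq F (c l)) := by
        rw [Finset.sum_add_distrib, Finset.sum_add_distrib, ← Finset.mul_sum, ← Finset.mul_sum,
          ← Finset.mul_sum, ← Finset.mul_sum, ← Finset.mul_sum, sum_integral_sq_wave hL0,
          Finset.sum_comm]
        rfl
      _ ≤ _ := by gcongr
  -- Over `B` the energy of `h` is left to be compared with `β`. Off `B`, membership in `τ t` forces
  -- membership in `σ t`, and there `h` differs from the observed `u` by the displacement error `v`
  -- and the wave with frequencies outside the range of `ρ`.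
  have hcell : ∀ p, ∫ t in a..a + ℓ, ‖{t | p ∈ τ t}.indicator (h p) t‖ ^ 2 ≤
      (if p ∈ B then ∫ t in a..a + ℓ, ‖h p t‖ ^ 2 else 0) + D p := by
    intro p
    have hi := intervalIntegrable_indicator_trigSum (hτm p) ℓ S₀ (fun k => F p (c (ρ k))) a (a + ℓ)
    have hcc := hhc p
    split_ifs with hp
    · refine le_add_of_le_of_nonneg ?_ (hD0 p)
      exact intervalIntegral.integral_mono_on (by linarith) hi
        (Continuous.intervalIntegrable (by fun_prop) _ _) fun t _ => sq_norm_indicator_le _ _ _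
    · rw [zero_add]
      have hv1 := hvc p
      have hw1 := hwc p
      refine intervalIntegral.integral_mono_on_of_le_Ioo (by linarith) hi
        (((Continuous.intervalIntegrable (by fun_prop) _ _).add ((hint p _ _).const_mul 3)).add
          (Continuous.intervalIntegrable (by fun_prop) _ _)) fun t ht => ?_
      by_cases hpt : p ∈ τ t
      · have hpσ : p ∈ σ t := by
          rw [hστ t ⟨ht.1.le, ht.2⟩] at hpt
          exact hpt.resolve_right hp
        have e1 : {t | p ∈ τ t}.indicator (h p) t = h p t :=
          Set.indicator_of_mem (s := {t | p ∈ τ t}) hpt _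
        have e2 : {t | p ∈ σ t}.indicator (u p) t = u p t :=
          Set.indicator_of_mem (s := {t | p ∈ σ t}) hpσ _
        rw [e1, e2]
        have h3 : h p t = u p t - v p t - wave F L S₁ c p t := by
          rw [hsplit]; simp only [hv]; abel
        have h4 : ‖h p t‖ ≤ ‖u p t‖ + ‖v p t‖ + ‖wave F L S₁ c p t‖ := by
          rw [h3]
          exact (norm_sub_le _ _).trans (by gcongr; exact norm_sub_le _ _)
        nlinarith [sq_nonneg (‖u p t‖ - ‖v p t‖), sq_nonneg (‖u p t‖ - ‖wave F L S₁ c p t‖),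
          sq_nonneg (‖v p t‖ - ‖wave F L S₁ c p t‖), norm_nonneg (h p t)]
      · have e1 : {t | p ∈ τ t}.indicator (h p) t = 0 :=
          Set.indicator_of_notMem (s := {t | p ∈ τ t}) hpt _
        rw [e1, norm_zero, zero_pow two_ne_zero]
        positivity
  have hBh : ∑ p with p ∈ B, ∫ t in a..a + ℓ, ‖h p t‖ ^ 2 ≤ β := by
    simp only [hh, wave, integral_norm_sq_trigSum hℓ]
    rw [← Finset.mul_sum, Finset.sum_comm, hβL, hSsum (fun l => ∑ p with p ∈ B, ‖F p (c l)‖ ^ 2)]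
    refine mul_le_mul hL (le_add_of_nonneg_right ?_) ?_ hL0.le
    · exact Finset.sum_nonneg fun _ _ => Finset.sum_nonneg fun _ _ => by positivity
    · exact Finset.sum_nonneg fun _ _ => Finset.sum_nonneg fun _ _ => by positivity
  have hτsum : ∑ p, ∫ t in a..a + ℓ, ‖{t | p ∈ τ t}.indicator (h p) t‖ ^ 2 ≤
      β + (3 * (δ * (ℓ * N)) + 3 * E + 3 * (C₀ * β)) := by
    refine (Finset.sum_le_sum fun p _ => hcell p).trans ?_
    rw [Finset.sum_add_distrib, ← Finset.sum_filter]
    gcongr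
  -- The displacement error contributes `3 * C * δ * (ℓ * N)`, at most half of the left side.
  have hℓN : ℓ * N ≤ 2 * C * ((1 + 3 * C₀) * β + 3 * E) := by
    have h2 : ℓ * N ≤ C * (β + (3 * (δ * (ℓ * N)) + 3 * E + 3 * (C₀ * β))) :=
      hb.trans (mul_le_mul_of_nonneg_left hτsum hC)
    have h3 : 6 * C * δ * (ℓ * N) ≤ 1 * (ℓ * N) := by
      refine mul_le_mul_of_nonneg_right ?_ (by positivity)
      nlinarith
    nlinarith
  have hLN : L * N ≤ s * (2 * C * ((1 + 3 * C₀) * β + 3 * E)) := by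
    have : L * N = L / ℓ * (ℓ * N) := by field_simp
    rw [this]
    exact mul_le_mul hs hℓN (by positivity) hs0
  have hfin : L * ∑ l ∈ S, nsq F (c l) = L * N + L * ∑ l ∈ S₁, nsq F (c l) := by
    rw [hSsum, mul_add]; rfl
  rw [hfin]
  have h5 : s * (2 * C * ((1 + 3 * C₀) * β + 3 * E)) ≤
      s * (2 * C * ((1 + 3 * C₀) * ((8 * (1 + C) * s + 1) * E) + 3 * E)) := by gcongr
  have h6 : C₀ * β ≤ C₀ * ((8 * (1 + C) * s + 1) * E) := by gcongr
  calc _ ≤ s * (2 * C * ((1 + 3 * C₀) * ((8 * (1 + C) * s + 1) * E) + 3 * E)) +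
        C₀ * ((8 * (1 + C) * s + 1) * E) := by linarith
    _ = _ := by rw [shortCircleConst]; ring

end Round

/-! ### Quantitative invertibility of minors of the Fourier matrix. -/

section Vandermonde
variable {K : Type*} [NormedAddCommGroup K] [NormedSpace ℂ K]

/-- The rows in `J` and the first `J.card` columns form a square Vandermonde matrix with rows scaled
by nonzero factors. Move the remaining columns to the other side and apply its inverse. -/
lemma exists_vandermonde_bound_of_finset {N : ℕ} {y z : Fin N → ℂ} (hy : ∀ j, y j ≠ 0)
    (hz : Function.Injective z) (J : Finset (Fin N)) :
    ∃ A : ℝ, 0 ≤ A ∧ ∀ (g : Fin N → K) (i : Fin N), (i : ℕ) < J.card →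
      ‖g i‖ ^ 2 ≤ A * (∑ j ∈ J, ‖∑ i : Fin N, (y j * z j ^ (i : ℕ)) • g i‖ ^ 2 +
        ∑ i : Fin N with J.card ≤ i.val, ‖g i‖ ^ 2) := by
  set m := J.card with hm
  have hmN : m ≤ N := by simpa using J.card_le_univ
  let φ : Fin m ≃ J := (J.orderIsoOfFin rfl).toEquiv
  let V : Matrix (Fin m) (Fin m) ℂ := Matrix.of fun a b => y (φ a) * z (φ a) ^ (b : ℕ)
  have hV : IsUnit V.det := by
    have : V = Matrix.of fun a b => y (φ a) * Matrix.vandermonde (fun a => z (φ a)) a b := rfl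
    rw [this, Matrix.det_mul_column]
    refine isUnit_iff_ne_zero.2 (mul_ne_zero (Finset.prod_ne_zero_iff.2 fun a _ => hy _) ?_)
    exact Matrix.det_vandermonde_ne_zero_iff.2
      (hz.comp (Subtype.val_injective.comp φ.injective))
  let W := V⁻¹
  have hWV : W * V = 1 := Matrix.nonsing_inv_mul V hV
  set w : ℝ := ∑ b, ∑ a, ‖W b a‖ with hw
  have hw0 : 0 ≤ w := Finset.sum_nonneg fun _ _ => Finset.sum_nonneg fun _ _ => norm_nonneg _
  set Y : ℝ := ∑ j, ∑ i : Fin N, ‖y j * z j ^ (i : ℕ)‖ with hY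
  have hY0 : 0 ≤ Y := Finset.sum_nonneg fun _ _ => Finset.sum_nonneg fun _ _ => norm_nonneg _
  -- Here `w` bounds the inverse minor and `Y` bounds the columns moved across. The factor `2 * N`
  -- converts sums of norms into sums of squares.
  refine ⟨2 * N * (w * (1 + Y)) ^ 2, by positivity, fun g i hi => ?_⟩
  set v : Fin N → K := fun j => ∑ i : Fin N, (y j * z j ^ (i : ℕ)) • g i with hv
  set high := (Finset.univ : Finset (Fin N)).filter (fun i => m ≤ i.val) with hhigh
  set q : ℝ := ∑ j ∈ J, ‖v j‖ + ∑ i ∈ high, ‖g i‖ with hq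
  have hlow : ∀ a : Fin m, ∑ b : Fin m, V a b • g (Fin.castLE hmN b) =
      v (φ a) - ∑ i ∈ high, (y (φ a) * z (φ a) ^ (i : ℕ)) • g i := by
    intro a
    rw [eq_sub_iff_add_eq, hv]
    simp only
    rw [← Finset.sum_filter_add_sum_filter_not Finset.univ (fun i : Fin N => (i : ℕ) < m)]
    congr 1
    · refine Finset.sum_bij (fun b _ => Fin.castLE hmN b) (fun b _ => by simp) (fun b _ b' _ h => ?_)
        (fun i hi => ⟨⟨i, (Finset.mem_filter.1 hi).2⟩, Finset.mem_univ _, rfl⟩) (fun b _ => rfl)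
      exact Fin.castLE_injective hmN h
    · rw [hhigh]; simp only [not_lt]
  have hterm : ∀ a : Fin m, ‖∑ b : Fin m, V a b • g (Fin.castLE hmN b)‖ ≤ (1 + Y) * q := by
    intro a
    rw [hlow]
    have h1 : ‖v (φ a)‖ ≤ q := by
      have : ‖v (φ a)‖ ≤ ∑ j ∈ J, ‖v j‖ :=
        Finset.single_le_sum (f := fun j => ‖v j‖) (fun _ _ => norm_nonneg _) (φ a).2
      have h2 : 0 ≤ ∑ i ∈ high, ‖g i‖ := Finset.sum_nonneg fun _ _ => norm_nonneg _
      linarith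
    have h2 : ‖∑ i ∈ high, (y (φ a) * z (φ a) ^ (i : ℕ)) • g i‖ ≤ Y * q := by
      refine (norm_sum_le _ _).trans ?_
      have h3 : ∑ i ∈ high, ‖g i‖ ≤ q := by
        have h2 : 0 ≤ ∑ j ∈ J, ‖v j‖ := Finset.sum_nonneg fun _ _ => norm_nonneg _
        linarith
      calc ∑ i ∈ high, ‖(y (φ a) * z (φ a) ^ (i : ℕ)) • g i‖ ≤ ∑ i ∈ high, Y * ‖g i‖ := by
            refine Finset.sum_le_sum fun i _ => ?_
            rw [norm_smul]
            gcongr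
            refine (Finset.single_le_sum (f := fun i : Fin N => ‖y (φ a) * z (φ a) ^ (i : ℕ)‖)
              (fun _ _ => norm_nonneg _) (Finset.mem_univ i)).trans ?_
            exact Finset.single_le_sum (f := fun j => ∑ i : Fin N, ‖y j * z j ^ (i : ℕ)‖)
              (fun _ _ => Finset.sum_nonneg fun _ _ => norm_nonneg _) (Finset.mem_univ (φ a : Fin N))
        _ = Y * ∑ i ∈ high, ‖g i‖ := by rw [Finset.mul_sum]
        _ ≤ Y * q := by gcongr
    refine (norm_sub_le _ _).trans ?_
    linarith
  have hg : g i = ∑ a, W ⟨i, hi⟩ a • ∑ b : Fin m, V a b • g (Fin.castLE hmN b) := by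
    simp only [Finset.smul_sum, smul_smul]
    rw [Finset.sum_comm]
    simp only [← Finset.sum_smul]
    have : ∀ b, ∑ a, W ⟨i, hi⟩ a * V a b = (1 : Matrix (Fin m) (Fin m) ℂ) ⟨i, hi⟩ b := by
      intro b; rw [← hWV, Matrix.mul_apply]
    simp only [this, Matrix.one_apply, ite_smul, one_smul, zero_smul]
    simp
  have hq0 : 0 ≤ q := by positivity
  have hnorm : ‖g i‖ ≤ w * (1 + Y) * q := by
    rw [hg]
    refine (norm_sum_le _ _).trans ?_
    calc ∑ a, ‖W ⟨i, hi⟩ a • ∑ b : Fin m, V a b • g (Fin.castLE hmN b)‖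
        ≤ ∑ a, ‖W ⟨i, hi⟩ a‖ * ((1 + Y) * q) := by
          refine Finset.sum_le_sum fun a _ => ?_
          rw [norm_smul]
          have := hterm a
          gcongr
      _ = (∑ a, ‖W ⟨i, hi⟩ a‖) * ((1 + Y) * q) := by rw [Finset.sum_mul]
      _ ≤ w * ((1 + Y) * q) := by
          refine mul_le_mul_of_nonneg_right ?_ (by positivity)
          exact Finset.single_le_sum (f := fun b => ∑ a, ‖W b a‖)
              (fun _ _ => Finset.sum_nonneg fun _ _ => norm_nonneg _) (Finset.mem_univ _)
      _ = _ := by ring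
  have hq2 : q ^ 2 ≤ 2 * N * (∑ j ∈ J, ‖v j‖ ^ 2 + ∑ i ∈ high, ‖g i‖ ^ 2) := by
    have h1 : (∑ j ∈ J, ‖v j‖) ^ 2 ≤ N * ∑ j ∈ J, ‖v j‖ ^ 2 := by
      refine sq_sum_le_card_mul_sum_sq.trans ?_
      gcongr
    have h2 : (∑ i ∈ high, ‖g i‖) ^ 2 ≤ N * ∑ i ∈ high, ‖g i‖ ^ 2 := by
      refine sq_sum_le_card_mul_sum_sq.trans ?_
      gcongr
      simpa using high.card_le_univ
    rw [hq]
    nlinarith [sq_nonneg (∑ j ∈ J, ‖v j‖ - ∑ i ∈ high, ‖g i‖)]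
  calc ‖g i‖ ^ 2 ≤ (w * (1 + Y) * q) ^ 2 := by gcongr
    _ = (w * (1 + Y)) ^ 2 * q ^ 2 := by ring
    _ ≤ (w * (1 + Y)) ^ 2 * (2 * N * (∑ j ∈ J, ‖v j‖ ^ 2 + ∑ i ∈ high, ‖g i‖ ^ 2)) := by gcongr
    _ = _ := by ring

variable (K) in
-- There are finitely many `J`, and adding their constants gives one that serves all. In the folding
-- argument `J` varies from point to point.
lemma exists_vandermonde_bound {N : ℕ} {y z : Fin N → ℂ} (hy : ∀ j, y j ≠ 0)
    (hz : Function.Injective z) :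
    ∃ A : ℝ, 0 ≤ A ∧ ∀ (J : Finset (Fin N)) (g : Fin N → K) (i : Fin N), (i : ℕ) < J.card →
      ‖g i‖ ^ 2 ≤ A * (∑ j ∈ J, ‖∑ i : Fin N, (y j * z j ^ (i : ℕ)) • g i‖ ^ 2 +
        ∑ i : Fin N with J.card ≤ i.val, ‖g i‖ ^ 2) := by
  choose A hA0 hA using fun J => exists_vandermonde_bound_of_finset (K := K) hy hz J
  refine ⟨∑ J, A J, Finset.sum_nonneg fun J _ => hA0 J, fun J g i hi => (hA J g i hi).trans ?_⟩
  refine mul_le_mul_of_nonneg_right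
    (Finset.single_le_sum (f := A) (fun J _ => hA0 J) (Finset.mem_univ J)) (by positivity)

lemma ex_natCast_mul (n : ℕ) (s : ℝ) : ex (n * s) = ex s ^ n := by
  rw [ex, ex, ← Complex.exp_nat_mul]; congr 1; push_cast; ring

lemma ex_div_injective (N : ℕ) : Function.Injective fun j : Fin N => ex ((j : ℕ) / N) := by
  intro i j h
  have hN : (0 : ℝ) < N := by exact_mod_cast i.pos
  have h1 : ex ((i : ℕ) / N - (j : ℕ) / N) = 1 := by
    rw [sub_eq_add_neg, ex_add, ex_neg]
    simp only at h
    rw [h, mul_comm, Complex.conj_mul']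
    simp
  obtain ⟨n, hn⟩ := (ex_eq_one_iff _).1 h1
  have h2 : ((i : ℕ) : ℝ) - (j : ℕ) = n * N := by rw [← hn]; field_simp
  have h3 : ((i : ℕ) : ℤ) - (j : ℕ) = n * N := by exact_mod_cast h2
  have hi := i.2
  have hj := j.2
  have h4 : n = 0 := by
    by_contra hne
    rcases lt_or_gt_of_ne hne with h | h
    · nlinarith
    · nlinarith
  rw [h4] at h3
  exact Fin.ext (by omega)

variable (K) in
/-- Invertibility of the matrices formed by any `k` rows and the first `k` columns of the Fourier
matrix, in quantitative form. -/
lemma exists_fourier_bound (N : ℕ) :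
    ∃ A : ℝ, 0 ≤ A ∧ ∀ (J : Finset (Fin N)) (g : Fin N → K) (i : Fin N), (i : ℕ) < J.card →
      ‖g i‖ ^ 2 ≤ A * (∑ j ∈ J, ‖∑ i : Fin N, ex ((j : ℕ) * (i : ℕ) / N) • g i‖ ^ 2 +
        ∑ i : Fin N with J.card ≤ i.val, ‖g i‖ ^ 2) := by
  obtain ⟨A, hA0, hA⟩ := exists_vandermonde_bound K (y := fun _ : Fin N => (1 : ℂ))
    (fun _ => one_ne_zero) (ex_div_injective N)
  refine ⟨A, hA0, fun J g i hi => ?_⟩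
  convert! hA J g i hi using 8 with j _ i _
  rw [one_mul, ← ex_natCast_mul]; congr 1; ring

variable (K) in
/-- The variant of `exists_fourier_bound` for the last `k` columns. -/
lemma exists_fourier_bound_rev (N : ℕ) :
    ∃ A : ℝ, 0 ≤ A ∧ ∀ (J : Finset (Fin N)) (g : Fin N → K) (i : Fin N), (i : ℕ) < J.card →
      ‖g i‖ ^ 2 ≤ A * (∑ j ∈ J, ‖∑ i : Fin N, ex ((j : ℕ) * (i.rev : ℕ) / N) • g i‖ ^ 2 +
        ∑ i : Fin N with J.card ≤ i.val, ‖g i‖ ^ 2) := by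
  have hinj : Function.Injective fun j : Fin N => ex (-((j : ℕ) / N)) := fun i j h =>
    ex_div_injective N (by
      simp only [ex_neg] at h
      exact (starRingEnd ℂ).injective h)
  -- In reversed order the entries are `ex (j * (N - 1) / N) * ex (-(j / N)) ^ i`, again a row
  -- scaling times powers of distinct nodes.
  obtain ⟨A, hA0, hA⟩ := exists_vandermonde_bound K
    (y := fun j : Fin N => ex ((j : ℕ) * (N - 1) / N)) (fun _ => ex_ne_zero _) hinj
  refine ⟨A, hA0, fun J g i hi => ?_⟩
  convert! hA J g i hi using 8 with j _ i _
  rw [← ex_natCast_mul, ← ex_add, Fin.val_rev]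
  congr 1
  have : i.val + 1 ≤ N := i.2
  push_cast [this]; ring

end Vandermonde

/-- Back substitution: each `a i` is controlled by the data `E` and by terms of larger index only.
The induction removes index `0`, on which no other inequality depends. -/
lemma exists_triangular_bound (N : ℕ) {X : ℝ} (hX : 0 ≤ X) : ∃ Y : ℝ, 0 ≤ Y ∧
    ∀ (E : ℝ) (a : Fin N → ℝ), (∀ i, a i ≤ X * (E + ∑ i' with i < i', a i')) →
      ∑ i, a i ≤ Y * E := by
  induction N with
  | zero => exact ⟨0, le_rfl, fun E a _ => by simp⟩
  | succ n ih =>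
    obtain ⟨Y, hY0, hY⟩ := ih
    refine ⟨Y + X * (1 + Y), by positivity, fun E a ha => ?_⟩
    have h1 := hY E (fun i => a i.succ) (fun i => by
      refine (ha i.succ).trans (le_of_eq ?_)
      congr 2
      rw [Finset.sum_filter, Finset.sum_filter, Fin.sum_univ_succ]
      simp)
    have h2 : a 0 ≤ X * (E + ∑ i : Fin n, a i.succ) := by
      refine (ha 0).trans (le_of_eq ?_)
      congr 2
      rw [Finset.sum_filter, Fin.sum_univ_succ]
      simp
    rw [Fin.sum_univ_succ]
    have h3 : X * (E + ∑ i : Fin n, a i.succ) ≤ X * (E + Y * E) := by gcongr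
    nlinarith

/-! ### Folding a circle `N` times. -/

section Fold
variable {P Ω K : Type*} [Fintype P] [NormedAddCommGroup K] [InnerProductSpace ℂ K]
  {F : P → (Ω →₀ ℂ) →ₗ[ℂ] K}

open Classical in
/-- The points over which more than `i` of the `N` translates by `ℓ / N` belong to `σ`. -/
def level (N : ℕ) (ℓ : ℝ) (σ : ℝ → Set P) (i : ℕ) (t : ℝ) : Set P :=
  {p | i < (Finset.univ.filter fun j : Fin N => p ∈ σ (t + (j : ℕ) * (ℓ / N))).card}

lemma measurableSet_level {N : ℕ} {ℓ : ℝ} {σ : ℝ → Set P} (hσ : ∀ p, MeasurableSet {t | p ∈ σ t})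
    (i : ℕ) (p : P) : MeasurableSet {t | p ∈ level N ℓ σ i t} := by
  classical
  have h : Measurable fun t =>
      (Finset.univ.filter fun j : Fin N => p ∈ σ (t + (j : ℕ) * (ℓ / N))).card := by
    simp only [Finset.card_filter]
    refine Finset.measurable_sum _ fun j _ => Measurable.ite ?_ measurable_const measurable_const
    exact (measurable_id.add_const ((j : ℕ) * (ℓ / N))) (hσ p)
  convert! measurableSet_lt (measurable_const (a := i)) h using 1

/-- Division with remainder by `N`, with the residues enumerated in the order `e`. The identity
serves for sets and `Fin.revPerm` for complements. -/
lemma sum_residues {N : ℕ} (hN : 0 < N) (e : Fin N ≃ Fin N) (S : Finset ℤ) {M : Type*}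
    [AddCommMonoid M] (f : ℤ → M)
    (hinj : ∀ i : Fin N, Function.Injective fun k : ℤ => (N : ℤ) * k + ((e i : Fin N) : ℕ)) :
    ∑ l ∈ S, f l = ∑ i : Fin N, ∑ k ∈ S.preimage (fun k : ℤ => (N : ℤ) * k + ((e i : Fin N) : ℕ))
      (hinj i).injOn, f ((N : ℤ) * k + ((e i : Fin N) : ℕ)) := by
  have hN' : (0 : ℤ) < N := by exact_mod_cast hN
  rw [Finset.sum_sigma']
  symm
  have hlt : ∀ l : ℤ, (l % N).toNat < N := fun l => by
    have := Int.emod_lt_of_pos l hN'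
    have := Int.emod_nonneg l hN'.ne'
    omega
  refine Finset.sum_nbij' (fun x => (N : ℤ) * x.2 + ((e x.1 : Fin N) : ℕ))
    (fun l => ⟨e.symm ⟨(l % N).toNat, hlt l⟩, l / N⟩) ?_ ?_ ?_ ?_ ?_
  · rintro ⟨i, k⟩ hx
    simpa using hx
  · intro l hl
    simp only [Finset.mem_sigma, Finset.mem_univ, true_and, Finset.mem_preimage,
      Equiv.apply_symm_apply]
    rw [Int.toNat_of_nonneg (Int.emod_nonneg l hN'.ne'), Int.mul_ediv_add_emod]
    exact hl
  · rintro ⟨i, k⟩ _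
    have h1 := (e i).2
    have h2 : ((N : ℤ) * k + ((e i : Fin N) : ℕ)) / N = k := by
      rw [add_comm, Int.add_mul_ediv_left _ _ hN'.ne',
        Int.ediv_eq_zero_of_lt (by positivity) (by exact_mod_cast h1), zero_add]
    have h3 : ((N : ℤ) * k + ((e i : Fin N) : ℕ)) % N = ((e i : Fin N) : ℕ) := by
      rw [add_comm, Int.add_mul_emod_self_left,
        Int.emod_eq_of_lt (by positivity) (by exact_mod_cast h1)]
    simp only [h2, h3, Int.toNat_natCast, Fin.eta, Equiv.symm_apply_apply]
  · intro l _
    simp only [Equiv.apply_symm_apply]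
    rw [Int.toNat_of_nonneg (Int.emod_nonneg l hN'.ne'), Int.mul_ediv_add_emod]
  · rintro ⟨i, k⟩ _; rfl

lemma integral_eq_sum_translates {N : ℕ} (hN : 0 < N) (ℓ : ℝ) {f : ℝ → ℝ}
    (hf : ∀ a b, IntervalIntegrable f volume a b) :
    ∫ t in (0 : ℝ)..ℓ, f t = ∑ j : Fin N, ∫ t in (0 : ℝ)..ℓ / N, f (t + (j : ℕ) * (ℓ / N)) := by
  have hN' : (N : ℝ) ≠ 0 := by exact_mod_cast hN.ne'
  have h := intervalIntegral.sum_integral_adjacent_intervals (f := f) (μ := volume)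
    (a := fun j : ℕ => (j : ℝ) * (ℓ / N)) (n := N) (fun k _ => hf _ _)
  have e1 : (N : ℝ) * (ℓ / N) = ℓ := by field_simp
  simp only [e1, Nat.cast_zero, zero_mul] at h
  rw [← h, Finset.sum_range]
  refine Finset.sum_congr rfl fun j _ => ?_
  rw [intervalIntegral.integral_comp_add_right]
  congr 1
  · ring
  · push_cast; ring

/-- Folding: lower Riesz bounds over the circle of length `ℓ / N` for the level sets of the
multiplicity function combine to a lower Riesz bound over the circle of length `ℓ`. -/
lemma IsRS.of_fold {N : ℕ} (hN : 0 < N) {ℓ : ℝ} (hℓ : 0 < ℓ) {σ : ℝ → Set P}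
    (hσm : ∀ p, MeasurableSet {t | p ∈ σ t}) (e : Fin N ≃ Fin N)
    {A : ℝ} (hA0 : 0 ≤ A) (hA : ∀ (J : Finset (Fin N)) (g : Fin N → K) (i : Fin N),
      (i : ℕ) < J.card → ‖g i‖ ^ 2 ≤
        A * (∑ j ∈ J, ‖∑ i : Fin N, ex ((j : ℕ) * ((e i : Fin N) : ℕ) / N) • g i‖ ^ 2 +
        ∑ i : Fin N with J.card ≤ i.val, ‖g i‖ ^ 2))
    {C : ℝ} (hC : 0 ≤ C) {Δ : Fin N → Set (Ω × ℤ)}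
    (hΔ : ∀ i : Fin N, IsRS F (ℓ / N) (level N ℓ σ i) (Δ i) C)
    {Γ : Set (Ω × ℤ)} (hΓ : ∀ ξ (k : ℤ) (i : Fin N),
      (ξ, (N : ℤ) * k + ((e i : Fin N) : ℕ)) ∈ Γ → (ξ, k) ∈ Δ i)
    {Y : ℝ} (hY : ∀ (E : ℝ) (a : Fin N → ℝ), (∀ i, a i ≤ C * A * (E + ∑ i' with i < i', a i')) →
      ∑ i, a i ≤ Y * E) : IsRS F ℓ σ Γ (N * Y) := by
  classical
  have hN0 : (0 : ℝ) < N := by exact_mod_cast hN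
  have hℓN : 0 < ℓ / N := by positivity
  intro S c hc
  have hinj : ∀ i : Fin N, Function.Injective fun k : ℤ => (N : ℤ) * k + ((e i : Fin N) : ℕ) := by
    intro i k k' h
    have hN' : (N : ℤ) ≠ 0 := by exact_mod_cast hN.ne'
    exact mul_left_cancel₀ hN' (add_right_cancel h)
  set T : Fin N → Finset ℤ := fun i =>
    S.preimage (fun k : ℤ => (N : ℤ) * k + ((e i : Fin N) : ℕ)) (hinj i).injOn with hT
  set d : Fin N → ℤ → Ω →₀ ℂ := fun i k => c ((N : ℤ) * k + ((e i : Fin N) : ℕ)) with hd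
  set u := wave F ℓ S c with hu
  set h : Fin N → P → ℝ → K := fun i => wave F (ℓ / N) (T i) (d i) with hh
  have hhc : ∀ i p, Continuous (h i p) := fun i p => continuous_trigSum _ _ _
  -- The `N` values over one fibre are the Fourier matrix applied to the waves of the residue
  -- classes, each modulated by a factor of modulus one depending on `t`.
  have hexp : ∀ p t (j : Fin N), u p (t + (j : ℕ) * (ℓ / N)) = ∑ i : Fin N,
      ex ((j : ℕ) * ((e i : Fin N) : ℕ) / N) • (ex (((e i : Fin N) : ℕ) * t / ℓ) • h i p t) := by
    intro p t j
    rw [hu, wave, trigSum, sum_residues hN e S _ hinj]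
    refine Finset.sum_congr rfl fun i _ => ?_
    simp only [hh, wave, trigSum, Finset.smul_sum, smul_smul, ← ex_add]
    refine Finset.sum_congr rfl fun k _ => ?_
    congr 1
    symm
    rw [← ex_add_int _ (k * (j : ℕ))]
    congr 1
    push_cast
    field_simp
    ring
  set E := ∑ p, ∫ t in (0 : ℝ)..ℓ, ‖{t | p ∈ σ t}.indicator (u p) t‖ ^ 2 with hE
  set a : Fin N → ℝ := fun i => ℓ / N * ∑ k ∈ T i, nsq F (d i k) with ha
  have haI : ∀ i, a i = ∑ p, ∫ t in (0 : ℝ)..ℓ / N, ‖h i p t‖ ^ 2 := by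
    intro i
    have := sum_integral_sq_wave (F := F) hℓN 0 (T i) (d i)
    rw [zero_add] at this
    exact this.symm
  have hint : ∀ p a b, IntervalIntegrable (fun t => ‖{t | p ∈ σ t}.indicator (u p) t‖ ^ 2) volume a b :=
    fun p a b => intervalIntegrable_indicator_trigSum (hσm p) _ _ _ _ _
  have hint' : ∀ p (j : Fin N), IntervalIntegrable (fun t => ‖{t | p ∈ σ t}.indicator (u p)
      (t + (j : ℕ) * (ℓ / N))‖ ^ 2) volume 0 (ℓ / N) := by
    intro p j
    have := (hint p (0 + (j : ℕ) * (ℓ / N)) (ℓ / N + (j : ℕ) * (ℓ / N))).comp_add_right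
      ((j : ℕ) * (ℓ / N))
    simpa using this
  have hhint : ∀ p i, IntervalIntegrable (fun t => ‖h i p t‖ ^ 2) volume 0 (ℓ / N) := by
    intro p i
    have := hhc i p
    exact Continuous.intervalIntegrable (by fun_prop) _ _
  have hkey : ∀ i, a i ≤ C * A * (E + ∑ i' with i < i', a i') := by
    intro i
    refine (hΔ i (T i) (d i) fun k hk ξ hξ => hΓ ξ k i (hc _ (by simpa [hT] using hk) ξ hξ)).trans ?_
    rw [mul_assoc]
    refine mul_le_mul_of_nonneg_left ?_ hC
    simp only [haI]
    rw [hE, Finset.sum_comm (s := Finset.univ.filter fun i' => i < i'), ← Finset.sum_add_distrib,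
      Finset.mul_sum]
    refine Finset.sum_le_sum fun p _ => ?_
    have hI1 : IntervalIntegrable (fun t => ∑ j : Fin N, ‖{t | p ∈ σ t}.indicator (u p)
        (t + (j : ℕ) * (ℓ / N))‖ ^ 2) volume 0 (ℓ / N) := by
      convert! IntervalIntegrable.sum Finset.univ (fun j _ => hint' p j) using 1
      ext t; simp
    have hI2 : IntervalIntegrable (fun t => ∑ i' with i < i', ‖h i' p t‖ ^ 2) volume 0 (ℓ / N) := by
      convert! IntervalIntegrable.sum (Finset.univ.filter fun i' => i < i')
        (fun j _ => hhint p j) using 1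
      ext t; simp
    rw [integral_eq_sum_translates hN ℓ (hint p), ← intervalIntegral.integral_finsetSum
      (fun j _ => hint' p j), ← intervalIntegral.integral_finsetSum (fun j _ => hhint p j),
      ← intervalIntegral.integral_add hI1 hI2, ← intervalIntegral.integral_const_mul]
    refine intervalIntegral.integral_mono_on hℓN.le
      (intervalIntegrable_indicator_trigSum (measurableSet_level hσm i p) _ _ _ _ _)
      ((hI1.add hI2).const_mul _) fun t _ => ?_
    by_cases hp : p ∈ level N ℓ σ i t
    · have e1 : {t | p ∈ level N ℓ σ i t}.indicator (wave F (ℓ / N) (T i) (d i) p) t = h i p t :=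
        Set.indicator_of_mem (s := {t | p ∈ level N ℓ σ i t}) hp _
      rw [e1]
      set J := Finset.univ.filter fun j : Fin N => p ∈ σ (t + (j : ℕ) * (ℓ / N)) with hJ
      have hiJ : (i : ℕ) < J.card := hp
      -- More than `i` translates are visible at `t`, so the `i`-th component is determined by the
      -- visible values and the components with index at least `J.card`. These have index larger
      -- than `i`, which is the triangular structure.
      have h1 := hA J (fun i => ex (((e i : Fin N) : ℕ) * t / ℓ) • h i p t) i hiJ
      simp only [← hexp, norm_smul, norm_ex, one_mul] at h1
      refine h1.trans ?_
      gcongr ?_ * (?_ + ?_)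
      · rw [← Finset.sum_filter_add_sum_filter_not Finset.univ
          (fun j : Fin N => p ∈ σ (t + (j : ℕ) * (ℓ / N)))]
        refine le_add_of_le_of_nonneg (Finset.sum_le_sum fun j hj => ?_)
          (Finset.sum_nonneg fun _ _ => by positivity)
        have hj' : (t + (j : ℕ) * (ℓ / N)) ∈ {t | p ∈ σ t} := (Finset.mem_filter.1 hj).2
        rw [Set.indicator_of_mem hj']
      · refine Finset.sum_le_sum_of_subset_of_nonneg (fun i' hi' => ?_) fun _ _ _ => by positivity
        simp only [Finset.mem_filter, Finset.mem_univ, true_and] at hi' ⊢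
        exact Fin.lt_def.2 (by omega)
    · have e1 : {t | p ∈ level N ℓ σ i t}.indicator (wave F (ℓ / N) (T i) (d i) p) t = 0 :=
        Set.indicator_of_notMem (s := {t | p ∈ level N ℓ σ i t}) hp _
      rw [e1, norm_zero, zero_pow two_ne_zero]
      positivity
  have hfin := hY E a hkey
  have : ℓ * ∑ l ∈ S, nsq F (c l) = N * ∑ i, a i := by
    rw [sum_residues hN e S _ hinj]
    simp only [ha, ← Finset.mul_sum]
    field_simp
    rfl
  rw [this, mul_assoc]
  gcongr

end Fold

/-! ### Step functions on a circle. -/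

section Step
variable {P : Type*}

/-- `σ` is `ℓ`-periodic, right continuous, and jumps only at points of `D + ℓ ℤ`. -/
def IsStep (ℓ : ℝ) (D : Finset ℝ) (σ : ℝ → Set P) : Prop :=
  Function.Periodic σ ℓ ∧ ∀ s t, s < t →
    (∀ d ∈ D, ∀ n : ℤ, ¬ (s < d + n * ℓ ∧ d + n * ℓ ≤ t)) → σ s = σ t

lemma IsStep.map {ℓ : ℝ} {D : Finset ℝ} {σ : ℝ → Set P} (h : IsStep ℓ D σ) (f : Set P → Set P) :
    IsStep ℓ D fun t => f (σ t) :=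
  ⟨fun t => by simp only [h.1 t], fun s t hst hd => by simp only [h.2 s t hst hd]⟩

lemma isStep_const (ℓ : ℝ) (D : Finset ℝ) (B : Set P) : IsStep ℓ D fun _ => B :=
  ⟨fun _ => rfl, fun _ _ _ _ => rfl⟩

/-- For one `d` the first translate to the right of `t` is `toIocMod hℓ t d`; stopping halfway
avoids it and all later ones. The induction takes a minimum over `D`. -/
lemma exists_gap_right {ℓ : ℝ} (hℓ : 0 < ℓ) (D : Finset ℝ) (t : ℝ) :
    ∃ δ > 0, ∀ d ∈ D, ∀ n : ℤ, ¬ (t < d + n * ℓ ∧ d + n * ℓ ≤ t + δ) := by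
  induction D using Finset.induction_on with
  | empty => exact ⟨1, one_pos, by simp⟩
  | insert d D _ ih =>
    obtain ⟨δ, hδ, h⟩ := ih
    set x := toIocMod hℓ t d with hx
    have hxm := toIocMod_mem_Ioc hℓ t d
    refine ⟨min δ ((x - t) / 2), lt_min hδ (by linarith [hxm.1]), fun e he n hn => ?_⟩
    rcases Finset.mem_insert.1 he with rfl | he
    · have h1 : e + n * ℓ ≤ t + (x - t) / 2 := hn.2.trans (by gcongr; exact min_le_right _ _)
      have h2 : toIocMod hℓ t (e + n • ℓ) = e + n • ℓ := by
        rw [toIocMod_eq_self hℓ, zsmul_eq_mul]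
        exact ⟨hn.1, by linarith [hxm.2, hxm.1]⟩
      rw [toIocMod_add_zsmul, zsmul_eq_mul] at h2
      linarith [hxm.1]
    · exact h e he n ⟨hn.1, hn.2.trans (by gcongr; exact min_le_left _ _)⟩

/-- By right continuity each point of the set is joined inside the set to a rational on its right,
so the set is a countable union of order connected components. -/
lemma IsStep.measurableSet {ℓ : ℝ} (hℓ : 0 < ℓ) {D : Finset ℝ} {σ : ℝ → Set P}
    (h : IsStep ℓ D σ) (p : P) : MeasurableSet {t | p ∈ σ t} := by
  set A := {t | p ∈ σ t} with hA
  have : A = ⋃ q : ℚ, Set.ordConnectedComponent A q := by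
    ext t
    simp only [Set.mem_iUnion]
    constructor
    · intro ht
      obtain ⟨δ, hδ, hgap⟩ := exists_gap_right hℓ D t
      obtain ⟨q, hq1, hq2⟩ := exists_rat_btwn (by linarith : t < t + δ)
      refine ⟨q, ?_⟩
      rw [Set.mem_ordConnectedComponent, Set.uIcc_of_ge hq1.le]
      intro s hs
      rcases hs.1.eq_or_lt with rfl | hlt
      · exact ht
      · have := h.2 t s hlt fun d hd n hn => hgap d hd n ⟨hn.1, by linarith [hn.2, hs.2]⟩
        change p ∈ σ s
        rw [← this]; exact ht
    · rintro ⟨q, hq⟩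
      exact Set.ordConnectedComponent_subset hq
  rw [this]
  exact MeasurableSet.iUnion fun q => Set.OrdConnected.measurableSet inferInstance

end Step

/-! ### Coherent choices of frequencies and their transport between circles. -/

section Good
variable {P Ω K : Type*} [Fintype P] [NormedAddCommGroup K] [InnerProductSpace ℂ K]

/-- There is a coherent choice of frequencies for all step functions with jumps in `D + ℓ ℤ`, with
lower Riesz bound `C` for the sets they describe and for the complements. -/
def Good (F : P → (Ω →₀ ℂ) →ₗ[ℂ] K) (Ξ : Set P → Set Ω) (ℓ : ℝ) (D : Finset ℝ) (C : ℝ) : Prop :=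
  ∃ Γ : (ℝ → Set P) → Set (Ω × ℤ),
    (∀ σ τ, IsStep ℓ D σ → IsStep ℓ D τ → (∀ t, σ t ⊆ τ t) → Γ σ ⊆ Γ τ) ∧
    (∀ σ, IsStep ℓ D σ → IsRS F ℓ σ (Γ σ) C) ∧
    (∀ σ, IsStep ℓ D σ → IsRS F ℓ (fun t => (σ t)ᶜ) (Γ σ)ᶜ C) ∧
    ∀ B, Γ (fun _ => B) = {x | x.1 ∈ Ξ B}

variable {F : P → (Ω →₀ ℂ) →ₗ[ℂ] K} {Ξ : Set P → Set Ω}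

lemma level_const {N : ℕ} (ℓ : ℝ) (B : Set P) {i : ℕ} (hi : i < N) :
    level N ℓ (fun _ => B) i = fun _ => B := by
  funext t; ext p
  by_cases hp : p ∈ B <;> simp [level, hp, hi]

/-- The numbers of translates inside and outside the set add up to `N`, so taking complements
reverses the order of the levels. -/
lemma level_compl {N : ℕ} (ℓ : ℝ) (σ : ℝ → Set P) (i : Fin N) :
    level N ℓ (fun t => (σ t)ᶜ) i = fun t => (level N ℓ σ i.rev t)ᶜ := by
  classical
  funext t; ext p
  have h := Finset.card_filter_add_card_filter_not (s := (Finset.univ : Finset (Fin N)))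
    (fun j : Fin N => p ∈ σ (t + (j : ℕ) * (ℓ / N)))
  simp only [Finset.card_univ, Fintype.card_fin] at h
  have hi := i.2
  simp only [level, Set.mem_compl_iff, Set.mem_ofPred_eq, Fin.val_rev, not_lt]
  omega

lemma level_mono {N : ℕ} {ℓ : ℝ} {σ τ : ℝ → Set P} (h : ∀ t, σ t ⊆ τ t) (i : ℕ) (t : ℝ) :
    level N ℓ σ i t ⊆ level N ℓ τ i t := by
  classical
  intro p hp
  refine lt_of_lt_of_le hp (Finset.card_le_card fun j hj => ?_)
  simp only [Finset.mem_filter, Finset.mem_univ, true_and] at hj ⊢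
  exact h _ hj

/-- Translation by `ℓ / N` permutes the translates cyclically, since the `N`-th one coincides with
the zeroth by periodicity. Jumps therefore matter only modulo `ℓ / N`. -/
lemma IsStep.level {N : ℕ} (hN : 0 < N) {ℓ : ℝ} {D D' : Finset ℝ}
    (hD : ∀ d ∈ D, ∃ d' ∈ D', ∃ n : ℤ, d = d' + n * (ℓ / N)) {σ : ℝ → Set P} (h : IsStep ℓ D σ)
    (i : ℕ) : IsStep (ℓ / N) D' (level N ℓ σ i) := by
  classical
  have hN0 : (N : ℝ) ≠ 0 := by exact_mod_cast hN.ne'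
  constructor
  · intro t
    ext p
    have : (Finset.univ.filter fun j : Fin N => p ∈ σ (t + ℓ / N + (j : ℕ) * (ℓ / N))).card =
        (Finset.univ.filter fun j : Fin N => p ∈ σ (t + (j : ℕ) * (ℓ / N))).card := by
      rw [Finset.card_filter, Finset.card_filter]
      rw [← Finset.sum_range (fun j => if p ∈ σ (t + ℓ / N + (j : ℕ) * (ℓ / N)) then 1 else 0),
        ← Finset.sum_range (fun j => if p ∈ σ (t + (j : ℕ) * (ℓ / N)) then 1 else 0)]
      have h1 : ∀ j : ℕ, t + ℓ / N + (j : ℕ) * (ℓ / N) = t + ((j + 1 : ℕ) : ℕ) * (ℓ / N) := by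
        intro j; push_cast; ring
      simp only [h1]
      have h2 := Finset.sum_range_succ (fun j : ℕ => if p ∈ σ (t + (j : ℕ) * (ℓ / N)) then 1 else 0) N
      rw [Finset.sum_range_succ'] at h2
      have h3 : σ (t + (N : ℕ) * (ℓ / N)) = σ (t + (0 : ℕ) * (ℓ / N)) := by
        have : t + (N : ℕ) * (ℓ / N) = t + (0 : ℕ) * (ℓ / N) + ℓ := by
          field_simp; push_cast; ring
        rw [this, h.1]
      rw [h3] at h2
      exact Nat.add_right_cancel h2
    simp only [CoherentRiesz.level, Set.mem_ofPred_eq, this]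
  · intro s t hst hgap
    have : ∀ j : ℕ, σ (s + j * (ℓ / N)) = σ (t + j * (ℓ / N)) := by
      intro j
      refine h.2 _ _ (by linarith) fun d hd n hn => ?_
      obtain ⟨d', hd', n', rfl⟩ := hD d hd
      have e : d' + ((n' + n * N - j : ℤ) : ℝ) * (ℓ / N) = d' + n' * (ℓ / N) + n * ℓ - j * (ℓ / N) := by
        push_cast; field_simp; ring
      refine hgap d' hd' (n' + n * N - j) ?_
      rw [e]
      constructor <;> linarith [hn.1, hn.2]
    simp only [CoherentRiesz.level, this]

/-- Coherence survives because levels are monotone in `σ`. For complements the levels are reversed,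
so the residue classes are read backwards and the bound for the last columns replaces the one for
the first. The new constant depends on `N` and the old constant, not on `ℓ` or the jumps; the
perturbation argument needs this uniformity. -/
lemma Good.fold {N : ℕ} (hN : 0 < N) {C : ℝ} (hC : 0 ≤ C) (F : P → (Ω →₀ ℂ) →ₗ[ℂ] K)
    (Ξ : Set P → Set Ω) : ∃ C' : ℝ, 0 ≤ C' ∧ ∀ (ℓ : ℝ) (D D' : Finset ℝ), 0 < ℓ →
      (∀ d ∈ D, ∃ d' ∈ D', ∃ n : ℤ, d = d' + n * (ℓ / N)) →
      Good F Ξ (ℓ / N) D' C → Good F Ξ ℓ D C' := by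
  obtain ⟨A, hA0, hA⟩ := exists_fourier_bound K N
  obtain ⟨A', hA0', hA'⟩ := exists_fourier_bound_rev K N
  obtain ⟨Y, hY0, hY⟩ := exists_triangular_bound N (mul_nonneg hC hA0)
  obtain ⟨Y', hY0', hY'⟩ := exists_triangular_bound N (mul_nonneg hC hA0')
  refine ⟨max (N * Y) (N * Y'), by positivity, fun ℓ D D' hℓ hD ⟨Γ, hmono, hRS, hRS', hconst⟩ => ?_⟩
  have hN' : (0 : ℤ) < N := by exact_mod_cast hN
  have hmod : ∀ (k : ℤ) (i : Fin N), ((N : ℤ) * k + (i : ℕ)) / N = k ∧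
      (((N : ℤ) * k + (i : ℕ)) % N).toNat = i := by
    intro k i
    have h1 := i.2
    constructor
    · rw [add_comm, Int.add_mul_ediv_left _ _ hN'.ne',
        Int.ediv_eq_zero_of_lt (by positivity) (by exact_mod_cast h1), zero_add]
    · rw [add_comm, Int.add_mul_emod_self_left,
        Int.emod_eq_of_lt (by positivity) (by exact_mod_cast h1), Int.toNat_natCast]
  have hlt : ∀ l : ℤ, (l % N).toNat < N := fun l => by
    have := Int.emod_lt_of_pos l hN'
    have := Int.emod_nonneg l hN'.ne'
    omega
  refine ⟨fun σ => {x | (x.1, x.2 / N) ∈ Γ (level N ℓ σ (x.2 % N).toNat)}, ?_, ?_, ?_, ?_⟩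
  · intro σ τ hσ hτ hle x hx
    exact hmono _ _ (hσ.level hN hD _) (hτ.level hN hD _) (level_mono hle _) hx
  · intro σ hσ
    refine IsRS.mono hℓ.le (le_max_left _ _) (IsRS.of_fold hN hℓ (hσ.measurableSet hℓ)
      (Equiv.refl _) hA0 hA hC (fun i => hRS _ (hσ.level hN hD i)) (fun ξ k i h => ?_) hY)
    have h' : (ξ, ((N : ℤ) * k + (i : ℕ)) / N) ∈
        Γ (level N ℓ σ (((N : ℤ) * k + (i : ℕ)) % N).toNat) := h
    rwa [(hmod k i).1, (hmod k i).2] at h'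
  · intro σ hσ
    refine IsRS.mono hℓ.le (le_max_right _ _) (IsRS.of_fold hN hℓ
      ((hσ.map compl).measurableSet hℓ) Fin.revPerm hA0' hA' hC
      (Δ := fun i => (Γ (level N ℓ σ i.rev))ᶜ) (fun i => ?_) (fun ξ k i h => ?_) hY')
    · rw [level_compl]
      exact hRS' _ (hσ.level hN hD _)
    · have h' : (ξ, ((N : ℤ) * k + (i.rev : ℕ)) / N) ∉
          Γ (level N ℓ σ (((N : ℤ) * k + (i.rev : ℕ)) % N).toNat) := h
      rwa [(hmod k i.rev).1, (hmod k i.rev).2] at h'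
  · intro B
    ext ⟨ξ, l⟩
    simp only [Set.mem_ofPred_eq]
    rw [level_const ℓ B (hlt l), hconst]
    rfl

/-- The `ℓ`-periodic function that agrees with `σ` on `[a, a + ℓ)`. -/
def periodize {ℓ : ℝ} (hℓ : 0 < ℓ) (a : ℝ) (σ : ℝ → Set P) (t : ℝ) : Set P := σ (toIcoMod hℓ a t)

lemma periodize_eq {ℓ : ℝ} (hℓ : 0 < ℓ) {a : ℝ} (σ : ℝ → Set P) {t : ℝ}
    (ht : t ∈ Set.Ico a (a + ℓ)) : periodize hℓ a σ t = σ t := by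
  rw [periodize, (toIcoMod_eq_self hℓ).2 ht]

/-- Repeating the piece over `[a, a + ℓ)` can create new jumps only at `a + ℓ ℤ`, which is why `a`
must belong to `D`. -/
lemma IsStep.periodize {ℓ L : ℝ} (hℓ : 0 < ℓ) (hL : ℓ < L) {a : ℝ} {D : Finset ℝ} (ha : a ∈ D)
    (hD : ∀ d ∈ D, d ∈ Set.Icc a (a + ℓ)) {σ : ℝ → Set P} (h : IsStep L D σ) :
    IsStep ℓ D (periodize hℓ a σ) := by
  constructor
  · intro t
    rw [CoherentRiesz.periodize, CoherentRiesz.periodize, toIcoMod_add_right]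
  · intro s t hst hgap
    set m := toIcoDiv hℓ a s with hm
    have hs1 : toIcoMod hℓ a s = s - m * ℓ := by rw [toIcoMod, zsmul_eq_mul]
    have hs2 := toIcoMod_mem_Ico hℓ a s
    rw [hs1] at hs2
    have ht1 : t < a + (m + 1) * ℓ := by
      by_contra hcon
      refine hgap a ha (m + 1) ⟨?_, ?_⟩
      · push_cast; linarith [hs2.2]
      · push_cast; linarith
    have ht2 : toIcoMod hℓ a t = t - m * ℓ := by
      rw [← toIcoMod_sub_zsmul hℓ a t m, zsmul_eq_mul, toIcoMod_eq_self]
      exact ⟨by linarith [hs2.1], by linarith⟩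
    rw [CoherentRiesz.periodize, CoherentRiesz.periodize, hs1, ht2]
    refine h.2 _ _ (by linarith) fun d hd n hn => ?_
    have hd' := hD d hd
    have hL0 : 0 < L := hℓ.trans hL
    rcases lt_trichotomy n 0 with h0 | h0 | h0
    · have : (n : ℝ) ≤ -1 := by exact_mod_cast Int.le_sub_one_of_lt h0
      have : n * L ≤ -1 * L := by gcongr
      linarith [hn.1, hd'.2, hs2.1]
    · subst h0
      refine hgap d hd m ?_
      simp only [Int.cast_zero, zero_mul, add_zero] at hn
      constructor <;> linarith [hn.1, hn.2]
    · have : (1 : ℝ) ≤ n := by exact_mod_cast h0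
      have : 1 * L ≤ n * L := by gcongr
      linarith [hn.2, hd'.1]

lemma IsStep.eq_of_mem_long {ℓ L : ℝ} {a : ℝ} {D : Finset ℝ} (hℓ : 0 < ℓ) (hL : ℓ < L)
    (hD : ∀ d ∈ D, d ∈ Set.Icc a (a + ℓ)) {σ : ℝ → Set P} (h : IsStep L D σ) {t : ℝ}
    (ht : t ∈ Set.Ico (a + ℓ) (a + L)) : σ t = σ (a + ℓ) := by
  rcases ht.1.eq_or_lt with h0 | h0
  · rw [h0]
  · symm
    refine h.2 _ _ h0 fun d hd n hn => ?_
    have hd' := hD d hd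
    have hL0 : 0 < L := hℓ.trans hL
    rcases lt_trichotomy n 0 with h0 | h0 | h0
    · have : (n : ℝ) ≤ -1 := by exact_mod_cast Int.le_sub_one_of_lt h0
      have : n * L ≤ -1 * L := by gcongr
      linarith [hn.1, hd'.2]
    · subst h0
      simp only [Int.cast_zero, zero_mul, add_zero] at hn
      linarith [hn.1, hd'.2]
    · have : (1 : ℝ) ≤ n := by exact_mod_cast h0
      have : 1 * L ≤ n * L := by gcongr
      linarith [hn.2, hd'.1, ht.2]

/-- A gap of three keeps the integers `⌊k * x⌋` and `⌊k * x⌋ + 1` distinct for all `k`, so both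
sequences are injective with disjoint ranges. -/
lemma floor_mul_gap {x : ℝ} (hx : 3 ≤ x) {j k : ℤ} (h : j < k) : ⌊j * x⌋ + 3 ≤ ⌊k * x⌋ := by
  rw [Int.le_floor]
  have h1 := Int.floor_le (j * x)
  have h2 : (j : ℝ) + 1 ≤ k := by exact_mod_cast h
  push_cast
  nlinarith

/-- With `B` the value of `σ` outside the short interval, the choice is sandwiched: `Γ (σ ∩ B)` lies
below `Ξ B` times all integers and `Γ (σ ∪ B)` above it. This follows from monotonicity and the
clause on constant slices in `Good`. It puts the frequencies of `σ` off the range of `ρ` into `Ξ B`,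
and those of the complement off the range of `ρ'` into `(Ξ B)ᶜ`. -/
lemma Good.of_short_circle {ℓ L : ℝ} (hℓ : 0 < ℓ) (hL : 3 * ℓ ≤ L) {s : ℝ} (hs : L / ℓ ≤ s)
    {a R : ℝ} (ha : |a| ≤ R) (ha' : |a + ℓ| ≤ R) {D : Finset ℝ} (haD : a ∈ D)
    (hD : ∀ d ∈ D, d ∈ Set.Icc a (a + ℓ)) {C C₀ : ℝ} (hC : 0 ≤ C) (hC₀ : 0 ≤ C₀)
    (hδ : 8 * (1 + C) * (64 * Real.pi ^ 2 * (2 / L) ^ 2 * R ^ 2) ≤ 1)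
    (hΞ : ∀ B, IsBaseRS F B (Ξ B) C₀) (hΞ' : ∀ B, IsBaseRS F Bᶜ (Ξ B)ᶜ C₀)
    (h : Good F Ξ ℓ D C) : Good F Ξ L D (shortCircleConst C C₀ s) := by
  have hℓL : ℓ < L := by linarith
  have hL0 : 0 < L := hℓ.trans hℓL
  obtain ⟨Γ, hmono, hRS, hRS', hconst⟩ := h
  set ρ : ℤ → ℤ := fun k => ⌊k * (L / ℓ)⌋ with hρdef
  set ρ' : ℤ → ℤ := fun k => ρ k + 1 with hρdef'
  have h3 : 3 ≤ L / ℓ := by rw [le_div_iff₀ hℓ]; exact hL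
  have hgap : ∀ {j k : ℤ}, j < k → ρ j + 3 ≤ ρ k := fun h => floor_mul_gap h3 h
  have hρ : Function.Injective ρ := by
    intro j k hjk
    rcases lt_trichotomy j k with h | h | h
    · have := hgap h; omega
    · exact h
    · have := hgap h; omega
  have hρ' : Function.Injective ρ' := fun j k hjk => hρ (by simp only [hρdef'] at hjk; omega)
  have hdisj : ∀ j k, ρ j ≠ ρ' k := by
    intro j k hjk
    simp only [hρdef'] at hjk
    rcases lt_trichotomy j k with h | h | h
    · have := hgap h; omega
    · subst h; omega
    · have := hgap h; omega
  -- Rounding down moves a frequency by at most `1 / L`, and the shift by one in `ρ'` moves it by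
  -- another `1 / L`; the common bound `2 / L` covers both copies.
  have hκ : ∀ k, |ρ k / L - k / ℓ| ≤ 2 / L := by
    intro k
    have h1 : (ρ k : ℝ) / L - k / ℓ = (ρ k - k * (L / ℓ)) / L := by field_simp
    rw [h1, abs_div, abs_of_pos hL0]
    gcongr
    rw [abs_le]
    have := Int.floor_le (k * (L / ℓ))
    have := Int.lt_floor_add_one (k * (L / ℓ))
    constructor <;> linarith
  have hκ' : ∀ k, |ρ' k / L - k / ℓ| ≤ 2 / L := by
    intro k
    have h1 : (ρ' k : ℝ) / L - k / ℓ = (ρ k + 1 - k * (L / ℓ)) / L := by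
      simp only [hρdef']; push_cast; field_simp
    rw [h1, abs_div, abs_of_pos hL0]
    gcongr
    rw [abs_le]
    have := Int.floor_le (k * (L / ℓ))
    have := Int.lt_floor_add_one (k * (L / ℓ))
    constructor <;> linarith
  have hR : ∀ t ∈ Set.uIoc a (a + ℓ), |t| ≤ R := by
    intro t ht
    rw [Set.uIoc_of_le (by linarith)] at ht
    rw [abs_le] at ha ha' ⊢
    constructor <;> linarith [ht.1, ht.2]
  set per := periodize (P := P) hℓ a with hper
  set up : (ℝ → Set P) → ℝ → Set P := fun σ t => per σ t ∪ σ (a + ℓ) with hup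
  set dn : (ℝ → Set P) → ℝ → Set P := fun σ t => per σ t ∩ σ (a + ℓ) with hdn
  have hups : ∀ σ, IsStep L D σ → IsStep ℓ D (up σ) := fun σ hσ =>
    (hσ.periodize hℓ hℓL haD hD).map fun A => A ∪ σ (a + ℓ)
  have hdns : ∀ σ, IsStep L D σ → IsStep ℓ D (dn σ) := fun σ hσ =>
    (hσ.periodize hℓ hℓL haD hD).map fun A => A ∩ σ (a + ℓ)
  have hle : ∀ σ, IsStep L D σ → ∀ ξ k, (ξ, k) ∈ Γ (dn σ) → ξ ∈ Ξ (σ (a + ℓ)) := by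
    intro σ hσ ξ k hx
    have := hmono _ _ (hdns σ hσ) (isStep_const ℓ D (σ (a + ℓ))) (fun t => Set.inter_subset_right) hx
    rw [hconst] at this
    exact this
  have hge : ∀ σ, IsStep L D σ → ∀ ξ k, ξ ∈ Ξ (σ (a + ℓ)) → (ξ, k) ∈ Γ (up σ) := by
    intro σ hσ ξ k hx
    refine hmono _ _ (isStep_const ℓ D (σ (a + ℓ))) (hups σ hσ) (fun t => Set.subset_union_right) ?_
    rw [hconst]
    exact hx
  have hΞmono : ∀ B B', B ⊆ B' → Ξ B ⊆ Ξ B' := by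
    intro B B' hB ξ hξ
    have : (ξ, (0 : ℤ)) ∈ Γ (fun _ => B') := by
      refine hmono _ _ (isStep_const ℓ D B) (isStep_const ℓ D B') (fun _ => hB) ?_
      rw [hconst]; exact hξ
    rw [hconst] at this
    exact this
  refine ⟨fun σ => {x | (∃ k, x.2 = ρ k ∧ (x.1, k) ∈ Γ (up σ)) ∨
    (∃ k, x.2 = ρ' k ∧ (x.1, k) ∈ Γ (dn σ)) ∨
    (x.2 ∉ Set.range ρ ∧ x.2 ∉ Set.range ρ' ∧ x.1 ∈ Ξ (σ (a + ℓ)))}, ?_, ?_, ?_, ?_⟩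
  · intro σ τ hσ hτ hστ x hx
    rcases hx with ⟨k, hk, hx⟩ | ⟨k, hk, hx⟩ | ⟨h1, h2, hx⟩
    · exact Or.inl ⟨k, hk, hmono _ _ (hups σ hσ) (hups τ hτ)
        (fun t => Set.union_subset_union (hστ _) (hστ _)) hx⟩
    · exact Or.inr (Or.inl ⟨k, hk, hmono _ _ (hdns σ hσ) (hdns τ hτ)
        (fun t => Set.inter_subset_inter (hστ _) (hστ _)) hx⟩)
    · exact Or.inr (Or.inr ⟨h1, h2, hΞmono _ _ (hστ _) hx⟩)
  · intro σ hσ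
    refine IsRS.of_short_circle hℓ hℓL.le hs hR hρ hρ' hκ hκ' hC hC₀ hδ hσ.1 (hups σ hσ).1
      (hdns σ hσ).1 (hσ.measurableSet hL0) ((hups σ hσ).measurableSet hℓ)
      ((hdns σ hσ).measurableSet hℓ) (B := σ (a + ℓ)) (fun t ht => ?_) (fun t ht => ?_)
      (fun t ht => hσ.eq_of_mem_long hℓ hℓL hD ht) (hRS _ (hups σ hσ)) (hRS _ (hdns σ hσ))
      (hΞ _) ?_ ?_ ?_
    · simp only [hup, hper, periodize_eq hℓ σ ht]
    · simp only [hdn, hper, periodize_eq hℓ σ ht]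
    · rintro ξ k (⟨k', hk, hx⟩ | ⟨k', hk, hx⟩ | ⟨h1, h2, hx⟩)
      · rwa [hρ hk]
      · exact absurd hk (hdisj _ _)
      · exact absurd ⟨k, rfl⟩ h1
    · rintro ξ k (⟨k', hk, hx⟩ | ⟨k', hk, hx⟩ | ⟨h1, h2, hx⟩)
      · exact absurd hk.symm (hdisj _ _)
      · rwa [hρ' hk]
      · exact absurd ⟨k, rfl⟩ h2
    · rintro ξ l hl (⟨k', hk, hx⟩ | ⟨k', hk, hx⟩ | ⟨h1, h2, hx⟩)
      · exact absurd ⟨k', hk.symm⟩ hl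
      · exact hle σ hσ ξ k' hx
      · exact hx
  · intro σ hσ
    have hcup := (hups σ hσ).map compl
    have hcdn := (hdns σ hσ).map compl
    -- Complementation exchanges union and intersection, so here `ρ'` takes the role of `ρ` and
    -- conversely.
    refine IsRS.of_short_circle hℓ hℓL.le hs hR hρ' hρ hκ' hκ hC hC₀ hδ (hσ.map compl).1 hcdn.1
      hcup.1 ((hσ.map compl).measurableSet hL0) (hcdn.measurableSet hℓ)
      (hcup.measurableSet hℓ) (B := (σ (a + ℓ))ᶜ) (fun t ht => ?_) (fun t ht => ?_)
      (fun t ht => ?_) (hRS' _ (hdns σ hσ)) (hRS' _ (hups σ hσ))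
      (hΞ' _) ?_ ?_ ?_
    · simp only [hdn, hper, periodize_eq hℓ σ ht, Set.compl_inter]
    · simp only [hup, hper, periodize_eq hℓ σ ht, Set.compl_union]
    · simp only [hσ.eq_of_mem_long hℓ hℓL hD ht]
    · intro ξ k hx hk
      exact hx (Or.inr (Or.inl ⟨k, rfl, hk⟩))
    · intro ξ k hx hk
      exact hx (Or.inl ⟨k, rfl, hk⟩)
    · intro ξ l hl hx hξ
      by_cases hlr : l ∈ Set.range ρ
      · obtain ⟨k, rfl⟩ := hlr
        exact hx (Or.inl ⟨k, rfl, hge σ hσ ξ k hξ⟩)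
      · exact hx (Or.inr (Or.inr ⟨hlr, hl, hξ⟩))
  · intro B
    have h1 : up (fun _ => B) = fun _ => B := by funext t; simp [hup, hper, periodize]
    have h2 : dn (fun _ => B) = fun _ => B := by funext t; simp [hdn, hper, periodize]
    simp only [h1, h2, hconst]
    ext ⟨ξ, l⟩
    simp only [Set.mem_ofPred_eq]
    constructor
    · rintro (⟨k, _, hx⟩ | ⟨k, _, hx⟩ | ⟨_, _, hx⟩) <;> exact hx
    · intro hξ
      by_cases h1 : l ∈ Set.range ρ
      · obtain ⟨k, rfl⟩ := h1
        exact Or.inl ⟨k, rfl, hξ⟩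
      · by_cases h2 : l ∈ Set.range ρ'
        · obtain ⟨k, rfl⟩ := h2
          exact Or.inr (Or.inl ⟨k, rfl, hξ⟩)
        · exact Or.inr (Or.inr ⟨h1, h2, hξ⟩)

end Good

/-! ### Simultaneous inhomogeneous approximation. -/

section Kronecker
open Filter Topology

lemma tendsto_average_ex {s : ℝ} (hs : ∀ n : ℤ, s ≠ n) :
    Tendsto (fun M : ℕ => (∑ k ∈ Finset.range M, ex ((k + 1 : ℕ) * s)) / (M : ℂ)) atTop (𝓝 0) := by
  have hz : ex s - 1 ≠ 0 := by
    intro h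
    obtain ⟨n, hn⟩ := (ex_eq_one_iff s).1 (sub_eq_zero.1 h)
    exact hs n hn
  rw [tendsto_zero_iff_norm_tendsto_zero]
  have hb : ∀ M : ℕ, ‖(∑ k ∈ Finset.range M, ex ((k + 1 : ℕ) * s)) / (M : ℂ)‖ ≤
      2 / ‖ex s - 1‖ / M := by
    intro M
    rw [norm_div, Complex.norm_natCast]
    gcongr
    rw [le_div_iff₀ (norm_pos_iff.2 hz), ← norm_mul]
    have : (∑ k ∈ Finset.range M, ex ((k + 1 : ℕ) * s)) * (ex s - 1) = ex s * (ex s ^ M - 1) := by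
      rw [← geom_sum_mul, ← mul_assoc, Finset.mul_sum]
      congr 1
      refine Finset.sum_congr rfl fun k _ => ?_
      rw [ex_natCast_mul, pow_succ']
    rw [this, norm_mul, norm_ex, one_mul]
    refine (norm_sub_le _ _).trans ?_
    rw [norm_pow, norm_ex]; norm_num
  refine squeeze_zero (fun _ => norm_nonneg _) hb ?_
  exact tendsto_const_nhds.div_atTop tendsto_natCast_atTop_atTop

/-- The mean square of an almost periodic sum is at least the sum of the squares of the
coefficients. -/
lemma sum_sq_le_of_norm_sq_le {𝒥 : Type*} [Fintype 𝒥] (s : 𝒥 → ℝ)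
    (hs : ∀ i j, i ≠ j → ∀ n : ℤ, s i - s j ≠ n) (b : 𝒥 → ℂ) {q : ℝ}
    (hq : ∀ k : ℕ, ‖∑ j, b j * ex ((k + 1 : ℕ) * s j)‖ ^ 2 ≤ q) : ∑ j, ‖b j‖ ^ 2 ≤ q := by
  classical
  have key : ∀ k : ℕ, ((‖∑ j, b j * ex ((k + 1 : ℕ) * s j)‖ ^ 2 : ℝ) : ℂ) =
      ∑ i, ∑ j, (starRingEnd ℂ) (b i) * b j * ex ((k + 1 : ℕ) * (s j - s i)) := by
    intro k
    have : ∀ z : ℂ, ((‖z‖ ^ 2 : ℝ) : ℂ) = (starRingEnd ℂ) z * z := by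
      intro z; rw [Complex.conj_mul']; norm_cast
    rw [this, map_sum, Finset.sum_mul_sum]
    refine Finset.sum_congr rfl fun i _ => Finset.sum_congr rfl fun j _ => ?_
    have : ((k + 1 : ℕ) : ℝ) * (s j - s i) = -((k + 1 : ℕ) * s i) + (k + 1 : ℕ) * s j := by ring
    rw [this, ex_add, ex_neg, map_mul]; ring
  have hlim : Tendsto (fun M : ℕ => (∑ k ∈ Finset.range M,
      ((‖∑ j, b j * ex ((k + 1 : ℕ) * s j)‖ ^ 2 : ℝ) : ℂ)) / (M : ℂ)) atTop
      (𝓝 (∑ i, ∑ j, if i = j then (starRingEnd ℂ) (b i) * b j else 0)) := by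
    have h1 : ∀ M : ℕ, (∑ k ∈ Finset.range M,
      ((‖∑ j, b j * ex ((k + 1 : ℕ) * s j)‖ ^ 2 : ℝ) : ℂ)) / (M : ℂ) =
      ∑ i, ∑ j, (starRingEnd ℂ) (b i) * b j *
        ((∑ k ∈ Finset.range M, ex ((k + 1 : ℕ) * (s j - s i))) / (M : ℂ)) := by
      intro M
      simp only [key]
      rw [Finset.sum_comm, Finset.sum_div]
      refine Finset.sum_congr rfl fun i _ => ?_
      rw [Finset.sum_comm, Finset.sum_div]
      refine Finset.sum_congr rfl fun j _ => ?_
      rw [← Finset.mul_sum, mul_div_assoc]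
    simp only [h1]
    refine tendsto_finsetSum _ fun i _ => tendsto_finsetSum _ fun j _ => ?_
    split_ifs with hij
    · subst hij
      have : Tendsto (fun M : ℕ => ((∑ k ∈ Finset.range M, ex ((k + 1 : ℕ) * (s i - s i))) / (M : ℂ)))
          atTop (𝓝 1) := by
        refine tendsto_const_nhds.congr' ?_
        filter_upwards [eventually_gt_atTop 0] with M hM
        have : (M : ℂ) ≠ 0 := by exact_mod_cast hM.ne'
        simp [this]
      simpa using this.const_mul ((starRingEnd ℂ) (b i) * b i)
    · simpa using (tendsto_average_ex (hs j i (Ne.symm hij))).const_mul ((starRingEnd ℂ) (b i) * b j)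
  have hlim2 : Tendsto (fun M : ℕ => (∑ k ∈ Finset.range M,
      (‖∑ j, b j * ex ((k + 1 : ℕ) * s j)‖ ^ 2 : ℝ)) / (M : ℝ)) atTop (𝓝 (∑ i, ‖b i‖ ^ 2)) := by
    have h2 : (∑ i, ∑ j, if i = j then (starRingEnd ℂ) (b i) * b j else 0) =
        ((∑ i, ‖b i‖ ^ 2 : ℝ) : ℂ) := by
      simp only [Finset.sum_ite_eq, Finset.mem_univ, if_true, Complex.conj_mul']
      push_cast; rfl
    rw [h2] at hlim
    have := (Complex.continuous_re.tendsto _).comp hlim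
    refine (this.congr fun M => ?_)
    simp only [Function.comp]
    rw [← Complex.ofReal_sum, ← Complex.ofReal_natCast, ← Complex.ofReal_div, Complex.ofReal_re]
  refine le_of_tendsto hlim2 ?_
  filter_upwards [eventually_gt_atTop 0] with M hM
  have hM' : (0 : ℝ) < M := by exact_mod_cast hM
  rw [div_le_iff₀ hM']
  calc _ ≤ ∑ k ∈ Finset.range M, q := Finset.sum_le_sum fun k _ => hq k
    _ = q * M := by simp [mul_comm]

lemma norm_half_one_add_ex_sq (y : ℝ) :
    ‖(1 + ex y) / 2‖ ^ 2 = (1 + Real.cos (2 * Real.pi * y)) / 2 := by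
  have h : ex y = ⟨Real.cos (2 * Real.pi * y), Real.sin (2 * Real.pi * y)⟩ := by
    have : (2 * Real.pi * Complex.I * (y : ℂ)) = ((2 * Real.pi * y : ℝ) : ℂ) * Complex.I := by
      push_cast; ring
    rw [ex, this]
    exact Complex.ext (Complex.exp_ofReal_mul_I_re _) (Complex.exp_ofReal_mul_I_im _)
  rw [norm_div, div_pow, ← Complex.normSq_eq_norm_sq, h, Complex.normSq_apply]
  simp only [Complex.add_re, Complex.add_im, Complex.one_re, Complex.one_im, zero_add,
    Complex.norm_ofNat]
  nlinarith [Real.sin_sq_add_cos_sq (2 * Real.pi * y)]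

lemma exists_pow_lt_inv_pow (r : ℕ) {q : ℝ} (hq0 : 0 ≤ q) (hq : q < 1) :
    ∃ p : ℕ, ((p + 1 : ℕ) : ℝ) ^ r * q ^ p < 1 := by
  have h := tendsto_pow_const_mul_const_pow_of_abs_lt_one r (r := q) (by rwa [abs_of_nonneg hq0])
  rcases hq0.eq_or_lt with h0 | h0
  · exact ⟨1, by rw [← h0]; simp⟩
  · have h2 := (h.comp (tendsto_add_atTop_nat 1)).eventually (gt_mem_nhds h0)
    obtain ⟨p, hp⟩ := h2.exists
    refine ⟨p, ?_⟩
    simp only [Function.comp] at hp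
    rw [pow_succ, ← mul_assoc] at hp
    exact lt_of_mul_lt_mul_right (by rw [one_mul]; exact hp) hq0

/-- Kronecker's theorem on simultaneous inhomogeneous approximation. -/
theorem kronecker_approximation {ι : Type*} [Fintype ι] (θ : ι → ℝ)
    (hθ : ∀ a : ι → ℤ, a ≠ 0 → ∀ n : ℤ, ∑ i, a i * θ i ≠ n) (β : ι → ℝ) {δ : ℝ} (hδ : 0 < δ) :
    ∃ N : ℕ, 0 < N ∧ ∃ n : ι → ℤ, ∀ i, |N * θ i - n i - β i| < δ := by
  classical
  -- If every multiple misses the target, some factor `(1 + ex (y k i)) / 2` always has squared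
  -- modulus at most `q < 1`. The product of the `p`-th powers of all factors is then uniformly
  -- small, while its mean square is at least the sum of its squared coefficients.
  by_contra! hcon
  set δ' := min δ (1 / 2) with hδ'
  have hδ'0 : 0 < δ' := by positivity
  have hδ'2 : δ' ≤ 1 / 2 := min_le_right _ _
  set q := (1 + Real.cos (2 * Real.pi * δ')) / 2 with hq
  have hq0 : 0 ≤ q := by have := Real.neg_one_le_cos (2 * Real.pi * δ'); linarith
  have hq1 : q < 1 := by
    have : Real.cos (2 * Real.pi * δ') < Real.cos 0 := by
      refine Real.cos_lt_cos_of_nonneg_of_le_pi le_rfl ?_ (by positivity)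
      nlinarith [Real.pi_pos]
    rw [Real.cos_zero] at this
    linarith
  -- The expanded product has `(p + 1) ^ r` coefficients, with `r` the number of coordinates, and
  -- their moduli sum to one. Their squares thus sum to at least `(p + 1) ^ (-r)`, which must exceed
  -- `q ^ p`.
  obtain ⟨p, hp⟩ := exists_pow_lt_inv_pow (Fintype.card ι) hq0 hq1
  let y : ℕ → ι → ℝ := fun k i => (k + 1 : ℕ) * θ i - β i
  have hfac : ∀ k i, ‖(1 + ex (y k i)) / 2‖ ^ 2 ≤ 1 := by
    intro k i
    rw [norm_half_one_add_ex_sq]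
    have := Real.cos_le_one (2 * Real.pi * y k i)
    linarith
  have hbad : ∀ k, ∃ i, ‖(1 + ex (y k i)) / 2‖ ^ 2 ≤ q := by
    intro k
    obtain ⟨i, hi⟩ := hcon (k + 1) k.succ_pos (fun i => round (y k i))
    refine ⟨i, ?_⟩
    rw [norm_half_one_add_ex_sq, hq]
    set x := y k i - round (y k i) with hx
    have h1 : δ' ≤ |x| := by
      have : (k + 1 : ℕ) * θ i - (round (y k i) : ℤ) - β i = x := by simp only [hx, y]; ring
      rw [this] at hi
      exact (min_le_left _ _).trans hi
    have h2 : |x| ≤ 1 / 2 := abs_sub_round _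
    have h3 : Real.cos (2 * Real.pi * y k i) = Real.cos (2 * Real.pi * |x|) := by
      have : 2 * Real.pi * y k i = 2 * Real.pi * x + round (y k i) * (2 * Real.pi) := by
        rw [hx]; ring
      rw [this, Real.cos_add_int_mul_two_pi, ← Real.cos_abs, abs_mul,
        abs_of_pos (by positivity : 0 < 2 * Real.pi)]
    have h4 : Real.cos (2 * Real.pi * |x|) ≤ Real.cos (2 * Real.pi * δ') := by
      refine Real.cos_le_cos_of_nonneg_of_le_pi (by positivity) ?_ ?_
      · nlinarith [Real.pi_pos]
      · have := Real.pi_pos; gcongr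
    rw [h3]; linarith
  let b : (ι → Fin (p + 1)) → ℂ := fun J => ∏ i, ((p.choose (J i) : ℂ) / 2 ^ p * ex (-((J i : ℕ) * β i)))
  let s : (ι → Fin (p + 1)) → ℝ := fun J => ∑ i, ((J i : ℕ) : ℝ) * θ i
  have hQ : ∀ k : ℕ, ∑ J, b J * ex ((k + 1 : ℕ) * s J) = ∏ i, ((1 + ex (y k i)) / 2) ^ p := by
    intro k
    have h1 : ∀ i, ((1 + ex (y k i)) / 2) ^ p = ∑ j : Fin (p + 1),
        ((p.choose j : ℂ) / 2 ^ p * ex ((j : ℕ) * y k i)) := by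
      intro i
      rw [div_pow, add_comm, add_pow, Finset.sum_range, Finset.sum_div]
      refine Finset.sum_congr rfl fun j _ => ?_
      rw [ex_natCast_mul, one_pow, mul_one]; ring
    simp only [h1]
    rw [Finset.prod_univ_sum, Fintype.piFinset_univ]
    refine Finset.sum_congr rfl fun J _ => ?_
    have hexs : ex ((k + 1 : ℕ) * s J) = ∏ i, ex ((k + 1 : ℕ) * (((J i : ℕ) : ℝ) * θ i)) := by
      simp only [s, Finset.mul_sum]
      simp only [ex]
      rw [← Complex.exp_sum]
      congr 1
      push_cast
      rw [Finset.mul_sum]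
    rw [hexs, ← Finset.prod_mul_distrib]
    refine Finset.prod_congr rfl fun i _ => ?_
    rw [mul_assoc, ← ex_add]
    congr 2
    simp only [y]; ring
  have hs : ∀ I J, I ≠ J → ∀ n : ℤ, s I - s J ≠ n := by
    intro I J hIJ n hn
    refine hθ (fun i => ((I i : ℕ) : ℤ) - (J i : ℕ)) ?_ n ?_
    · intro h0
      refine hIJ (funext fun i => Fin.ext ?_)
      have := congrFun h0 i
      simp only [Pi.zero_apply] at this
      omega
    · rw [← hn]
      simp only [s, ← Finset.sum_sub_distrib]
      refine Finset.sum_congr rfl fun i _ => ?_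
      push_cast; ring
  have hle := sum_sq_le_of_norm_sq_le s hs b (q := q ^ p) (fun k => by
    rw [hQ, norm_prod, ← Finset.prod_pow]
    obtain ⟨i, hi⟩ := hbad k
    rw [← Finset.mul_prod_erase _ _ (Finset.mem_univ i)]
    have h1 : ∀ j, (‖((1 + ex (y k j)) / 2) ^ p‖) ^ 2 = (‖(1 + ex (y k j)) / 2‖ ^ 2) ^ p := by
      intro j; rw [norm_pow, ← pow_mul, ← pow_mul, mul_comm]
    simp only [h1]
    have h2 : ∏ j ∈ Finset.univ.erase i, (‖(1 + ex (y k j)) / 2‖ ^ 2) ^ p ≤ 1 :=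
      Finset.prod_le_one (fun _ _ => by positivity)
        fun j _ => pow_le_one₀ (by positivity) (hfac k j)
    calc _ ≤ q ^ p * 1 := by gcongr
      _ = q ^ p := mul_one _)
  have hsum1 : ∑ J, ‖b J‖ = 1 := by
    have h1 : ∀ J, ‖b J‖ = ∏ i, ((p.choose (J i) : ℝ) / 2 ^ p) := by
      intro J
      simp only [b, norm_prod, norm_mul, norm_ex, mul_one, norm_div, norm_pow, Complex.norm_ofNat,
        Complex.norm_natCast]
    simp only [h1]
    have h2 := Finset.prod_univ_sum (fun _ : ι => (Finset.univ : Finset (Fin (p + 1))))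
      (fun _ j => (p.choose j : ℝ) / 2 ^ p)
    rw [Fintype.piFinset_univ] at h2
    rw [← h2]
    refine Finset.prod_eq_one fun i _ => ?_
    rw [← Finset.sum_div, ← Finset.sum_range fun j => (p.choose j : ℝ)]
    rw [← Nat.cast_sum, Nat.sum_range_choose]
    push_cast
    exact div_self (by positivity)
  have hcs := sq_sum_le_card_mul_sum_sq (s := Finset.univ) (f := fun J => ‖b J‖)
  rw [hsum1, one_pow] at hcs
  have hcard : ((Finset.univ : Finset (ι → Fin (p + 1))).card : ℝ) = ((p + 1 : ℕ) : ℝ) ^ Fintype.card ι := by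
    rw [Finset.card_univ, Fintype.card_fun, Fintype.card_fin]; push_cast; rfl
  rw [hcard] at hcs
  have : ((p + 1 : ℕ) : ℝ) ^ Fintype.card ι * ∑ J, ‖b J‖ ^ 2 ≤
      ((p + 1 : ℕ) : ℝ) ^ Fintype.card ι * q ^ p := by gcongr
  linarith

/-- Kronecker's theorem for a finite dimensional rational subspace `W` of `ℝ` that does not meet the
line through `ℓ`: some multiple of the elements of `W` is, modulo `ℓ`, close to a prescribed small
dilate of `W`. -/
lemma exists_multiple_near_dilate (W : Submodule ℚ ℝ) [FiniteDimensional ℚ W] {ℓ : ℝ} (hℓ : 0 < ℓ)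
    (hW : ∀ w ∈ W, ∀ q : ℚ, w = q * ℓ → w = 0) (G F : Finset ℝ) (hG : ∀ g ∈ G, g ∈ W)
    (hF : ∀ f ∈ F, f ∈ W) {Q : ℕ} (hQ : 0 < Q) (ε : ℝ) {κ : ℝ} (hκ : 0 < κ) :
    ∃ N : ℕ, 0 < N ∧ Q ∣ N ∧ ∃ n : ℝ →ₗ[ℚ] ℚ, (∀ g ∈ G, ∃ z : ℤ, n g = z) ∧
      ∀ f ∈ F, |N * f - n f * ℓ - ε * f| < κ := by
  classical
  let b := Module.finBasis ℚ W
  let r := Module.finrank ℚ W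
  let co : Fin r → ℝ → ℚ := fun j x => if h : x ∈ W then b.repr ⟨x, h⟩ j else 0
  have hco : ∀ x ∈ W, x = ∑ j, (co j x : ℝ) * (b j : ℝ) := by
    intro x hx
    have h1 := b.sum_repr ⟨x, hx⟩
    have h2 := congrArg (fun w : W => (w : ℝ)) h1
    simp only [AddSubmonoidClass.coe_finsetSum, Submodule.coe_smul, Rat.smul_def] at h2
    refine h2.symm.trans (Finset.sum_congr rfl fun j _ => ?_)
    simp [co, hx]
  -- This clears the denominators of the coordinates of `G`; setting `n (b j) = m * n' j` then makes
  -- `n` integral on `G`.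
  let m : ℕ := ∏ g ∈ G, ∏ j, (co j g).den
  have hm0 : 0 < m := Finset.prod_pos fun g _ => Finset.prod_pos fun j _ => (co j g).pos
  have hm : ∀ g ∈ G, ∀ j, ∃ z : ℤ, co j g * m = z := by
    intro g hg j
    have h1 : (co j g).den ∣ m :=
      (Finset.dvd_prod_of_mem _ (Finset.mem_univ j)).trans
        (Finset.dvd_prod_of_mem (fun g => ∏ j, (co j g).den) hg)
    obtain ⟨k, hk⟩ := h1
    refine ⟨(co j g).num * k, ?_⟩
    rw [hk]; push_cast
    rw [← mul_assoc, Rat.mul_den_eq_num]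
  have hmR : (0 : ℝ) < m := by exact_mod_cast hm0
  have hQR : (0 : ℝ) < Q := by exact_mod_cast hQ
  set Θ : ℝ := ∑ f ∈ F, ∑ j, |(co j f : ℝ)| with hΘ
  have hΘ0 : 0 ≤ Θ := Finset.sum_nonneg fun _ _ => Finset.sum_nonneg fun _ _ => abs_nonneg _
  have hδ : 0 < κ / (1 + m * ℓ * Θ) := by positivity
  -- An integer relation would place a combination of the basis of `W` on the rational line through
  -- `ℓ`, which meets `W` only in zero.
  have hind : ∀ a : Fin r → ℤ, a ≠ 0 → ∀ n : ℤ, ∑ j, a j * (Q * (b j : ℝ) / (m * ℓ)) ≠ n := by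
    intro a ha n hn
    refine ha ?_
    have h1 : ∑ j, ((a j : ℚ) * Q) • b j = 0 := by
      have hmem := (∑ j, ((a j : ℚ) * Q) • b j).2
      have hval : ((∑ j, ((a j : ℚ) * Q) • b j : W) : ℝ) = ∑ j, (a j : ℝ) * Q * (b j : ℝ) := by
        simp [Rat.smul_def]
      have : ((∑ j, ((a j : ℚ) * Q) • b j : W) : ℝ) = ((n * m : ℚ) : ℝ) * ℓ := by
        rw [hval]
        push_cast
        rw [← hn, Finset.sum_mul, Finset.sum_mul]
        refine Finset.sum_congr rfl fun j _ => ?_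
        field_simp
      exact Subtype.ext (hW _ hmem _ this)
    funext j
    have h2 := Fintype.linearIndependent_iff.1 b.linearIndependent _ h1 j
    have hQ' : (Q : ℚ) ≠ 0 := by exact_mod_cast hQ.ne'
    have h3 : (a j : ℚ) = 0 := by simpa [hQ'] using h2
    exact_mod_cast h3
  obtain ⟨N', hN', n', hn'⟩ := kronecker_approximation (fun j => Q * (b j : ℝ) / (m * ℓ))
    hind (fun j => ε * (b j : ℝ) / (m * ℓ)) hδ
  · let n₀ : W →ₗ[ℚ] ℚ := b.constr ℚ (fun j => (m : ℚ) * n' j)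
    obtain ⟨n, hn⟩ := LinearMap.exists_extend n₀
    have hnv : ∀ x ∈ W, n x = ∑ j, co j x * (m * n' j) := by
      intro x hx
      have : n x = n₀ ⟨x, hx⟩ := by rw [← hn]; rfl
      rw [this, Module.Basis.constr_apply_fintype]
      refine Finset.sum_congr rfl fun j _ => ?_
      simp [co, hx]
    -- The factor `Q` was already built into the numbers given to Kronecker's theorem, so
    -- divisibility by `Q` costs nothing.
    refine ⟨Q * N', by positivity, ⟨N', rfl⟩, n, fun g hg => ?_, fun f hf => ?_⟩
    · choose z hz using hm g hg
      refine ⟨∑ j, z j * n' j, ?_⟩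
      rw [hnv g (hG g hg)]
      push_cast
      refine Finset.sum_congr rfl fun j _ => ?_
      rw [← mul_assoc, hz]
    · have hfW := hF f hf
      have e1 : ((Q * N' : ℕ) : ℝ) * f - n f * ℓ - ε * f = ∑ j, (co j f : ℝ) * (m * ℓ *
          (N' * (Q * (b j : ℝ) / (m * ℓ)) - n' j - ε * (b j : ℝ) / (m * ℓ))) := by
        have p1 : ((Q * N' : ℕ) : ℝ) * f = ∑ j, (Q * N') * ((co j f : ℝ) * (b j : ℝ)) := by
          rw [← Finset.mul_sum, ← hco f hfW]; push_cast; rfl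
        have p2 : ε * f = ∑ j, ε * ((co j f : ℝ) * (b j : ℝ)) := by
          rw [← Finset.mul_sum, ← hco f hfW]
        rw [hnv f hfW, p1, p2]
        push_cast
        rw [Finset.sum_mul, ← Finset.sum_sub_distrib, ← Finset.sum_sub_distrib]
        refine Finset.sum_congr rfl fun j _ => ?_
        field_simp
      rw [e1]
      have h2 : |∑ j, (co j f : ℝ) * (m * ℓ *
          (N' * (Q * (b j : ℝ) / (m * ℓ)) - n' j - ε * (b j : ℝ) / (m * ℓ)))| ≤
          ∑ j, |(co j f : ℝ)| * (m * ℓ * (κ / (1 + m * ℓ * Θ))) := by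
        refine (Finset.abs_sum_le_sum_abs _ _).trans (Finset.sum_le_sum fun j _ => ?_)
        rw [abs_mul, abs_mul, abs_of_pos (by positivity : 0 < m * ℓ)]
        have := (hn' j).le
        gcongr
      refine h2.trans_lt ?_
      rw [← Finset.sum_mul]
      have h3 : ∑ j, |(co j f : ℝ)| ≤ Θ :=
        Finset.single_le_sum (f := fun f => ∑ j, |(co j f : ℝ)|)
          (fun _ _ => Finset.sum_nonneg fun _ _ => abs_nonneg _) hf
      calc _ ≤ Θ * (m * ℓ * (κ / (1 + m * ℓ * Θ))) := by gcongr
        _ = (m * ℓ * Θ) / (1 + m * ℓ * Θ) * κ := by ring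
        _ < 1 * κ := by
          gcongr
          rw [div_lt_one (by positivity)]
          linarith
        _ = κ := one_mul κ

end Kronecker

/-! ### Induction on the dimension of the rational span of the jumps. -/

section Main
variable {P Ω K : Type*} [Fintype P] [NormedAddCommGroup K] [InnerProductSpace ℂ K]
  {F : P → (Ω →₀ ℂ) →ₗ[ℂ] K} {Ξ : Set P → Set Ω} {C₀ : ℝ}

/-- With jumps only at multiples of the period, `σ` is constant on `[0, ℓ)`, hence everywhere by
periodicity. -/
lemma IsStep.eq_const {ℓ : ℝ} (hℓ : 0 < ℓ) {σ : ℝ → Set P} (h : IsStep ℓ {0} σ) :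
    σ = fun _ => σ 0 := by
  funext t
  have h1 := toIcoMod_mem_Ico hℓ 0 t
  rw [zero_add] at h1
  have h2 : σ t = σ (toIcoMod hℓ 0 t) := by
    rw [toIcoMod, zsmul_eq_mul, h.1.sub_int_mul_eq]
  rw [h2]
  rcases h1.1.eq_or_lt with h0 | h0
  · rw [← h0]
  · refine (h.2 _ _ h0 fun d hd n hn => ?_).symm
    rw [Finset.mem_singleton] at hd
    subst hd
    rw [zero_add] at hn
    have h3 : (n : ℝ) * ℓ < 1 * ℓ := by linarith [hn.2, h1.2]
    have h4 := lt_of_mul_lt_mul_right h3 hℓ.le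
    have h5 : (0 : ℝ) < n := pos_of_mul_pos_left hn.1 hℓ.le
    have h6 : n < 1 := by exact_mod_cast h4
    have h7 : 0 < n := by exact_mod_cast h5
    omega

lemma IsRS.const {ℓ : ℝ} (hℓ : 0 < ℓ) {B : Set P} {U : Set Ω} (h : IsBaseRS F B U C₀) :
    IsRS F ℓ (fun _ => B) {x | x.1 ∈ U} C₀ := by
  classical
  intro S c hc
  have h1 : ∀ p, ∫ t in (0 : ℝ)..ℓ, ‖{_t : ℝ | p ∈ B}.indicator (wave F ℓ S c p) t‖ ^ 2 =
      if p ∈ B then ℓ * ∑ l ∈ S, ‖F p (c l)‖ ^ 2 else 0 := by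
    intro p
    have h2 := integral_norm_sq_trigSum hℓ 0 S (fun l => F p (c l))
    rw [zero_add] at h2
    by_cases hp : p ∈ B
    · rw [if_pos hp, ← h2]
      simp [hp, wave]
    · simp [hp]
  simp only [h1]
  rw [← Finset.sum_filter, ← Finset.mul_sum, Finset.sum_comm, mul_left_comm]
  rw [Finset.mul_sum (s := S) (a := C₀)]
  refine mul_le_mul_of_nonneg_left (Finset.sum_le_sum fun l hl => ?_) hℓ.le
  refine (h (c l) fun ξ hξ => hc l hl ξ hξ).trans (le_of_eq ?_)
  congr!

lemma Good.const {ℓ : ℝ} (hℓ : 0 < ℓ) (hmono : Monotone Ξ)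
    (hΞ : ∀ B, IsBaseRS F B (Ξ B) C₀) (hΞ' : ∀ B, IsBaseRS F Bᶜ (Ξ B)ᶜ C₀) :
    Good F Ξ ℓ {0} C₀ := by
  refine ⟨fun σ => {x | x.1 ∈ Ξ (σ 0)}, fun σ τ _ _ hst x hx => hmono (hst 0) hx,
    fun σ hσ => ?_, fun σ hσ => ?_, fun B => rfl⟩
  · have h := IsRS.const hℓ (hΞ (σ 0))
    rwa [← hσ.eq_const hℓ] at h
  · have h := IsRS.const hℓ (hΞ' (σ 0))
    have h2 := (hσ.map (fun A => Aᶜ)).eq_const hℓ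
    rw [h2]
    exact h

/-- Perturbations smaller than a fraction of `γ` preserve the order of `D`, so the same two elements
remain its extreme points. -/
lemma exists_uniform_gap (D : Finset ℝ) : ∃ γ : ℝ, 0 < γ ∧ ∀ d ∈ D, ∀ e ∈ D, d < e → d + γ ≤ e := by
  have h : ∀ d ∈ D, ∀ e ∈ D, ∀ᶠ γ : ℝ in nhdsWithin 0 (Set.Ioi 0), d < e → d + γ ≤ e := by
    intro d _ e _
    by_cases hde : d < e
    · filter_upwards [Ioo_mem_nhdsGT (sub_pos.2 hde)] with γ hγ _
      linarith [hγ.2]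
    · exact Filter.Eventually.of_forall fun _ h => absurd h hde
  have h2 : ∀ᶠ γ : ℝ in nhdsWithin 0 (Set.Ioi 0), ∀ d ∈ D, ∀ e ∈ D, d < e → d + γ ≤ e := by
    rw [Filter.eventually_all_finset]
    intro d hd
    rw [Filter.eventually_all_finset]
    exact fun e he => h d hd e he
  obtain ⟨γ, hγ, hγ0⟩ := (h2.and self_mem_nhdsWithin).exists
  exact ⟨γ, hγ0, hγ⟩

lemma exists_rat_functional {ℓ : ℝ} (hℓ : ℓ ≠ 0) : ∃ φ : ℝ →ₗ[ℚ] ℚ, φ ℓ = 1 := by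
  obtain ⟨φ, hφ⟩ := LinearMap.exists_leftInverse_of_injective (LinearMap.toSpanSingleton ℚ ℝ ℓ)
    (LinearMap.ker_eq_bot.2 fun a b hab => by
      simpa [LinearMap.toSpanSingleton_apply, Rat.smul_def, hℓ] using hab)
  refine ⟨φ, ?_⟩
  have := congrArg (fun f => f (1 : ℚ)) hφ
  simpa using this

lemma exists_common_denominator (D : Finset ℝ) (φ : ℝ → ℚ) :
    ∃ Q : ℕ, 0 < Q ∧ ∀ d ∈ D, ∀ N : ℕ, Q ∣ N → ∃ z : ℤ, (N : ℚ) * φ d = z := by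
  refine ⟨∏ d ∈ D, (φ d).den, Finset.prod_pos fun d _ => (φ d).pos, fun d hd N hN => ?_⟩
  obtain ⟨k, rfl⟩ := (Finset.dvd_prod_of_mem (fun d => (φ d).den) hd).trans hN
  refine ⟨(φ d).num * k, ?_⟩
  push_cast
  rw [mul_right_comm, mul_comm ((φ d).den : ℚ), Rat.mul_den_eq_num]

/-- Bounds that hold for every small rational perturbation of the data. -/
def GoodNear (F : P → (Ω →₀ ℂ) →ₗ[ℂ] K) (Ξ : Set P → Set Ω) (E : Submodule ℚ ℝ) (D : Finset ℝ)
    (ℓ : ℝ) : Prop :=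
  ∃ (T : Finset ℝ) (τ C : ℝ), (∀ e ∈ T, e ∈ E) ∧ 0 < τ ∧ 0 ≤ C ∧ ∀ h : ℝ →ₗ[ℚ] ℝ,
    (∀ e ∈ T, |h e - e| < τ) → ∀ s : ℝ, 0 < s → Good F Ξ (s * h ℓ) (D.image fun d => s * h d) C

lemma shortCircleConst_nonneg {C C₀ s : ℝ} (hC : 0 ≤ C) (hC₀ : 0 ≤ C₀) (hs : 0 ≤ s) :
    0 ≤ shortCircleConst C C₀ s := by
  unfold shortCircleConst
  positivity

/-- A `ℚ`-linear perturbation preserves the relations `d = φ d • ℓ`, so one common denominator folds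
all jumps to the origin for every perturbation. The tolerance `ℓ` only keeps the perturbed period
positive. -/
lemma GoodNear.of_rational (hC₀ : 0 ≤ C₀) (hmono : Monotone Ξ)
    (hΞ : ∀ B, IsBaseRS F B (Ξ B) C₀) (hΞ' : ∀ B, IsBaseRS F Bᶜ (Ξ B)ᶜ C₀) {E : Submodule ℚ ℝ}
    {D : Finset ℝ} {ℓ : ℝ} (hℓ : 0 < ℓ) (hℓE : ℓ ∈ E) {φ : ℝ → ℚ}
    (hD : ∀ d ∈ D, d = φ d • ℓ) : GoodNear F Ξ E D ℓ := by
  obtain ⟨Q, hQ, hφ⟩ := exists_common_denominator D φ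
  obtain ⟨C, hC, hfold⟩ := Good.fold hQ hC₀ F Ξ
  refine ⟨{ℓ}, ℓ, C, by simpa using hℓE, hℓ, hC, fun h hh s hs => ?_⟩
  have h1 := hh ℓ (Finset.mem_singleton_self ℓ)
  have hpos : 0 < s * h ℓ := mul_pos hs (by linarith [(abs_lt.1 h1).1])
  have hQ' : (0 : ℝ) < Q := by exact_mod_cast hQ
  refine hfold _ _ {0} hpos ?_ (Good.const (by positivity) hmono hΞ hΞ')
  intro x hx
  obtain ⟨d, hd, rfl⟩ := Finset.mem_image.1 hx
  obtain ⟨z, hz⟩ := hφ d hd Q dvd_rfl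
  refine ⟨0, Finset.mem_singleton_self _, z, ?_⟩
  have hz' : (Q : ℝ) * φ d = z := by exact_mod_cast hz
  rw [← hz', hD d hd, map_smul, Rat.smul_def, ← hD d hd]
  field_simp
  ring

set_option maxHeartbeats 800000 in
-- Modulo the rational multiples of `ℓ` removed by `φ`, the jumps are elements of `D'` in `W`.
-- Choose `N` with `N * w` close to `ε * w` modulo `ℓ` for `w` in `D'`. After folding by `N`, the
-- jumps form a nearly exact copy of `D'` scaled by `ε / N`, inside an interval much shorter than
-- the period `ℓ / N`. The short circle then reduces to the hypothesis on `W`. The order of choices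
-- matters: `C₁` comes from `W`, then `ε`, then `N`, and last the tolerance `τ`.
lemma goodNear_of_projection (hC₀ : 0 ≤ C₀)
    (hΞ : ∀ B, IsBaseRS F B (Ξ B) C₀) (hΞ' : ∀ B, IsBaseRS F Bᶜ (Ξ B)ᶜ C₀)
    {E W : Submodule ℚ ℝ} [FiniteDimensional ℚ W] {D : Finset ℝ} {ℓ : ℝ} (hℓ : 0 < ℓ)
    (hℓE : ℓ ∈ E) (hWE : W ≤ E) (φ : ℝ →ₗ[ℚ] ℚ)
    (hW : ∀ w ∈ W, ∀ q : ℚ, w = q * ℓ → w = 0) {D' : Finset ℝ} (hDD' : ∀ d ∈ D, d - φ d • ℓ ∈ D')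
    (hD'W : ∀ d ∈ D', d ∈ W) {m M : ℝ} (hm : m ∈ D') (hM : M ∈ D') (hmM : m < M)
    (hle : ∀ d ∈ D', m ≤ d) (hge : ∀ d ∈ D', d ≤ M) (h : GoodNear F Ξ W D' (M - m)) :
    GoodNear F Ξ E D ℓ := by
  obtain ⟨T, τ₁, C₁, hTW, hτ₁, hC₁, hT⟩ := h
  obtain ⟨γ, hγ, hgap⟩ := exists_uniform_gap D'
  obtain ⟨Q, hQ, hφ⟩ := exists_common_denominator D φ
  set τ' := min (min τ₁ 1) (γ / 4) with hτ'
  have hτ'0 : 0 < τ' := by positivity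
  set B₀ : ℝ := 1 + |m| + |M| with hB₀
  have hB₀1 : 1 ≤ B₀ := by have := abs_nonneg m; have := abs_nonneg M; linarith
  set A : ℝ := 8 * (1 + C₁) * (64 * Real.pi ^ 2 * 4) with hA
  have hA0 : 0 ≤ A := by positivity
  -- Small enough that three short lengths, each at most `2 * ε * B₀` up to scaling, fit into the
  -- perturbed period, which is at least `ℓ / 2`, and that the Paley–Wiener error stays within its
  -- allowance for `C₁`.
  set ε : ℝ := ℓ / (12 * B₀ * (A + 1)) with hε
  have hε0 : 0 < ε := by positivity
  set s₀ : ℝ := 2 * ℓ / (ε * ((M - m) / 2)) with hs₀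
  have hs₀0 : 0 ≤ s₀ := by have : 0 < M - m := by linarith
                           positivity
  classical
  obtain ⟨N, hN, hQN, n, hnG, hnF⟩ := exists_multiple_near_dilate W hℓ hW D' (T ∪ D') hD'W
    (by intro f hf; rcases Finset.mem_union.1 hf with h | h
        · exact hTW f h
        · exact hD'W f h) hQ ε (by positivity : 0 < ε * τ' / 2)
  have hN' : (0 : ℝ) < N := by exact_mod_cast hN
  obtain ⟨C, hC, hfold⟩ := Good.fold hN (shortCircleConst_nonneg hC₁ hC₀ hs₀0) F Ξ
  set S : ℝ := ∑ f ∈ T ∪ D', |(n f : ℝ)| with hS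
  have hS0 : 0 ≤ S := Finset.sum_nonneg fun _ _ => abs_nonneg _
  -- Half of the allowance `ε * τ'` was spent on Kronecker's theorem. A perturbation by `τ` changes
  -- `N * e - n e * ℓ` by at most `(N + S) * τ`, which fits into the other half.
  set τ : ℝ := min (ℓ / 2) (ε * τ' / (2 * (1 + N + S))) with hτ
  have hτ0 : 0 < τ := by positivity
  refine ⟨insert ℓ (T ∪ D'), τ, C, ?_, hτ0, hC, fun h hh s hs => ?_⟩
  · intro e he
    rcases Finset.mem_insert.1 he with rfl | he
    · exact hℓE
    rcases Finset.mem_union.1 he with h | h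
    · exact hWE (hTW e h)
    · exact hWE (hD'W e h)
  have hhℓ := abs_lt.1 (hh ℓ (Finset.mem_insert_self _ _))
  have hτℓ : τ ≤ ℓ / 2 := min_le_left _ _
  have hlow : ℓ / 2 ≤ h ℓ := by linarith
  have hup : h ℓ ≤ 2 * ℓ := by linarith
  have hhℓ0 : 0 < h ℓ := by linarith
  let nl : ℝ →ₗ[ℚ] ℝ := (LinearMap.toSpanSingleton ℚ ℝ (h ℓ)).comp n
  -- The displacement modulo the perturbed period, rescaled by `ε⁻¹`, is again `ℚ`-linear and near
  -- the identity on `T ∪ D'`. This is why perturbations in `GoodNear` are linear maps.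
  let h' : ℝ →ₗ[ℚ] ℝ := (LinearMap.mulLeft ℚ ε⁻¹).comp ((N : ℚ) • h - nl)
  have hh' : ∀ x, h' x = ε⁻¹ * (N * h x - n x * h ℓ) := by
    intro x
    simp [h', nl, Rat.smul_def, LinearMap.toSpanSingleton_apply]
  have hnear : ∀ e ∈ T ∪ D', |h' e - e| < τ' := by
    intro e he
    have e1 := hnF e he
    have e2 := hh e (Finset.mem_insert_of_mem he)
    have e3 := hh ℓ (Finset.mem_insert_self _ _)
    have e4 : |(n e : ℝ)| ≤ S := Finset.single_le_sum (f := fun f => |(n f : ℝ)|)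
      (fun _ _ => abs_nonneg _) he
    have e5 : h' e - e = ε⁻¹ * ((N * e - n e * ℓ - ε * e) + (N * (h e - e) - n e * (h ℓ - ℓ))) := by
      rw [hh']; field_simp; ring
    rw [e5, abs_mul, abs_of_pos (by positivity : 0 < ε⁻¹), inv_mul_lt_iff₀ hε0]
    have e6 : |N * (h e - e) - n e * (h ℓ - ℓ)| ≤ ε * τ' / 2 := by
      calc _ ≤ |N * (h e - e)| + |n e * (h ℓ - ℓ)| := abs_sub _ _
        _ ≤ N * τ + S * τ := by
          rw [abs_mul, abs_mul, Nat.abs_cast]; gcongr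
        _ ≤ (1 + N + S) * τ := by nlinarith
        _ ≤ (1 + N + S) * (ε * τ' / (2 * (1 + N + S))) := by gcongr; exact min_le_right _ _
        _ = ε * τ' / 2 := by field_simp
    calc _ ≤ _ := abs_add_le _ _
      _ < ε * τ' / 2 + ε * τ' / 2 := add_lt_add_of_lt_of_le e1 e6
      _ = ε * τ' := by ring
  have hnearD : ∀ d ∈ D', |h' d - d| < τ' := fun d hd => hnear d (Finset.mem_union_right _ hd)
  have hτ1 : τ' ≤ 1 := (min_le_left _ _).trans (min_le_right _ _)
  have hτ2 : τ' ≤ τ₁ := (min_le_left _ _).trans (min_le_left _ _)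
  have hτ3 : τ' ≤ γ / 4 := min_le_right _ _
  have hord : ∀ d ∈ D', ∀ e ∈ D', d ≤ e → h' d ≤ h' e := by
    intro d hd e he hde
    rcases hde.eq_or_lt with rfl | hlt
    · exact le_rfl
    · have := hgap d hd e he hlt
      have h1 := abs_lt.1 (hnearD d hd)
      have h2 := abs_lt.1 (hnearD e he)
      linarith
  have hbd : ∀ d ∈ D', |d| ≤ |m| + |M| → |h' d| ≤ B₀ := by
    intro d hd hdb
    have h1 := (hnearD d hd).le
    have : |h' d| ≤ |h' d - d| + |d| := by simpa using abs_add_le (h' d - d) d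
    linarith
  have hbm := hbd m hm (by linarith [abs_nonneg M])
  have hbM := hbd M hM (by linarith [abs_nonneg m])
  have hγM := hgap m hm M hM hmM
  have hlen : h' (M - m) = h' M - h' m := map_sub _ _ _
  have hlen1 : (M - m) / 2 ≤ h' (M - m) := by
    have h1 := abs_lt.1 (hnearD m hm)
    have h2 := abs_lt.1 (hnearD M hM)
    rw [hlen]; linarith
  have hlen2 : h' (M - m) ≤ 2 * B₀ := by
    rw [hlen]; linarith [(abs_le.1 hbm).1, (abs_le.1 hbM).2]
  have hlen0 : 0 < h' (M - m) := by linarith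
  have hs' : 0 < s * ε / N := by positivity
  have hgood := hT h' (fun e he => (hnear e (Finset.mem_union_left _ he)).trans_le hτ2) _ hs'
  have hsum : s * ε / N * h' m + s * ε / N * h' (M - m) = s * ε / N * h' M := by rw [hlen]; ring
  have hεB : 12 * ε * B₀ * (A + 1) = ℓ := by rw [hε]; field_simp
  have hLgood : Good F Ξ (s * h ℓ / N) (D'.image fun d => s * ε / N * h' d)
      (shortCircleConst C₁ C₀ s₀) := by
    refine Good.of_short_circle (a := s * ε / N * h' m) (R := s * ε / N * B₀) (mul_pos hs' hlen0) ?_ ?_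
      ?_ ?_ (Finset.mem_image_of_mem (fun d => s * ε / N * h' d) hm) ?_ hC₁ hC₀ ?_ hΞ hΞ' hgood
    · have : 3 * ε * h' (M - m) ≤ h ℓ := by
        calc 3 * ε * h' (M - m) ≤ 3 * ε * (2 * B₀) := by gcongr
          _ = 6 * ε * B₀ * 1 := by ring
          _ ≤ 6 * ε * B₀ * (A + 1) := by gcongr; linarith
          _ = ℓ / 2 := by linarith
          _ ≤ h ℓ := hlow
      calc 3 * (s * ε / N * h' (M - m)) = s / N * (3 * ε * h' (M - m)) := by ring
        _ ≤ s / N * h ℓ := by gcongr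
        _ = s * h ℓ / N := by ring
    · have : s * h ℓ / N / (s * ε / N * h' (M - m)) = h ℓ / (ε * h' (M - m)) := by field_simp
      rw [this, hs₀]
      have : 0 < M - m := by linarith
      gcongr
    · rw [abs_mul, abs_of_pos hs']; gcongr
    · rw [hsum, abs_mul, abs_of_pos hs']; gcongr
    · intro x hx
      obtain ⟨d, hd, rfl⟩ := Finset.mem_image.1 hx
      rw [hsum]
      exact ⟨mul_le_mul_of_nonneg_left (hord _ hm _ hd (hle d hd)) hs'.le,
        mul_le_mul_of_nonneg_left (hord _ hd _ hM (hge d hd)) hs'.le⟩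
    · have e1 : 8 * (1 + C₁) * (64 * Real.pi ^ 2 * (2 / (s * h ℓ / N)) ^ 2 *
          (s * ε / N * B₀) ^ 2) = A * (ε * B₀ / h ℓ) ^ 2 := by
        rw [hA]; field_simp; ring
      rw [e1]
      have e2 : ε * B₀ / h ℓ ≤ 1 / (A + 1) := by
        rw [div_le_div_iff₀ hhℓ0 (by positivity)]
        have : ε * B₀ * (A + 1) = ℓ / 12 := by rw [← hεB]; ring
        rw [this]; linarith
      calc A * (ε * B₀ / h ℓ) ^ 2 ≤ (A + 1) * (1 / (A + 1)) ^ 2 := by gcongr; linarith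
        _ = 1 / (A + 1) := by field_simp
        _ ≤ 1 := by rw [div_le_one (by positivity)]; linarith
  refine hfold _ _ _ (by positivity) ?_ hLgood
  intro x hx
  obtain ⟨d, hd, rfl⟩ := Finset.mem_image.1 hx
  obtain ⟨z, hz⟩ := hφ d hd N hQN
  obtain ⟨y, hy⟩ := hnG _ (hDD' d hd)
  -- The integer number of folded periods has two parts: `y` is the value of `n` on the
  -- `W`-component and `z` is `N * φ d`, integral because `Q` divides `N`.
  refine ⟨_, Finset.mem_image_of_mem _ (hDD' d hd), y + z, ?_⟩
  have hz' : (N : ℝ) * φ d = z := by exact_mod_cast hz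
  push_cast
  rw [hh', hy, map_sub, map_smul, Rat.smul_def, ← hz']
  push_cast
  field_simp
  ring

/-- Slices that jump only at finitely many places admit coherent frequency sets. -/
theorem goodNear (hC₀ : 0 ≤ C₀) (hmono : Monotone Ξ) (hΞ : ∀ B, IsBaseRS F B (Ξ B) C₀)
    (hΞ' : ∀ B, IsBaseRS F Bᶜ (Ξ B)ᶜ C₀) (E : Submodule ℚ ℝ) [FiniteDimensional ℚ E]
    {D : Finset ℝ} (hD : ∀ d ∈ D, d ∈ E) {ℓ : ℝ} (hℓ : 0 < ℓ) (hℓE : ℓ ∈ E) :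
    GoodNear F Ξ E D ℓ := by
  classical
  induction hr : Module.finrank ℚ E using Nat.strong_induction_on generalizing E D ℓ with
  | _ r ih =>
    obtain ⟨φ, hφ⟩ := exists_rat_functional hℓ.ne'
    by_cases hrat : ∀ d ∈ D, d = φ d • ℓ
    · exact GoodNear.of_rational hC₀ hmono hΞ hΞ' hℓ hℓE hrat
    set W : Submodule ℚ ℝ := E ⊓ LinearMap.ker φ with hWdef
    have hWE : W ≤ E := inf_le_left
    have hWlt : W < E := lt_of_le_of_ne hWE fun h => by
      have : ℓ ∈ W := by rw [h]; exact hℓE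
      have h2 : φ ℓ = 0 := this.2
      rw [hφ] at h2
      exact one_ne_zero h2
    have : FiniteDimensional ℚ W := Submodule.finiteDimensional_of_le hWE
    have hWr : Module.finrank ℚ W < r := hr ▸ Submodule.finrank_lt_finrank_of_lt hWlt
    -- Adding `0` ensures, since some jump is not a rational multiple of `ℓ`, that `D'` has two
    -- distinct elements and a positive length.
    set D' : Finset ℝ := insert 0 (D.image fun d => d - φ d • ℓ) with hD'
    have hD'W : ∀ d ∈ D', d ∈ W := by
      intro x hx
      rcases Finset.mem_insert.1 hx with rfl | hx
      · exact W.zero_mem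
      · obtain ⟨d, hd, rfl⟩ := Finset.mem_image.1 hx
        refine ⟨E.sub_mem (hD d hd) (E.smul_mem _ hℓE), ?_⟩
        change φ _ = 0
        rw [map_sub, map_smul, hφ, smul_eq_mul, mul_one, sub_self]
    have hne : D'.Nonempty := ⟨0, Finset.mem_insert_self _ _⟩
    have hm := D'.min'_mem hne
    have hM := D'.max'_mem hne
    have hlt : D'.min' hne < D'.max' hne := by
      push Not at hrat
      obtain ⟨d, hd, hdne⟩ := hrat
      exact Finset.min'_lt_max' D' (Finset.mem_insert_of_mem (Finset.mem_image_of_mem _ hd))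
        (Finset.mem_insert_self _ _) (sub_ne_zero.2 hdne)
    refine goodNear_of_projection hC₀ hΞ hΞ' hℓ hℓE hWE φ ?_
      (fun d hd => Finset.mem_insert_of_mem (Finset.mem_image_of_mem _ hd)) hD'W hm hM hlt
      (fun d hd => D'.min'_le d hd) (fun d hd => D'.le_max' d hd)
      (ih _ hWr W hD'W (sub_pos.2 hlt) (W.sub_mem (hD'W _ hM) (hD'W _ hm)) rfl)
    intro w hw q hq
    have h1 : φ w = 0 := hw.2
    have h2 : w = q • ℓ := by rw [hq, Rat.smul_def]
    rw [h2, map_smul, hφ, smul_eq_mul, mul_one] at h1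
    rw [hq, h1]; simp

/-- Every finite set of jump points is admissible. -/
theorem exists_good (hC₀ : 0 ≤ C₀) (hmono : Monotone Ξ) (hΞ : ∀ B, IsBaseRS F B (Ξ B) C₀)
    (hΞ' : ∀ B, IsBaseRS F Bᶜ (Ξ B)ᶜ C₀) (D : Finset ℝ) {ℓ : ℝ} (hℓ : 0 < ℓ) :
    ∃ C, 0 ≤ C ∧ Good F Ξ ℓ D C := by
  classical
  obtain ⟨T, τ, C, -, hτ, hC, h⟩ := goodNear hC₀ hmono hΞ hΞ'
    (Submodule.span ℚ ((insert ℓ D : Finset ℝ) : Set ℝ)) (D := D)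
    (fun d hd => Submodule.subset_span (by simp [hd])) hℓ (Submodule.subset_span (by simp))
  refine ⟨C, hC, ?_⟩
  simpa using h LinearMap.id (fun e _ => by simpa using hτ) 1 one_pos

end Main

/-! ### Grid atoms, slicing in the first coordinate, and induction on dimension. -/

section Grid

lemma norm_toLp_sq {α : Type*} [MeasurableSpace α] {μ : Measure α} {f : α → ℂ} (hf : MemLp f 2 μ) :
    ‖hf.toLp f‖ ^ 2 = ∫ x, ‖f x‖ ^ 2 ∂μ := by
  rw [Lp.norm_toLp, hf.eLpNorm_eq_integral_rpow_norm (by norm_num) (by norm_num)]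
  simp only [ENNReal.toReal_ofNat, Real.rpow_ofNat]
  have h0 : 0 ≤ ∫ x, ‖f x‖ ^ 2 ∂μ := integral_nonneg fun _ => by positivity
  rw [ENNReal.toReal_ofReal (Real.rpow_nonneg h0 _), ← Real.rpow_natCast, ← Real.rpow_mul h0]
  norm_num

lemma norm_expFun {d : ℕ} (ξ : Fin d → ℤ) (x : Fin d → ℝ) : ‖expFun ξ x‖ = 1 := norm_ex _

@[fun_prop] lemma continuous_expFun {d : ℕ} (ξ : Fin d → ℤ) : Continuous (expFun ξ) := by
  unfold expFun; fun_prop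

lemma expFun_cons {d : ℕ} (ξ : Fin (d + 1) → ℤ) (t : ℝ) (y : Fin d → ℝ) :
    expFun ξ (Fin.cons t y) = ex (ξ 0 * t) * expFun (Fin.tail ξ) y := by
  have : ∀ {n} (ξ : Fin n → ℤ) x, expFun ξ x = ex (∑ k, (ξ k : ℝ) * x k) := fun _ _ => rfl
  rw [this, this, ← ex_add, Fin.sum_univ_succ]
  simp [Fin.tail]

/-- The trigonometric polynomial with the given coefficients. -/
def trigPoly (d : ℕ) : ((Fin d → ℤ) →₀ ℂ) →ₗ[ℂ] ((Fin d → ℝ) → ℂ) :=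
  Finsupp.linearCombination ℂ expFun

lemma trigPoly_apply {d : ℕ} (v : (Fin d → ℤ) →₀ ℂ) (x : Fin d → ℝ) :
    trigPoly d v x = ∑ ξ ∈ v.support, v ξ * expFun ξ x := by
  rw [trigPoly, Finsupp.linearCombination_apply, Finsupp.sum, Finset.sum_apply]
  rfl

@[fun_prop] lemma continuous_trigPoly {d : ℕ} (v : (Fin d → ℤ) →₀ ℂ) : Continuous (trigPoly d v) := by
  have : trigPoly d v = fun x => ∑ ξ ∈ v.support, v ξ * expFun ξ x := funext (trigPoly_apply v)
  rw [this]; fun_prop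

lemma norm_trigPoly_le {d : ℕ} (v : (Fin d → ℤ) →₀ ℂ) (x : Fin d → ℝ) :
    ‖trigPoly d v x‖ ≤ ∑ ξ ∈ v.support, ‖v ξ‖ := by
  rw [trigPoly_apply]
  refine (norm_sum_le _ _).trans (le_of_eq (Finset.sum_congr rfl fun ξ _ => ?_))
  rw [norm_mul, norm_expFun, mul_one]

/-- The coefficients of a trigonometric polynomial with the first frequency fixed. -/
def freqSlice {d : ℕ} (v : (Fin (d + 1) → ℤ) →₀ ℂ) (l : ℤ) : (Fin d → ℤ) →₀ ℂ :=
  v.comapDomain (fun ξ => Fin.cons l ξ) (Fin.cons_right_injective (α := fun _ => ℤ) l).injOn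

lemma freqSlice_apply {d : ℕ} (v : (Fin (d + 1) → ℤ) →₀ ℂ) (l : ℤ) (ξ : Fin d → ℤ) :
    freqSlice v l ξ = v (Fin.cons l ξ) := rfl

/-- The first coordinates of the frequencies of a trigonometric polynomial. -/
def firstFreqs {d : ℕ} (v : (Fin (d + 1) → ℤ) →₀ ℂ) : Finset ℤ := v.support.image fun ξ => ξ 0

lemma trigPoly_cons {d : ℕ} (v : (Fin (d + 1) → ℤ) →₀ ℂ) (t : ℝ) (y : Fin d → ℝ) :
    trigPoly (d + 1) v (Fin.cons t y) =
      trigPoly d (∑ l ∈ firstFreqs v, ex (l * t / 1) • freqSlice v l) y := by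
  rw [map_sum, Finset.sum_apply, trigPoly_apply,
    ← Finset.sum_fiberwise_of_maps_to (g := fun ξ : Fin (d + 1) → ℤ => ξ 0) (t := firstFreqs v)
      (fun ξ hξ => Finset.mem_image_of_mem _ hξ)]
  refine Finset.sum_congr rfl fun l _ => ?_
  rw [map_smul, Pi.smul_apply, trigPoly_apply, smul_eq_mul, Finset.mul_sum]
  refine Finset.sum_nbij' (fun ξ => Fin.tail ξ) (fun ξ => Fin.cons l ξ) ?_ ?_ ?_ ?_ ?_
  · intro ξ hξ
    obtain ⟨h1, h2⟩ := Finset.mem_filter.1 hξ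
    rw [Finsupp.mem_support_iff, freqSlice_apply, ← h2, Fin.cons_self_tail]
    exact Finsupp.mem_support_iff.1 h1
  · intro ξ hξ
    rw [Finsupp.mem_support_iff, freqSlice_apply] at hξ
    exact Finset.mem_filter.2 ⟨Finsupp.mem_support_iff.2 hξ, rfl⟩
  · intro ξ hξ
    rw [← (Finset.mem_filter.1 hξ).2]; exact Fin.cons_self_tail ξ
  · intro ξ _; exact Fin.tail_cons _ _
  · intro ξ hξ
    have h2 := (Finset.mem_filter.1 hξ).2
    rw [expFun_cons, freqSlice_apply, ← h2, Fin.cons_self_tail, div_one]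
    ring

/-- The position of a real number with respect to the grid `T`. -/
def gridPos (T : Finset ℝ) (t : ℝ) : Set T := {f | (f : ℝ) ≤ t}

lemma measurableSet_gridPos (T : Finset ℝ) (q : Set T) : MeasurableSet (gridPos T ⁻¹' {q}) := by
  have : gridPos T ⁻¹' {q} = ⋂ f : T, {t | (f : ℝ) ≤ t ↔ f ∈ q} := by
    ext t
    simp [gridPos, Set.ext_iff]
  rw [this]
  refine MeasurableSet.iInter fun f => ?_
  by_cases hf : f ∈ q
  · simp only [hf, iff_true]; exact measurableSet_Ici
  · simp only [hf, iff_false, not_le]; exact measurableSet_Iio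

/-- The atoms of the product grid in the unit cube. -/
def atom (T : Finset ℝ) {d : ℕ} (p : Fin d → Set T) : Set (Fin d → ℝ) :=
  Set.univ.pi fun k => Set.Ico 0 1 ∩ gridPos T ⁻¹' {p k}

lemma measurableSet_atom (T : Finset ℝ) {d : ℕ} (p : Fin d → Set T) : MeasurableSet (atom T p) :=
  MeasurableSet.univ_pi fun _ => measurableSet_Ico.inter (measurableSet_gridPos T _)

lemma volume_atom_lt_top (T : Finset ℝ) {d : ℕ} (p : Fin d → Set T) : volume (atom T p) < ⊤ := by
  have h : atom T p ⊆ Set.Icc 0 1 := fun x hx =>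
    ⟨fun k => (hx k (Set.mem_univ k)).1.1, fun k => (hx k (Set.mem_univ k)).1.2.le⟩
  exact (measure_mono h).trans_lt (Bornology.IsBounded.measure_lt_top (Metric.isBounded_Icc 0 1))

lemma cons_mem_atom (T : Finset ℝ) {d : ℕ} (q : Set T) (p : Fin d → Set T) (t : ℝ) (y : Fin d → ℝ) :
    (Fin.cons t y : Fin (d + 1) → ℝ) ∈ atom T (Fin.cons q p : Fin (d + 1) → Set T) ↔
      (t ∈ Set.Ico (0 : ℝ) 1 ∧ gridPos T t = q) ∧ y ∈ atom T p := by
  simp only [atom, Set.mem_univ_pi, Fin.forall_fin_succ, Fin.cons_zero, Fin.cons_succ,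
    Set.mem_inter_iff, Set.mem_preimage, Set.mem_singleton_iff]

lemma memLp_indicator_trigPoly {d : ℕ} {A : Set (Fin d → ℝ)} (hA : MeasurableSet A)
    (hA' : volume A < ⊤) (v : (Fin d → ℤ) →₀ ℂ) (p : ENNReal) :
    MemLp (A.indicator (trigPoly d v)) p volume := by
  rw [memLp_indicator_iff_restrict hA]
  have : IsFiniteMeasure (volume.restrict A) := ⟨by simpa using hA'⟩
  exact MemLp.of_bound (continuous_trigPoly v).aestronglyMeasurable _
    (Filter.Eventually.of_forall (norm_trigPoly_le v))

/-- The restriction of a trigonometric polynomial to an atom of the grid. -/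
def atomMap (T : Finset ℝ) (d : ℕ) (p : Fin d → Set T) :
    ((Fin d → ℤ) →₀ ℂ) →ₗ[ℂ] Lp ℂ 2 (volume : Measure (Fin d → ℝ)) where
  toFun v := (memLp_indicator_trigPoly (measurableSet_atom T p) (volume_atom_lt_top T p) v 2).toLp _
  map_add' v w := by
    rw [← MemLp.toLp_add]
    congr 1
    rw [map_add, Set.indicator_add']
  map_smul' a v := by
    rw [RingHom.id_apply, ← MemLp.toLp_const_smul]
    congr 1
    rw [map_smul]
    exact Set.indicator_const_smul _ a (trigPoly d v)

lemma norm_atomMap_sq (T : Finset ℝ) {d : ℕ} (p : Fin d → Set T) (v : (Fin d → ℤ) →₀ ℂ) :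
    ‖atomMap T d p v‖ ^ 2 = ∫ x in atom T p, ‖trigPoly d v x‖ ^ 2 := by
  have h := norm_toLp_sq (memLp_indicator_trigPoly (measurableSet_atom T p)
    (volume_atom_lt_top T p) v 2)
  refine h.trans ?_
  rw [← integral_indicator (measurableSet_atom T p)]
  congr 1
  funext x
  by_cases hx : x ∈ atom T p <;> simp [hx]

lemma integral_eq_integral_cons {d : ℕ} {g : (Fin (d + 1) → ℝ) → ℝ} (hg : Integrable g) :
    ∫ x, g x = ∫ t : ℝ, ∫ y : Fin d → ℝ, g (Fin.cons t y) := by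
  have h := (volume_preserving_piFinSuccAbove (fun _ : Fin (d + 1) => ℝ) 0).symm
  rw [← h.integral_comp', Measure.volume_eq_prod, integral_prod]
  · refine integral_congr_ae (Filter.Eventually.of_forall fun t => ?_)
    refine integral_congr_ae (Filter.Eventually.of_forall fun y => ?_)
    simp only [MeasurableEquiv.piFinSuccAbove_symm_apply]
    congr 1
    exact Fin.insertNth_zero' t y
  · exact (h.integrable_comp_emb (MeasurableEquiv.measurableEmbedding _)).2 hg

/-- Fubini in the first coordinate: slicing an atom leaves a lower dimensional atom over one grid
cell, and slicing the polynomial leaves the value of a wave of period one. -/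
lemma norm_atomMap_cons_sq (T : Finset ℝ) {d : ℕ} (q : Set T) (p : Fin d → Set T)
    (v : (Fin (d + 1) → ℤ) →₀ ℂ) :
    ‖atomMap T (d + 1) (Fin.cons q p) v‖ ^ 2 = ∫ t in (0 : ℝ)..1,
      ‖{t | gridPos T (Int.fract t) = q}.indicator
        (wave (atomMap T d) 1 (firstFreqs v) (freqSlice v) p) t‖ ^ 2 := by
  rw [norm_atomMap_sq, ← integral_indicator (measurableSet_atom T _), integral_eq_integral_cons]
  · rw [intervalIntegral.integral_of_le zero_le_one, ← integral_Ico_eq_integral_Ioc,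
      ← integral_indicator measurableSet_Ico]
    congr 1
    funext t
    by_cases ht : t ∈ Set.Ico (0 : ℝ) 1
    · rw [Set.indicator_of_mem ht]
      have hfr : Int.fract t = t := Int.fract_eq_self.2 ht
      by_cases hq : gridPos T t = q
      · have hmem : t ∈ {t | gridPos T (Int.fract t) = q} := by
          rw [Set.mem_ofPred_eq, hfr]; exact hq
        rw [Set.indicator_of_mem hmem]
        have hw : wave (atomMap T d) 1 (firstFreqs v) (freqSlice v) p t =
            atomMap T d p (∑ l ∈ firstFreqs v, ex (l * t / 1) • freqSlice v l) := by
          simp only [map_sum, map_smul]; rfl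
        rw [hw, norm_atomMap_sq, ← integral_indicator (measurableSet_atom T _)]
        congr 1
        funext y
        have := cons_mem_atom T q p t y
        by_cases hy : y ∈ atom T p
        · rw [Set.indicator_of_mem hy, Set.indicator_of_mem (this.2 ⟨⟨ht, hq⟩, hy⟩), trigPoly_cons]
        · rw [Set.indicator_of_notMem hy, Set.indicator_of_notMem fun h => hy (this.1 h).2]
      · have hmem : t ∉ {t | gridPos T (Int.fract t) = q} := by
          rw [Set.mem_ofPred_eq, hfr]; exact hq
        rw [Set.indicator_of_notMem hmem]
        have : ∀ y, (atom T (Fin.cons q p : Fin (d + 1) → Set T)).indicator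
            (fun x => ‖trigPoly (d + 1) v x‖ ^ 2) (Fin.cons t y) = 0 := fun y =>
          Set.indicator_of_notMem (fun h => hq ((cons_mem_atom T q p t y).1 h).1.2) _
        simp [this]
    · rw [Set.indicator_of_notMem ht]
      have : ∀ y, (atom T (Fin.cons q p : Fin (d + 1) → Set T)).indicator
          (fun x => ‖trigPoly (d + 1) v x‖ ^ 2) (Fin.cons t y) = 0 := fun y =>
        Set.indicator_of_notMem (fun h => ht ((cons_mem_atom T q p t y).1 h).1.1) _
      simp [this]
  · rw [integrable_indicator_iff (measurableSet_atom T _)]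
    have := memLp_indicator_trigPoly (measurableSet_atom T (Fin.cons q p : Fin (d + 1) → Set T))
      (volume_atom_lt_top T _) v 2
    rw [memLp_indicator_iff_restrict (measurableSet_atom T _)] at this
    exact (memLp_two_iff_integrable_sq_norm this.1).1 this

/-- The slices of a union of atoms. -/
def gridSlice (T : Finset ℝ) {d : ℕ} (B : Set (Fin (d + 1) → Set T)) (t : ℝ) :
    Set (Fin d → Set T) := {p | (Fin.cons (gridPos T (Int.fract t)) p : Fin (d + 1) → Set T) ∈ B}

/-- The jump at `0` is added because the fractional part is discontinuous at the integers. -/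
lemma isStep_gridSlice (T : Finset ℝ) {d : ℕ} (B : Set (Fin (d + 1) → Set T)) :
    IsStep 1 (insert 0 T) (gridSlice T B) := by
  refine ⟨fun t => by simp [gridSlice], fun s t hst h => ?_⟩
  have h0 : ⌊s⌋ = ⌊t⌋ := by
    refine le_antisymm (Int.floor_mono hst.le) ?_
    by_contra! hlt
    refine h 0 (Finset.mem_insert_self _ _) ⌊t⌋ ⟨?_, ?_⟩
    · rw [zero_add, mul_one]; exact Int.floor_lt.1 hlt
    · rw [zero_add, mul_one]; exact Int.floor_le t
  have h1 : gridPos T (Int.fract s) = gridPos T (Int.fract t) := by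
    ext f
    simp only [gridPos, Set.mem_ofPred_eq, Int.fract]
    rw [h0]
    constructor
    · intro hf; linarith
    · intro hf
      by_contra! hlt
      exact h f (Finset.mem_insert_of_mem f.2) ⌊t⌋ ⟨by linarith, by linarith⟩
  simp only [gridSlice, h1]

open Classical in
lemma sum_norm_atomMap_succ_sq (T : Finset ℝ) {d : ℕ} (B : Set (Fin (d + 1) → Set T))
    (v : (Fin (d + 1) → ℤ) →₀ ℂ) :
    ∑ p with p ∈ B, ‖atomMap T (d + 1) p v‖ ^ 2 = ∑ p, ∫ t in (0 : ℝ)..1,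
      ‖{t | p ∈ gridSlice T B t}.indicator
        (wave (atomMap T d) 1 (firstFreqs v) (freqSlice v) p) t‖ ^ 2 := by
  rw [Finset.sum_filter, ← (Fin.consEquiv fun _ : Fin (d + 1) => Set T).sum_comp,
    Fintype.sum_prod_type_right]
  refine Finset.sum_congr rfl fun p _ => ?_
  change ∑ q, (if (Fin.cons q p : Fin (d + 1) → Set T) ∈ B then
    ‖atomMap T (d + 1) (Fin.cons q p) v‖ ^ 2 else 0) = _
  simp only [norm_atomMap_cons_sq]
  have hm : ∀ q, MeasurableSet {t : ℝ | gridPos T (Int.fract t) = q} := fun q =>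
    measurable_fract (measurableSet_gridPos T q)
  have hi : ∀ q, IntervalIntegrable (fun t => ‖{t | gridPos T (Int.fract t) = q}.indicator
      (wave (atomMap T d) 1 (firstFreqs v) (freqSlice v) p) t‖ ^ 2) volume 0 1 := fun q =>
    intervalIntegrable_indicator_trigSum (hm q) _ _ _ _ _
  rw [← Finset.sum_filter, ← intervalIntegral.integral_finsetSum fun q _ => hi q]
  refine intervalIntegral.integral_congr fun t _ => ?_
  rw [Finset.sum_filter, Finset.sum_eq_single (gridPos T (Int.fract t))]
  · by_cases hp : (Fin.cons (gridPos T (Int.fract t)) p : Fin (d + 1) → Set T) ∈ B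
    · rw [if_pos hp, Set.indicator_of_mem, Set.indicator_of_mem]
      · exact hp
      · rfl
    · rw [if_neg hp, Set.indicator_of_notMem, norm_zero]
      · norm_num
      · exact hp
  · intro q _ hq
    split_ifs
    · have : t ∉ {t | gridPos T (Int.fract t) = q} := fun h => hq (Eq.symm h)
      rw [Set.indicator_of_notMem this]; simp
    · rfl
  · simp

lemma IsRS.isBaseRS_atomMap {T : Finset ℝ} {d : ℕ} {B : Set (Fin (d + 1) → Set T)}
    {Γ : Set ((Fin d → ℤ) × ℤ)} {C : ℝ} (h : IsRS (atomMap T d) 1 (gridSlice T B) Γ C) :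
    IsBaseRS (atomMap T (d + 1)) B {ξ | (Fin.tail ξ, ξ 0) ∈ Γ} C := by
  classical
  intro v hv
  have h1 := h (firstFreqs v) (freqSlice v) fun l _ ξ hξ => by
    rw [freqSlice_apply] at hξ
    simpa using hv _ hξ
  have h2 := sum_integral_sq_wave (F := atomMap T d) one_pos 0 (firstFreqs v) (freqSlice v)
  -- For the full set of atoms the slicing formula is Parseval: it identifies the total energy with
  -- the sum of the energies of the frequency slices.
  have h3 := sum_norm_atomMap_succ_sq T (Set.univ : Set (Fin (d + 1) → Set T)) v
  have h4 : nsq (atomMap T (d + 1)) v = 1 * ∑ l ∈ firstFreqs v, nsq (atomMap T d) (freqSlice v l) := by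
    rw [← h2, zero_add, nsq]
    refine Eq.trans ?_ (h3.trans ?_)
    · simp
    · refine Finset.sum_congr rfl fun p _ => ?_
      have : {t : ℝ | p ∈ gridSlice T (Set.univ : Set (Fin (d + 1) → Set T)) t} = Set.univ :=
        Set.eq_univ_of_forall fun t => Set.mem_univ _
      rw [this]; simp only [Set.indicator_univ]
  rw [h4]
  refine h1.trans (le_of_eq ?_)
  rw [← sum_norm_atomMap_succ_sq]

/-- Coherent frequency sets for all unions of atoms of a grid. -/
theorem exists_coherent_grid (T : Finset ℝ) (d : ℕ) :
    ∃ (Ξ : Set (Fin d → Set T) → Set (Fin d → ℤ)) (C : ℝ), 0 ≤ C ∧ Monotone Ξ ∧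
      (∀ B, IsBaseRS (atomMap T d) B (Ξ B) C) ∧ ∀ B, IsBaseRS (atomMap T d) Bᶜ (Ξ B)ᶜ C := by
  classical
  induction d with
  | zero =>
    have h : ∀ (B : Set (Fin 0 → Set T)) (U : Set (Fin 0 → ℤ)), (U.Nonempty → B = Set.univ) →
        IsBaseRS (atomMap T 0) B U 1 := by
      intro B U hBU v hv
      by_cases hv0 : v = 0
      · simp [hv0, nsq]
      · obtain ⟨ξ, hξ⟩ := Finsupp.ne_iff.1 hv0
        rw [hBU ⟨ξ, hv ξ hξ⟩]
        simp [nsq]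
    -- In dimension zero there is one atom and one frequency, so a set of atoms is full or empty and
    -- the frequency is taken exactly when it is full.
    refine ⟨fun B => {_ξ | default ∈ B}, 1, zero_le_one, fun A B hAB ξ hξ => hAB hξ,
      fun B => h _ _ ?_, fun B => h _ _ ?_⟩
    · rintro ⟨ξ, hξ⟩
      exact Set.eq_univ_of_forall fun p => by rw [Subsingleton.elim p default]; exact hξ
    · rintro ⟨ξ, hξ⟩
      exact Set.eq_univ_of_forall fun p => by rw [Subsingleton.elim p default]; exact hξ
  | succ d ih =>
    obtain ⟨Ξ, C₀, hC₀, hmono, hΞ, hΞ'⟩ := ih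
    obtain ⟨C, hC, Γ, hΓ, hRS, hRS', -⟩ := exists_good hC₀ hmono hΞ hΞ' (insert 0 T) one_pos
    refine ⟨fun B => {ξ | (Fin.tail ξ, ξ 0) ∈ Γ (gridSlice T B)}, C, hC, fun A B hAB ξ hξ => ?_,
      fun B => (hRS _ (isStep_gridSlice T B)).isBaseRS_atomMap, fun B => ?_⟩
    · exact hΓ _ _ (isStep_gridSlice T A) (isStep_gridSlice T B) (fun t p hp => hAB hp) hξ
    · exact IsRS.isBaseRS_atomMap (B := Bᶜ) (hRS' _ (isStep_gridSlice T B))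

end Grid

/-! ### From complementary lower bounds to Riesz bases. -/

section Hilbert
open Filter Topology ContinuousLinearMap

/-- Isomorphic Hilbert spaces are isometrically isomorphic. -/
theorem exists_linearIsometryEquiv {G H : Type*} [NormedAddCommGroup G] [InnerProductSpace ℂ G]
    [CompleteSpace G] [NormedAddCommGroup H] [InnerProductSpace ℂ H] [CompleteSpace H]
    (A : G ≃L[ℂ] H) : Nonempty (G ≃ₗᵢ[ℂ] H) := by
  let A' : G →L[ℂ] H := A
  let B' : H →L[ℂ] G := A.symm
  -- Polar decomposition: with `s` the positive square root of `S`, the map `A ∘ s⁻¹` preserves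
  -- norms and is onto.
  set S : G →L[ℂ] G := adjoint A' ∘SL A' with hS
  have hS0 : 0 ≤ S := (nonneg_iff_isPositive S).2 (isPositive_adjoint_comp_self A')
  have hAB : A' ∘SL B' = ContinuousLinearMap.id ℂ H := by ext x; simp [A', B']
  have hBA : B' ∘SL A' = ContinuousLinearMap.id ℂ _ := by
    apply ContinuousLinearMap.ext; intro x; simp [A', B']
  have hSu : IsUnit S := by
    rw [isUnit_iff_exists]
    refine ⟨B' ∘SL adjoint B', ?_, ?_⟩
    · calc (adjoint A' ∘SL A') ∘SL (B' ∘SL adjoint B')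
          = adjoint A' ∘SL (A' ∘SL B') ∘SL adjoint B' := rfl
        _ = adjoint A' ∘SL adjoint B' := by rw [hAB]; rfl
        _ = adjoint (B' ∘SL A') := (adjoint_comp _ _).symm
        _ = 1 := by rw [hBA]; exact star_one _
    · calc (B' ∘SL adjoint B') ∘SL (adjoint A' ∘SL A')
          = B' ∘SL (adjoint B' ∘SL adjoint A') ∘SL A' := rfl
        _ = B' ∘SL adjoint (A' ∘SL B') ∘SL A' := by rw [adjoint_comp]
        _ = B' ∘SL A' := by rw [hAB]; rw [show adjoint (ContinuousLinearMap.id ℂ H) = 1 from star_one _]; rfl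
        _ = 1 := hBA
  obtain ⟨u, hu⟩ := (CFC.isUnit_sqrt_iff S hS0).2 hSu
  set s := CFC.sqrt S with hs
  have hss : s * s = S := CFC.sqrt_mul_sqrt_self S hS0
  have hsa : adjoint s = s := (CFC.sqrt_nonneg S).isSelfAdjoint
  have hnorm : ∀ x, ‖A x‖ = ‖s x‖ := by
    intro x
    have h1 : inner ℂ (A' x) (A' x) = inner ℂ (s x) (s x) := by
      calc inner ℂ (A' x) (A' x) = inner ℂ (S x) x := by
            rw [hS, comp_apply, adjoint_inner_left]
        _ = inner ℂ (adjoint s (s x)) x := by rw [hsa, ← hss]; rfl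
        _ = inner ℂ (s x) (s x) := adjoint_inner_left _ _ _
    rw [inner_self_eq_norm_sq_to_K, inner_self_eq_norm_sq_to_K] at h1
    have h2 : ‖A' x‖ ^ 2 = ‖s x‖ ^ 2 := by exact_mod_cast h1
    exact (pow_left_inj₀ (norm_nonneg _) (norm_nonneg _) two_ne_zero).1 h2
  have hu1 : ∀ x, s ((↑u⁻¹ : G →L[ℂ] G) x) = x := by
    intro x
    have := congrArg (fun f => f x) u.mul_inv
    rwa [hu] at this
  have hu2 : ∀ x, (↑u⁻¹ : G →L[ℂ] G) (s x) = x := by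
    intro x
    have := congrArg (fun f => f x) u.inv_mul
    rwa [hu] at this
  let W : G →ₗᵢ[ℂ] H :=
    { toLinearMap := (A' ∘SL (↑u⁻¹ : G →L[ℂ] G)).toLinearMap
      norm_map' := fun x => (hnorm _).trans (congrArg norm (hu1 x)) }
  have hW : ∀ x, W x = A ((↑u⁻¹ : G →L[ℂ] G) x) :=
    fun _ => rfl
  have hWs : Function.Surjective W := fun y => ⟨s (A.symm y), by rw [hW, hu2]; simp⟩
  exact ⟨LinearIsometryEquiv.ofSurjective W hWs⟩

/-- The image of the standard basis of `ℓ²` under an isomorphism onto a Hilbert space is a Riesz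
basis. -/
theorem isRieszBasis_of_equiv {ι H : Type*} [DecidableEq ι] [NormedAddCommGroup H]
    [InnerProductSpace ℂ H] [CompleteSpace H] (A : lp (fun _ : ι => ℂ) 2 ≃L[ℂ] H) :
    IsRieszBasis fun i => A (lp.single 2 i (1 : ℂ)) := by
  obtain ⟨E⟩ := exists_linearIsometryEquiv A
  let b : HilbertBasis ι ℂ H := HilbertBasis.ofRepr E.symm
  refine ⟨b, E.symm.toContinuousLinearEquiv.trans A, fun i => ?_⟩
  have h1 : E.symm (b i) = lp.single 2 i (1 : ℂ) := by
    convert! b.repr_self i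
  change A (lp.single 2 i 1) = A (E.symm (b i))
  rw [h1]

variable {I H₀ H₁ H₂ : Type*} [NormedAddCommGroup H₀] [InnerProductSpace ℂ H₀]
  [NormedAddCommGroup H₁] [InnerProductSpace ℂ H₁]
  [NormedAddCommGroup H₂] [InnerProductSpace ℂ H₂]

/-- Both sides are continuous in the vector, so a bound for finite combinations passes to convergent
expansions with the same admissible frequencies. -/
lemma norm_sq_le_of_hasSum {b : I → H₀} {R : H₀ →L[ℂ] H₁} {Ξ : Set I} {C : ℝ}
    (h : ∀ v : I →₀ ℂ, (∀ ξ, v ξ ≠ 0 → ξ ∈ Ξ) → ‖Finsupp.linearCombination ℂ b v‖ ^ 2 ≤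
      C * ‖R (Finsupp.linearCombination ℂ b v)‖ ^ 2)
    {J : Type*} {φ : J → I} {c : J → ℂ} (hφ : ∀ j, c j ≠ 0 → φ j ∈ Ξ) {y : H₀}
    (hy : HasSum (fun j => c j • b (φ j)) y) : ‖y‖ ^ 2 ≤ C * ‖R y‖ ^ 2 := by
  refine le_of_tendsto_of_tendsto' ((continuous_norm.pow 2).continuousAt.tendsto.comp hy)
    (((continuous_const.mul ((R.continuous.norm).pow 2)).continuousAt.tendsto).comp hy) fun s => ?_
  have h1 : ∑ j ∈ s, c j • b (φ j) =
      Finsupp.linearCombination ℂ b (∑ j ∈ s, Finsupp.single (φ j) (c j)) := by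
    simp [map_sum, Finsupp.linearCombination_single]
  simp only [Function.comp_apply, h1]
  refine h _ fun ξ hξ => ?_
  rw [Finsupp.finsetSum_apply] at hξ
  obtain ⟨j, _, hj⟩ := Finset.exists_ne_zero_of_sum_ne_zero hξ
  by_cases hφj : φ j = ξ
  · rw [← hφj]
    refine hφ j fun h0 => hj ?_
    rw [h0, Finsupp.single_zero]; rfl
  · exact absurd (Finsupp.single_eq_of_ne (Ne.symm hφj)) hj

/-- Complementary lower Riesz bounds for a splitting of a Hilbert space with an orthonormal basis
yield a Riesz basis. -/
theorem isRieszBasis_of_split [CompleteSpace H₀] [CompleteSpace H₁]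
    (b : HilbertBasis I ℂ H₀) (R₁ : H₀ →L[ℂ] H₁) (R₂ : H₀ →L[ℂ] H₂)
    (hsplit : ∀ x y, inner ℂ x y = inner ℂ (R₁ x) (R₁ y) + inner ℂ (R₂ x) (R₂ y))
    (hsurj : ∀ f, ∃ g, R₁ g = f ∧ R₂ g = 0) (Ξ : Set I) {C : ℝ} (hC : 0 ≤ C)
    (h₁ : ∀ v : I →₀ ℂ, (∀ ξ, v ξ ≠ 0 → ξ ∈ Ξ) → ‖Finsupp.linearCombination ℂ b v‖ ^ 2 ≤
      C * ‖R₁ (Finsupp.linearCombination ℂ b v)‖ ^ 2)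
    (h₂ : ∀ v : I →₀ ℂ, (∀ ξ, v ξ ≠ 0 → ξ ∈ Ξᶜ) → ‖Finsupp.linearCombination ℂ b v‖ ^ 2 ≤
      C * ‖R₂ (Finsupp.linearCombination ℂ b v)‖ ^ 2) :
    IsRieszBasis fun ξ : Ξ => R₁ (b ξ) := by
  classical
  have hon : Orthonormal ℂ fun ξ : Ξ => b ξ := b.orthonormal.comp _ Subtype.val_injective
  let V := hon.orthogonalFamily.linearIsometry
  have hV : ∀ ξ : Ξ, V (lp.single 2 ξ (1 : ℂ)) = b ξ := fun ξ => by
    have := hon.orthogonalFamily.linearIsometry_apply_single (i := ξ) (1 : ℂ)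
    exact this.trans (one_smul ℂ _)
  let A : lp (fun _ : Ξ => ℂ) 2 →L[ℂ] H₁ := R₁ ∘SL V.toContinuousLinearMap
  have hA : ∀ x, A x = R₁ (V x) := fun _ => rfl
  have hbelow : ∀ x, ‖x‖ ≤ (Real.sqrt C).toNNReal * ‖A x‖ := by
    intro x
    have h3 : ‖V x‖ ^ 2 ≤ C * ‖R₁ (V x)‖ ^ 2 :=
      norm_sq_le_of_hasSum h₁ (φ := fun ξ : Ξ => (ξ : I)) (c := fun ξ => x ξ)
        (fun ξ _ => ξ.2) (hon.orthogonalFamily.hasSum_linearIsometry x)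
    rw [Real.coe_toNNReal _ (Real.sqrt_nonneg _), hA, ← V.norm_map x]
    rw [← pow_le_pow_iff_left₀ (norm_nonneg _) (by positivity) two_ne_zero]
    rw [mul_pow, Real.sq_sqrt hC]
    exact h3
  have hanti := A.antilipschitz_of_bound hbelow
  have hker : A.ker = ⊥ := LinearMap.ker_eq_bot.2 hanti.injective
  have hclosed : IsClosed (A.range : Set H₁) := hanti.isClosed_range A.uniformContinuous
  have hrange : A.range = ⊤ := by
    rw [← hclosed.submodule_topologicalClosure_eq, Submodule.topologicalClosure_eq_top_iff,
      Submodule.eq_bot_iff]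
    -- A vector orthogonal to the range lifts to some `g` with `R₂ g = 0` whose expansion uses only
    -- frequencies outside `Ξ`; the complementary bound forces `g = 0`.
    intro f hf
    obtain ⟨g, rfl, hg⟩ := hsurj f
    have h3 : ∀ ξ ∈ Ξ, inner ℂ (b ξ) g = 0 := by
      intro ξ hξ
      rw [hsplit, hg, inner_zero_right, add_zero]
      refine (Submodule.mem_orthogonal _ _).1 hf _ ⟨lp.single 2 ⟨ξ, hξ⟩ (1 : ℂ), ?_⟩
      change A _ = _
      rw [hA, hV]
    have h4 : ‖g‖ ^ 2 ≤ C * ‖R₂ g‖ ^ 2 :=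
      norm_sq_le_of_hasSum h₂ (φ := id) (c := fun i => b.repr g i)
        (fun ξ hξ hξΞ => hξ (by rw [b.repr_apply_apply]; exact h3 ξ hξΞ)) (b.hasSum_repr g)
    rw [hg, norm_zero] at h4
    have h5 : ‖g‖ = 0 := by
      have : ‖g‖ ^ 2 ≤ 0 := by simpa using h4
      exact pow_eq_zero_iff two_ne_zero |>.1 (le_antisymm this (by positivity))
    rw [norm_eq_zero.1 h5, map_zero]
  have h := isRieszBasis_of_equiv (ContinuousLinearEquiv.ofBijective A hker hrange)
  convert! h using 2 with ξ
  exact congrArg R₁ (hV ξ).symm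

end Hilbert

/-! ### Exponentials over the unit cube and restriction to subsets. -/

section Cube

lemma memLp_expFun {d : ℕ} (ξ : Fin d → ℤ) (ν : Measure (Fin d → ℝ)) [IsFiniteMeasure ν] :
    MemLp (expFun ξ) 2 ν :=
  MemLp.of_bound (continuous_expFun ξ).aestronglyMeasurable 1
    (Filter.Eventually.of_forall fun x => (norm_expFun ξ x).le)

/-- Lebesgue measure on the unit cube. -/
abbrev cubeMeasure (d : ℕ) : Measure (Fin d → ℝ) := volume.restrict (Set.Icc 0 1)

instance (d : ℕ) : IsFiniteMeasure (cubeMeasure d) :=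
  ⟨by simpa using Bornology.IsBounded.measure_lt_top (Metric.isBounded_Icc (0 : Fin d → ℝ) 1)⟩

lemma mFourier_coe {d : ℕ} (ξ : Fin d → ℤ) (x : Fin d → ℝ) :
    UnitAddTorus.mFourier ξ (fun i => (x i : UnitAddCircle)) = expFun ξ x := by
  simp only [UnitAddTorus.mFourier, ContinuousMap.coe_mk, fourier_coe_apply, expFun]
  rw [← Complex.exp_sum]
  congr 1
  push_cast
  rw [Finset.mul_sum]
  refine Finset.sum_congr rfl fun k _ => ?_
  ring

/-- The exponentials with integer frequencies form an orthonormal basis over the unit cube. -/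
lemma exists_cubeBasis (d : ℕ) : ∃ b : HilbertBasis (Fin d → ℤ) ℂ (Lp ℂ 2 (cubeMeasure d)),
    ∀ ξ, b ξ = (memLp_expFun ξ (cubeMeasure d)).toLp _ := by
  have h1 := UnitAddTorus.measurePreserving_equivPiIoc (0 : Fin d → ℝ)
  have hm : MeasurableSet {x : Fin d → ℝ | ∀ i, x i ∈ Set.Ioc ((0 : Fin d → ℝ) i) ((0 : Fin d → ℝ) i + 1)} :=
    MeasurableSet.univ_pi' fun i => measurableSet_Ioc
  have h2 := (measurePreserving_subtype_coe (μa := volume) hm).comp h1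
  have h3 : volume.restrict {x : Fin d → ℝ | ∀ i, x i ∈ Set.Ioc ((0 : Fin d → ℝ) i) ((0 : Fin d → ℝ) i + 1)} =
      cubeMeasure d := by
    refine Measure.restrict_congr_set ?_
    have hset : {x : Fin d → ℝ | ∀ i, x i ∈ Set.Ioc ((0 : Fin d → ℝ) i) ((0 : Fin d → ℝ) i + 1)} =
        Set.univ.pi fun i => Set.Ioc ((0 : Fin d → ℝ) i) ((1 : Fin d → ℝ) i) := by ext x; simp
    rw [hset]
    exact Measure.univ_pi_Ioc_ae_eq_Icc
  rw [h3] at h2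
  -- Pulling back along the measure preserving parametrisation from the torus carries exponentials
  -- to characters, so orthonormality and completeness are inherited from Fourier series.
  let Φ := Lp.compMeasurePreservingₗᵢ (p := 2) (E := ℂ) ℂ _ h2
  have hΦ : ∀ ξ, Φ ((memLp_expFun ξ (cubeMeasure d)).toLp _) = UnitAddTorus.mFourierLp 2 ξ := by
    intro ξ
    refine (Lp.toLp_compMeasurePreserving (memLp_expFun ξ (cubeMeasure d)) h2).trans ?_
    refine Lp.ext ?_
    refine (MemLp.coeFn_toLp _).trans ?_
    refine Filter.EventuallyEq.trans ?_ (UnitAddTorus.coeFn_mFourierLp 2 ξ).symm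
    refine Filter.Eventually.of_forall fun x => ?_
    have h4 := (UnitAddTorus.measurableEquivPiIoc (0 : Fin d → ℝ)).symm_apply_apply x
    rw [UnitAddTorus.coe_symm_measurableEquivPiIoc_apply] at h4
    have h5 := mFourier_coe ξ ((UnitAddTorus.measurableEquivPiIoc (0 : Fin d → ℝ)) x).1
    rw [h4] at h5
    exact h5.symm
  have hon : Orthonormal ℂ fun ξ : Fin d → ℤ => (memLp_expFun ξ (cubeMeasure d)).toLp _ := by
    rw [← Φ.orthonormal_comp_iff]
    convert! UnitAddTorus.orthonormal_mFourier (d := Fin d) using 1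
    exact funext hΦ
  have hbot : (Submodule.span ℂ (Set.range fun ξ : Fin d → ℤ =>
      (memLp_expFun ξ (cubeMeasure d)).toLp _))ᗮ = ⊥ := by
    rw [Submodule.eq_bot_iff]
    intro f hf
    have h5 := UnitAddTorus.span_mFourierLp_closure_eq_top (d := Fin d) (p := 2) (by norm_num)
    rw [Submodule.topologicalClosure_eq_top_iff, Submodule.eq_bot_iff] at h5
    have h6 : Φ f = 0 := by
      refine h5 _ ?_
      rw [Submodule.mem_orthogonal]
      intro u hu
      induction hu using Submodule.span_induction with
      | mem u hu =>
        obtain ⟨ξ, rfl⟩ := hu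
        rw [← hΦ, Φ.inner_map_map]
        exact (Submodule.mem_orthogonal _ _).1 hf _ (Submodule.subset_span ⟨ξ, rfl⟩)
      | zero => exact inner_zero_left _
      | add u v _ _ hu hv => rw [inner_add_left, hu, hv, add_zero]
      | smul a u _ hu => rw [inner_smul_left, hu, mul_zero]
    have h7 : ‖f‖ = 0 := by rw [← Φ.norm_map, h6, norm_zero]
    exact norm_eq_zero.1 h7
  refine ⟨HilbertBasis.mkOfOrthogonalEqBot hon hbot, fun ξ => ?_⟩
  rw [HilbertBasis.coe_mkOfOrthogonalEqBot]

/-- The exponentials with frequencies in `Ξ` form a Riesz basis of `L²(ν)`. -/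
def IsExpRieszBasisOf {d : ℕ} (Ξ : Set (Fin d → ℤ)) (ν : Measure (Fin d → ℝ)) : Prop :=
  ∃ h : ∀ ξ : Ξ, MemLp (expFun ξ.1) 2 ν,
    IsRieszBasis (H := Lp ℂ 2 ν) (fun ξ : Ξ => (h ξ).toLp (expFun ξ.1))

lemma memLp_trigPoly {d : ℕ} (v : (Fin d → ℤ) →₀ ℂ) (ν : Measure (Fin d → ℝ))
    [IsFiniteMeasure ν] : MemLp (trigPoly d v) 2 ν :=
  MemLp.of_bound (continuous_trigPoly v).aestronglyMeasurable _
    (Filter.Eventually.of_forall (norm_trigPoly_le v))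

lemma linearCombination_toLp_expFun {d : ℕ} (ν : Measure (Fin d → ℝ)) [IsFiniteMeasure ν]
    (v : (Fin d → ℤ) →₀ ℂ) :
    Finsupp.linearCombination ℂ (fun ξ => (memLp_expFun ξ ν).toLp (expFun ξ)) v =
      (memLp_trigPoly v ν).toLp _ := by
  induction v using Finsupp.induction_linear with
  | zero =>
    rw [map_zero, eq_comm, ← norm_eq_zero, ← sq_eq_zero_iff, norm_toLp_sq]
    simp
  | add v w hv hw =>
    rw [map_add, hv, hw, ← MemLp.toLp_add]
    exact MemLp.toLp_congr _ _ (by rw [map_add])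
  | single ξ a =>
    rw [Finsupp.linearCombination_single, ← MemLp.toLp_const_smul]
    refine MemLp.toLp_congr _ _ ?_
    rw [trigPoly, Finsupp.linearCombination_single]

lemma restrict_toLp {d : ℕ} {ν : Measure (Fin d → ℝ)} (X : Set (Fin d → ℝ)) {f : (Fin d → ℝ) → ℂ}
    (hf : MemLp f 2 ν) : LpToLpRestrictCLM _ ℂ ℂ ν 2 X (hf.toLp f) = (hf.restrict X).toLp f :=
  Lp.ext ((LpToLpRestrictCLM_coeFn ℂ X _).trans (Filter.EventuallyEq.trans
    (ae_restrict_of_ae hf.coeFn_toLp) (MemLp.coeFn_toLp (hf.restrict X)).symm))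

/-- Complementary lower bounds for exponentials on a subset of the cube and on its complement yield
a Riesz basis of exponentials. -/
theorem isExpRieszBasisOf_restrict {d : ℕ} {X : Set (Fin d → ℝ)} (hX : MeasurableSet X)
    {Ξ : Set (Fin d → ℤ)} {C : ℝ} (hC : 0 ≤ C)
    (h₁ : ∀ v : (Fin d → ℤ) →₀ ℂ, (∀ ξ, v ξ ≠ 0 → ξ ∈ Ξ) →
      ∫ x, ‖trigPoly d v x‖ ^ 2 ∂cubeMeasure d ≤
        C * ∫ x in X, ‖trigPoly d v x‖ ^ 2 ∂cubeMeasure d)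
    (h₂ : ∀ v : (Fin d → ℤ) →₀ ℂ, (∀ ξ, v ξ ≠ 0 → ξ ∈ Ξᶜ) →
      ∫ x, ‖trigPoly d v x‖ ^ 2 ∂cubeMeasure d ≤
        C * ∫ x in Xᶜ, ‖trigPoly d v x‖ ^ 2 ∂cubeMeasure d) :
    IsExpRieszBasisOf Ξ ((cubeMeasure d).restrict X) := by
  obtain ⟨b, hb⟩ := exists_cubeBasis d
  refine ⟨fun ξ => (memLp_expFun ξ.1 (cubeMeasure d)).restrict X, ?_⟩
  have hlc : ∀ v, Finsupp.linearCombination ℂ b v = (memLp_trigPoly v (cubeMeasure d)).toLp _ := by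
    intro v
    rw [← linearCombination_toLp_expFun]
    congr 2
    exact funext hb
  have hn : ∀ v, ‖Finsupp.linearCombination ℂ b v‖ ^ 2 = ∫ x, ‖trigPoly d v x‖ ^ 2 ∂cubeMeasure d :=
    fun v => by rw [hlc, norm_toLp_sq]
  have hnR : ∀ Y v, ‖LpToLpRestrictCLM _ ℂ ℂ (cubeMeasure d) 2 Y
      (Finsupp.linearCombination ℂ b v)‖ ^ 2 = ∫ x in Y, ‖trigPoly d v x‖ ^ 2 ∂cubeMeasure d :=
    fun Y v => by rw [hlc, restrict_toLp, norm_toLp_sq]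
  have := isRieszBasis_of_split b (LpToLpRestrictCLM _ ℂ ℂ (cubeMeasure d) 2 X)
    (LpToLpRestrictCLM _ ℂ ℂ (cubeMeasure d) 2 Xᶜ) ?_ ?_ Ξ hC ?_ ?_
  · simpa only [hb, restrict_toLp] using this
  · intro f g
    rw [L2.inner_def, L2.inner_def, L2.inner_def, ← integral_add_compl hX (L2.integrable_inner f g)]
    congr 1 <;>
    · refine integral_congr_ae ?_
      filter_upwards [LpToLpRestrictCLM_coeFn ℂ _ f, LpToLpRestrictCLM_coeFn ℂ _ g] with x hf hg
      rw [hf, hg]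
  · intro f
    have hf : MemLp (X.indicator f) 2 (cubeMeasure d) :=
      (memLp_indicator_iff_restrict hX).2 (Lp.memLp f)
    -- Extension by zero supplies the lift that vanishes under restriction to the complement.
    refine ⟨hf.toLp _, ?_, ?_⟩
    · rw [restrict_toLp]
      refine Lp.ext ((MemLp.coeFn_toLp _).trans ?_)
      filter_upwards [ae_restrict_mem hX] with x hx
      exact Set.indicator_of_mem hx _
    · rw [restrict_toLp]
      refine Lp.ext ((MemLp.coeFn_toLp _).trans ?_)
      filter_upwards [ae_restrict_mem hX.compl, Lp.coeFn_zero ℂ 2 ((cubeMeasure d).restrict Xᶜ)]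
        with x hx h0
      rw [h0]
      exact Set.indicator_of_notMem hx _
  · intro v hv
    rw [hn, hnR]; exact h₁ v hv
  · intro v hv
    rw [hn, hnR]; exact h₂ v hv

end Cube

/-! ### Unions of rectangles as unions of grid atoms, up to null sets. -/

section Rectangles

/-- Away from the grid, membership in `X` depends only on the position relative to the grid. -/
def IsAdapted {d : ℕ} (T : Finset ℝ) (X : Set (Fin d → ℝ)) : Prop :=
  ∀ x y : Fin d → ℝ, (∀ k, x k ∉ T) → (∀ k, y k ∉ T) → (∀ k, ∀ f ∈ T, f ≤ x k ↔ f ≤ y k) →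
    x ∈ X → y ∈ X

lemma IsAdapted.mono {d : ℕ} {T T' : Finset ℝ} (hT : T ⊆ T') {X : Set (Fin d → ℝ)}
    (h : IsAdapted T X) : IsAdapted T' X := fun x y hx hy hxy =>
  h x y (fun k hk => hx k (hT hk)) (fun k hk => hy k (hT hk)) fun k f hf => hxy k f (hT hf)

/-- Away from its endpoints every bounded interval, whatever its type, looks like `[inf, sup)`. The
empty set also fits, since both of its extremes are zero by convention. -/
lemma mem_iff_of_ordConnected {I : Set ℝ} (hI : I.OrdConnected) (hb : Bornology.IsBounded I) {t : ℝ}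
    (h1 : t ≠ sInf I) (h2 : t ≠ sSup I) : t ∈ I ↔ sInf I ≤ t ∧ ¬ sSup I ≤ t := by
  constructor
  · intro ht
    refine ⟨csInf_le hb.bddBelow ht, fun h => h2 (le_antisymm (le_csSup hb.bddAbove ht) h)⟩
  · rintro ⟨h3, h4⟩
    rcases I.eq_empty_or_nonempty with rfl | hne
    · simp only [Real.sInf_empty, Real.sSup_empty] at h3 h4
      exact absurd h3 h4
    · obtain ⟨a, ha, hat⟩ := exists_lt_of_csInf_lt hne (lt_of_le_of_ne h3 (Ne.symm h1))
      obtain ⟨c, hc, hct⟩ := exists_lt_of_lt_csSup hne (not_le.1 h4)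
      exact hI.out ha hc ⟨hat.le, hct.le⟩

lemma exists_isAdapted_of_isRectangle {d : ℕ} {R : Set (Fin d → ℝ)} (h : IsRectangle R) :
    ∃ T, IsAdapted T R := by
  classical
  obtain ⟨I, hI, rfl⟩ := h
  refine ⟨Finset.univ.biUnion fun k => {sInf (I k), sSup (I k)}, fun x y hx hy hxy hxI k _ => ?_⟩
  have hT1 : ∀ k, sInf (I k) ∈ Finset.univ.biUnion fun k => {sInf (I k), sSup (I k)} := fun k =>
    Finset.mem_biUnion.2 ⟨k, Finset.mem_univ _, by simp⟩
  have hT2 : ∀ k, sSup (I k) ∈ Finset.univ.biUnion fun k => {sInf (I k), sSup (I k)} := fun k =>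
    Finset.mem_biUnion.2 ⟨k, Finset.mem_univ _, by simp⟩
  rw [mem_iff_of_ordConnected (hI k).1 (hI k).2 (ne_of_mem_of_not_mem (hT1 k) (hy k)).symm
    (ne_of_mem_of_not_mem (hT2 k) (hy k)).symm, ← hxy k _ (hT1 k), ← hxy k _ (hT2 k),
    ← mem_iff_of_ordConnected (hI k).1 (hI k).2 (ne_of_mem_of_not_mem (hT1 k) (hx k)).symm
    (ne_of_mem_of_not_mem (hT2 k) (hx k)).symm]
  exact hxI k (Set.mem_univ k)

lemma exists_isAdapted {d : ℕ} {X : Set (Fin d → ℝ)}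
    (h : IsFiniteUnionOfRectangles X) : ∃ T, IsAdapted T X := by
  classical
  obtain ⟨S, hS, hR, rfl⟩ := h
  choose! T hT using fun R hRS => exists_isAdapted_of_isRectangle (hR R hRS)
  refine ⟨hS.toFinset.biUnion T, fun x y hx hy hxy => ?_⟩
  rintro ⟨R, hRS, hxR⟩
  exact ⟨R, hRS, (hT R hRS).mono (Finset.subset_biUnion_of_mem T (hS.mem_toFinset.2 hRS))
    x y hx hy hxy hxR⟩

lemma measurableSet_of_isFiniteUnionOfRectangles {d : ℕ} {X : Set (Fin d → ℝ)}
    (h : IsFiniteUnionOfRectangles X) : MeasurableSet X := by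
  obtain ⟨S, hS, hR, rfl⟩ := h
  refine MeasurableSet.sUnion hS.countable fun R hRS => ?_
  obtain ⟨I, hI, rfl⟩ := hR R hRS
  exact MeasurableSet.univ_pi fun k => (hI k).1.measurableSet

lemma ae_forall_notMem {d : ℕ} (T : Finset ℝ) : ∀ᵐ x : Fin d → ℝ, ∀ k, x k ∉ T := by
  have h : ∀ k, ∀ t ∈ T, ∀ᵐ x : Fin d → ℝ, x k ≠ t := fun k t _ => by
    have := Measure.pi_hyperplane (fun _ : Fin d => (volume : Measure ℝ)) k t
    rw [ae_iff]
    simpa [volume_pi] using this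
  rw [ae_all_iff]
  intro k
  filter_upwards [(Filter.eventually_all_finset T).2 (h k)] with x hx hxT
  exact hx _ hxT rfl

open Classical in
-- Almost every point avoids the grid hyperplanes and the faces where a coordinate equals one, and
-- for such points `Y` agrees with the disjoint union of the atoms in `B`.
lemma sum_norm_atomMap_sq {d : ℕ} (T : Finset ℝ) (B : Set (Fin d → Set T)) {Y : Set (Fin d → ℝ)}
    (hY : Y ⊆ Set.Icc 0 1) (hYB : ∀ x ∈ Set.Icc (0 : Fin d → ℝ) 1, (∀ k, x k ∉ T) →
      (x ∈ Y ↔ (fun k => gridPos T (x k)) ∈ B)) (v : (Fin d → ℤ) →₀ ℂ) :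
    ∑ p with p ∈ B, ‖atomMap T d p v‖ ^ 2 = ∫ x in Y, ‖trigPoly d v x‖ ^ 2 := by
  have hmem : ∀ (p : Fin d → Set T) x, x ∈ atom T p ↔
      (∀ k, x k ∈ Set.Ico (0 : ℝ) 1) ∧ (fun k => gridPos T (x k)) = p := by
    intro p x
    simp only [atom, Set.mem_univ_pi, Set.mem_inter_iff, Set.mem_preimage, Set.mem_singleton_iff,
      forall_and, funext_iff]
  simp only [norm_atomMap_sq]
  rw [← integral_biUnion_finset _ (fun p _ => measurableSet_atom T p)]
  · refine setIntegral_congr_set ?_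
    filter_upwards [ae_forall_notMem (d := d) (insert 1 T)] with x hx
    refine propext ?_
    change x ∈ (⋃ p ∈ _, _) ↔ x ∈ Y
    simp only [Set.mem_iUnion, Finset.mem_filter, Finset.mem_univ, true_and, hmem, exists_prop]
    have hxT : ∀ k, x k ∉ T := fun k hk => hx k (Finset.mem_insert_of_mem hk)
    constructor
    · rintro ⟨p, hp, hx1, rfl⟩
      exact (hYB x ⟨fun k => (hx1 k).1, fun k => (hx1 k).2.le⟩ hxT).2 hp
    · intro hxY
      have hxI := hY hxY
      refine ⟨_, (hYB x hxI hxT).1 hxY, fun k => ⟨hxI.1 k, lt_of_le_of_ne (hxI.2 k) fun h => ?_⟩, rfl⟩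
      exact hx k (by rw [h]; exact Finset.mem_insert_self _ _)
  · intro p _ q _ hpq
    refine Set.disjoint_left.2 fun x hxp hxq => hpq ?_
    rw [← ((hmem p x).1 hxp).2, ← ((hmem q x).1 hxq).2]
  · intro p _
    have := memLp_indicator_trigPoly (measurableSet_atom T p) (volume_atom_lt_top T p) v 2
    rw [memLp_indicator_iff_restrict (measurableSet_atom T _)] at this
    exact (memLp_two_iff_integrable_sq_norm this.1).1 this

end Rectangles
end

end CoherentRiesz

/-! ### Assembly of the theorem. -/

open CoherentRiesz in
theorem mainTheorem2 {ι : Type*} [Finite ι] (d : ℕ) (X : ι → Set (Fin d → ℝ))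
    (hX : ∀ i, X i ⊆ Set.Icc 0 1) (hrect : ∀ i, IsFiniteUnionOfRectangles (X i)) :
    ∃ Ξ : ι → Set (Fin d → ℤ), IsCoherentCollection X Ξ := by
  classical
  have := Fintype.ofFinite ι
  choose T₀ hT₀ using fun i => exists_isAdapted (hrect i)
  set T : Finset ℝ := Finset.univ.biUnion T₀ with hTdef
  have hT : ∀ i, IsAdapted T (X i) := fun i =>
    (hT₀ i).mono (Finset.subset_biUnion_of_mem T₀ (Finset.mem_univ i))
  obtain ⟨Ξ, C, hC, hmono, hΞ, hΞ'⟩ := exists_coherent_grid T d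
  -- Taking the atoms that meet `X i` off the grid makes `B` visibly monotone under inclusion;
  -- adaptedness gives the converse, that off the grid `X i` is exactly this union.
  let B : ι → Set (Fin d → Set T) := fun i =>
    {p | ∃ x ∈ X i, (∀ k, x k ∉ T) ∧ (fun k => gridPos T (x k)) = p}
  have hXB : ∀ i x, (∀ k, x k ∉ T) → (x ∈ X i ↔ (fun k => gridPos T (x k)) ∈ B i) := by
    intro i x hx
    refine ⟨fun hxX => ⟨x, hxX, hx, rfl⟩, fun ⟨y, hyX, hy, hyx⟩ => hT i y x hy hx ?_ hyX⟩
    intro k f hf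
    exact Set.ext_iff.1 (congrFun hyx k) ⟨f, hf⟩
  have hm : ∀ i, MeasurableSet (X i) := fun i =>
    measurableSet_of_isFiniteUnionOfRectangles (hrect i)
  have hcube : ∀ v, nsq (atomMap T d) v = ∫ x, ‖trigPoly d v x‖ ^ 2 ∂cubeMeasure d := by
    intro v
    rw [← sum_norm_atomMap_sq T Set.univ subset_rfl (fun x hx _ => by simp [hx]), nsq]
    simp
  refine ⟨fun i => Ξ (B i), fun i => ?_, fun i j hij => hmono ?_⟩
  · have hres : (cubeMeasure d).restrict (X i) = volume.restrict (X i) := by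
      rw [Measure.restrict_restrict (hm i), Set.inter_eq_left.2 (hX i)]
    have h : IsExpRieszBasisOf (Ξ (B i)) ((cubeMeasure d).restrict (X i)) := by
      refine isExpRieszBasisOf_restrict (hm i) hC (fun v hv => ?_) fun v hv => ?_
      · rw [hres, ← hcube, ← sum_norm_atomMap_sq T (B i) (hX i) fun x _ hx => hXB i x hx]
        exact hΞ (B i) v hv
      -- Inside the cube, and off the grid, the complement of `X i` corresponds to the complementary
      -- set of atoms.
      · rw [Measure.restrict_restrict (hm i).compl, ← hcube,
          ← sum_norm_atomMap_sq T (B i)ᶜ Set.inter_subset_right fun x hxI hx => by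
            rw [Set.mem_compl_iff, ← hXB i x hx]; simp [hxI]]
        exact hΞ' (B i) v hv
    rw [hres] at h
    exact h
  · rintro p ⟨x, hx, hxT, rfl⟩
    exact ⟨x, hij hx, hxT, rfl⟩
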